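/- All vector spaces and algebras are finite-dimensional over $\mathbb C$, and products not listed are zero. A Leibniz algebra is a vector space with a bilinear bracket satisfying $[x,[y,z]]=[[x,y],z]-[[x,z],y]$. Its nilradical is its largest nilpotent two-sided ideal. For $n\ge 4$ and $\alpha,\beta,\gamma\in\mathbb C$ let $\mathcal G(\alpha,\beta,\gamma)$ be the algebra with basis $e_1,\dots,e_n$ and products $$[e_1,e_1]=e_2,\quad [e_i,e_1]=e_{i+1}\ (3\le i\le n-1),\quad [e_1,e_3]=-e_4+\beta e_2,\quad [e_1,e_i]=-e_{i+1}\ (4\le i\le n-1),$$ $$[e_3,e_3]=\gamma e_2,\quad [e_i,e_{n+2-i}]=(-1)^i\alpha e_n\ (3\le i\le n-1),$$ where $\alpha\in\{0,1\}$ if $n$ is odd and $\alpha=0$ if $n$ is even. Let $H^1_{n+2}(0,0,0)$, $H^2_{n+2}(0,1,0)$, $H^3_{n+2}(0,2,1)$ and, for odd $n$ only, $H^4_{n+2}(1,0,0)$, $H^5_{n+2}(1,1,0)$, $H^6_{n+2}(1,2,1)$ be the algebras $H^k_{n+2}(\alpha,\beta,\gamma)$ with basis $e_1,\dots,e_n,x,y$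 in which the $e_i$ multiply as in $\mathcal G(\alpha,\beta,\gamma)$ and whose other nonzero products are the following. * $H^1$: $[e_1,x]=e_1$, $[e_2,x]=2e_2$, $[x,e_1]=-e_1$, and $[e_i,x]=(i-3)e_i$, $[x,e_i]=-(i-3)e_i$, $[e_i,y]=e_i$, $[y,e_i]=-e_i$ for $3\le i\le n$. * $H^2$: $[e_1,x]=e_1-e_3$, $[e_2,x]=e_2$, $[e_i,x]=(i-3)e_i$ $(4\le i\le n)$; $[x,e_1]=-e_1+e_3$, $[x,e_4]=-e_4+e_2$, $[x,e_i]=-(i-3)e_i$ $(5\le i\le n)$; $[e_1,y]=e_3$, $[e_i,y]=e_i$ $(2\le i\le n)$; $[y,e_1]=-e_3$, $[y,e_i]=-e_i$ $(3\le i\le n)$. * $H^3$: $[e_1,x]=e_1-e_3$, $[e_4,x]=e_4-e_2$, $[e_i,x]=(i-3)e_i$ $(5\le i\le n)$; $[x,e_1]=-e_1+e_3$, $[x,e_4]=-e_4+e_2$, $[x,e_i]=-(i-3)e_i$ $(5\le i\le n)$; $[e_1,y]=e_3$, $[e_2,y]=2e_2$, $[e_3,y]=e_3$, $[e_4,y]=e_4+e_2$,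 $[e_i,y]=e_i$ $(5\le i\le n)$; $[y,e_1]=-e_3$, $[y,e_3]=-e_3$, $[y,e_4]=-e_4+e_2$, $[y,e_i]=-e_i$ $(5\le i\le n)$. * $H^4$: $[e_1,x]=e_1-e_3$, $[e_2,x]=2e_2$, $[e_i,x]=(i-3)e_i$ $(4\le i\le n-1)$, $[e_n,x]=(n-4)e_n$; $[x,e_1]=-e_1+e_3$, $[x,e_i]=-(i-3)e_i$ $(4\le i\le n-1)$, $[x,e_n]=-(n-4)e_n$; $[e_1,y]=e_3$, $[e_i,y]=e_i$ $(3\le i\le n-1)$, $[e_n,y]=2e_n$; $[y,e_1]=-e_3$, $[y,e_i]=-e_i$ $(3\le i\le n-1)$, $[y,e_n]=-2e_n$. * $H^5$: $[e_1,x]=e_1-e_3$, $[e_2,x]=e_2$, $[e_i,x]=(i-3)e_i$ $(4\le i\le n-1)$, $[e_n,x]=(n-4)e_n$; $[x,e_1]=-e_1+e_3$, $[x,e_4]=-e_4+e_2$, $[x,e_i]=-(i-3)e_i$ $(5\le i\le n-1)$, $[x,e_n]=-(n-4)e_n$; $[e_1,y]=e_3$, $[e_i,y]=e_i$ $(2\le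 i\le n-1)$, $[e_n,y]=2e_n$; $[y,e_1]=-e_3$, $[y,e_i]=-e_i$ $(3\le i\le n-1)$, $[y,e_n]=-2e_n$. * $H^6$: $[e_1,x]=e_1-e_3$, $[e_4,x]=e_4-e_2$, $[e_i,x]=(i-3)e_i$ $(5\le i\le n-1)$, $[e_n,x]=(n-4)e_n$; $[x,e_1]=-e_1+e_3$, $[x,e_4]=-e_4+e_2$, $[x,e_i]=-(i-3)e_i$ $(5\le i\le n-1)$, $[x,e_n]=-(n-4)e_n$; $[e_1,y]=e_3$, $[e_2,y]=2e_2$, $[e_3,y]=e_3$, $[e_4,y]=e_4+e_2$, $[e_i,y]=e_i$ $(5\le i\le n-1)$, $[e_n,y]=2e_n$; $[y,e_1]=-e_3$, $[y,e_3]=-e_3$, $[y,e_4]=-e_4+e_2$, $[y,e_i]=-e_i$ $(5\le i\le n-1)$, $[y,e_n]=-2e_n$. **Theorem.** Let $n\ge 4$. Every solvable Leibniz algebra $R$ whose nilradical is isomorphic to some $\mathcal G(\alpha,\beta,\gamma)$ as above, and in which the complementary subspace to the nilradical has dimension two (the largest possible), is isomorphic to one of the algebras $H^1_{n+2}(0,0,0),\dots,H^6_{n+2}(1,2,1)$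 (the last three only if $n$ is odd). Conversely, each of these algebras $H^k_{n+2}(\alpha,\beta,\gamma)$ is a solvable Leibniz algebra whose nilradical is isomorphic to $\mathcal G(\alpha,\beta,\gamma)$ and has a two-dimensional complementary subspace. If $n\ge 6$, these algebras are pairwise non-isomorphic. -/

import Mathlib

namespace LeibnizAlg

/-- A bilinear multiplication `[·,·]` on a complex vector space. -/
abbrev Mul₂ (L : Type*) [AddCommGroup L] [Module ℂ L] := L →ₗ[ℂ] L →ₗ[ℂ] L

section General

variable {L : Type*} [AddCommGroup L] [Module ℂ L]

/-- The (right) Leibniz identity `[x,[y,z]] = [[x,y],z] - [[x,z],y]`. -/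
def IsLeibniz (br : Mul₂ L) : Prop :=
  ∀ x y z : L, br x (br y z) = br (br x y) z - br (br x z) y

/-- The lower central series of `S`: `lowerSeries br S k` is `S^{k+1}`, that is
`S^1 = S` and `S^{k+1} = [S^k, S]` (the span of the products). -/
def lowerSeries (br : Mul₂ L) (S : Submodule ℂ L) : ℕ → Submodule ℂ L
  | 0 => S
  | k + 1 => Submodule.map₂ br (lowerSeries br S k) S

/-- The derived series of the whole algebra: `derivedSeries br s` is `L^{[s+1]}`, that is
`L^{[1]} = L` and `L^{[s+1]} = [L^{[s]}, L^{[s]}]`. -/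
def derivedSeries (br : Mul₂ L) : ℕ → Submodule ℂ L
  | 0 => ⊤
  | s + 1 => Submodule.map₂ br (derivedSeries br s) (derivedSeries br s)

def IsSolvable (br : Mul₂ L) : Prop := ∃ s, derivedSeries br s = ⊥

/-- Two-sided ideals. -/
def IsIdeal (br : Mul₂ L) (I : Submodule ℂ L) : Prop :=
  ∀ a ∈ I, ∀ b : L, br a b ∈ I ∧ br b a ∈ I

/-- Ideals that are nilpotent as algebras. -/
def IsNilpotentIdeal (br : Mul₂ L) (I : Submodule ℂ L) : Prop :=
  IsIdeal br I ∧ ∃ k, lowerSeries br I k = ⊥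

/-- `N` is the nilradical: the largest nilpotent ideal. -/
def IsNilradical (br : Mul₂ L) (N : Submodule ℂ L) : Prop :=
  IsGreatest {I : Submodule ℂ L | IsNilpotentIdeal br I} N

/-- Isomorphism of algebras. -/
def Iso {L' : Type*} [AddCommGroup L'] [Module ℂ L'] (br : Mul₂ L) (br' : Mul₂ L') : Prop :=
  ∃ φ : L ≃ₗ[ℂ] L', ∀ a b : L, φ (br a b) = br' (φ a) (φ b)

/-- The subspace `N` of `(L, br)`, with the multiplication inherited from `L`, is isomorphic to
the algebra `(L', br')`. -/
def SubIso {L' : Type*} [AddCommGroup L'] [Module ℂ L'] (br : Mul₂ L) (N : Submodule ℂ L)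
    (br' : Mul₂ L') : Prop :=
  ∃ φ : L' ≃ₗ[ℂ] N, ∀ a b : L', ((φ (br' a b) : N) : L) = br (φ a) (φ b)

/-- `(L, br)` is a solvable Leibniz algebra with a nilradical isomorphic to `(L', br')` and with a
two-dimensional complementary space to the nilradical. -/
def HasNilradicalCodimTwo {L' : Type*} [AddCommGroup L'] [Module ℂ L'] (br : Mul₂ L)
    (br' : Mul₂ L') : Prop :=
  IsLeibniz br ∧ IsSolvable br ∧
    ∃ N Q : Submodule ℂ L, IsNilradical br N ∧ SubIso br N br' ∧
      IsCompl N Q ∧ Module.finrank ℂ Q = 2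

end General

/-- The basis vector `e_k` of `ℂ^m`, with `k` counted from `1` (and `0` if `k` is not in
`{1, …, m}`). -/
def e {m : ℕ} (k : ℕ) : Fin m → ℂ := fun i => if (i : ℕ) + 1 = k then 1 else 0

/-- The bilinear multiplication on `ℂ^m` with `[e_i, e_j] = T i j` for `1 ≤ i, j ≤ m`. -/
noncomputable def ofTable {m : ℕ} (T : ℕ → ℕ → Fin m → ℂ) : Mul₂ (Fin m → ℂ) :=
  (Pi.basisFun ℂ (Fin m)).constr ℂ fun i =>
    (Pi.basisFun ℂ (Fin m)).constr ℂ fun j => T ((i : ℕ) + 1) ((j : ℕ) + 1)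

/-- `ofTable T` has the multiplication table `T`. -/
theorem ofTable_e {m : ℕ} (T : ℕ → ℕ → Fin m → ℂ) (i j : ℕ)
    (hi : 1 ≤ i) (him : i ≤ m) (hj : 1 ≤ j) (hjm : j ≤ m) :
    ofTable T (e i) (e j) = T i j := by
  have key : ∀ k : ℕ, ∀ (h1 : 1 ≤ k) (hk : k ≤ m),
      (e k : Fin m → ℂ) = Pi.basisFun ℂ (Fin m) ⟨k - 1, by omega⟩ := by
    intro k h1 hk
    ext l
    simp only [e, Pi.basisFun_apply, Pi.single_apply, Fin.ext_iff]
    congr 1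
    exact propext ⟨fun h => by omega, fun h => by omega⟩
  rw [key i hi him, key j hj hjm, ofTable, Module.Basis.constr_basis, Module.Basis.constr_basis]
  simp only [Nat.sub_add_cancel hi, Nat.sub_add_cancel hj]

/-- The products `[e_i, e_j]` of the algebra `G(α, β, γ)` with basis `e_1, …, e_n`
(with values in any `ℂ^m`, so that it can also be used inside a larger algebra). -/
noncomputable def gTable (n : ℕ) (α β γ : ℂ) {m : ℕ} (i j : ℕ) : Fin m → ℂ :=
  (if i = 1 ∧ j = 1 then e 2 else 0)
  + (if 3 ≤ i ∧ i + 1 ≤ n ∧ j = 1 then e (i + 1) else 0)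
  + (if i = 1 ∧ j = 3 then -e 4 + β • e 2 else 0)
  + (if i = 1 ∧ 4 ≤ j ∧ j + 1 ≤ n then -e (j + 1) else 0)
  + (if i = 3 ∧ j = 3 then γ • e 2 else 0)
  + (if 3 ≤ i ∧ i + 1 ≤ n ∧ i + j = n + 2 then ((-1) ^ i * α) • e n else 0)

/-- The `n`-dimensional algebra `G(α, β, γ)`. -/
noncomputable def G (n : ℕ) (α β γ : ℂ) : Mul₂ (Fin n → ℂ) := ofTable (gTable n α β γ)

/-- The algebra with basis `e_1, …, e_n, x = e_{n+1}, y = e_{n+2}` in which the `e_i` multiply as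
in `G(α, β, γ)`, in which `[e_i, x] = rx i`, `[x, e_i] = lx i`, `[e_i, y] = ry i`,
`[y, e_i] = ly i` for `1 ≤ i ≤ n`, and in which `[x,x] = [x,y] = [y,x] = [y,y] = 0`. -/
noncomputable def extend (n : ℕ) (α β γ : ℂ) (rx lx ry ly : ℕ → Fin (n + 2) → ℂ) :
    Mul₂ (Fin (n + 2) → ℂ) :=
  ofTable fun i j =>
    if i ≤ n ∧ j ≤ n then gTable n α β γ i j
    else if i ≤ n ∧ j = n + 1 then rx i
    else if i = n + 1 ∧ j ≤ n then lx j
    else if i ≤ n ∧ j = n + 2 then ry i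
    else if i = n + 2 ∧ j ≤ n then ly j
    else 0

/-- `H^1_{n+2}(0,0,0)` -/
noncomputable def H1 (n : ℕ) : Mul₂ (Fin (n + 2) → ℂ) :=
  extend n 0 0 0
    (fun i => if i = 1 then e 1 else if i = 2 then (2 : ℂ) • e 2 else ((i : ℂ) - 3) • e i)
    (fun i => if i = 1 then -e 1 else if i = 2 then 0 else -((i : ℂ) - 3) • e i)
    (fun i => if i = 1 then 0 else if i = 2 then 0 else e i)
    (fun i => if i = 1 then 0 else if i = 2 then 0 else -e i)

/-- `H^2_{n+2}(0,1,0)` -/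
noncomputable def H2 (n : ℕ) : Mul₂ (Fin (n + 2) → ℂ) :=
  extend n 0 1 0
    (fun i => if i = 1 then e 1 - e 3 else if i = 2 then e 2 else ((i : ℂ) - 3) • e i)
    (fun i => if i = 1 then -e 1 + e 3 else if i = 2 then 0 else if i = 4 then -e 4 + e 2
      else -((i : ℂ) - 3) • e i)
    (fun i => if i = 1 then e 3 else e i)
    (fun i => if i = 1 then -e 3 else if i = 2 then 0 else -e i)

/-- `H^3_{n+2}(0,2,1)` -/
noncomputable def H3 (n : ℕ) : Mul₂ (Fin (n + 2) → ℂ) :=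
  extend n 0 2 1
    (fun i => if i = 1 then e 1 - e 3 else if i = 2 then 0 else if i = 4 then e 4 - e 2
      else ((i : ℂ) - 3) • e i)
    (fun i => if i = 1 then -e 1 + e 3 else if i = 2 then 0 else if i = 4 then -e 4 + e 2
      else -((i : ℂ) - 3) • e i)
    (fun i => if i = 1 then e 3 else if i = 2 then (2 : ℂ) • e 2 else if i = 4 then e 4 + e 2
      else e i)
    (fun i => if i = 1 then -e 3 else if i = 2 then 0 else if i = 4 then -e 4 + e 2
      else -e i)

/-- `H^4_{n+2}(1,0,0)` (used for odd `n`) -/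
noncomputable def H4 (n : ℕ) : Mul₂ (Fin (n + 2) → ℂ) :=
  extend n 1 0 0
    (fun i => if i = 1 then e 1 - e 3 else if i = 2 then (2 : ℂ) • e 2
      else if i = n then ((n : ℂ) - 4) • e n else ((i : ℂ) - 3) • e i)
    (fun i => if i = 1 then -e 1 + e 3 else if i = 2 then 0
      else if i = n then -((n : ℂ) - 4) • e n else -((i : ℂ) - 3) • e i)
    (fun i => if i = 1 then e 3 else if i = 2 then 0
      else if i = n then (2 : ℂ) • e n else e i)
    (fun i => if i = 1 then -e 3 else if i = 2 then 0
      else if i = n then -(2 : ℂ) • e n else -e i)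

/-- `H^5_{n+2}(1,1,0)` (used for odd `n`) -/
noncomputable def H5 (n : ℕ) : Mul₂ (Fin (n + 2) → ℂ) :=
  extend n 1 1 0
    (fun i => if i = 1 then e 1 - e 3 else if i = 2 then e 2
      else if i = n then ((n : ℂ) - 4) • e n else ((i : ℂ) - 3) • e i)
    (fun i => if i = 1 then -e 1 + e 3 else if i = 2 then 0 else if i = 4 then -e 4 + e 2
      else if i = n then -((n : ℂ) - 4) • e n else -((i : ℂ) - 3) • e i)
    (fun i => if i = 1 then e 3 else if i = n then (2 : ℂ) • e n else e i)
    (fun i => if i = 1 then -e 3 else if i = 2 then 0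
      else if i = n then -(2 : ℂ) • e n else -e i)

/-- `H^6_{n+2}(1,2,1)` (used for odd `n`) -/
noncomputable def H6 (n : ℕ) : Mul₂ (Fin (n + 2) → ℂ) :=
  extend n 1 2 1
    (fun i => if i = 1 then e 1 - e 3 else if i = 2 then 0 else if i = 4 then e 4 - e 2
      else if i = n then ((n : ℂ) - 4) • e n else ((i : ℂ) - 3) • e i)
    (fun i => if i = 1 then -e 1 + e 3 else if i = 2 then 0 else if i = 4 then -e 4 + e 2
      else if i = n then -((n : ℂ) - 4) • e n else -((i : ℂ) - 3) • e i)
    (fun i => if i = 1 then e 3 else if i = 2 then (2 : ℂ) • e 2 else if i = 4 then e 4 + e 2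
      else if i = n then (2 : ℂ) • e n else e i)
    (fun i => if i = 1 then -e 3 else if i = 2 then 0 else if i = 4 then -e 4 + e 2
      else if i = n then -(2 : ℂ) • e n else -e i)

/-- The six algebras; `H n k` is `H^{k+1}_{n+2}`. -/
noncomputable def H (n : ℕ) : Fin 6 → Mul₂ (Fin (n + 2) → ℂ) :=
  ![H1 n, H2 n, H3 n, H4 n, H5 n, H6 n]

/-- The nilradicals `G(α, β, γ)` belonging to the six algebras. -/
noncomputable def GH (n : ℕ) : Fin 6 → Mul₂ (Fin n → ℂ) :=
  ![G n 0 0 0, G n 0 1 0, G n 0 2 1, G n 1 0 0, G n 1 1 0, G n 1 2 1]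

/-- The algebras with `α = 1` (the last three) occur for odd `n` only. -/
def Occurs (n : ℕ) (k : Fin 6) : Prop := 3 ≤ (k : ℕ) → Odd n

end LeibnizAlg

/-! Write `n = M + 3`, `E = e_1`, `U = e_2` and `g i = e_{i+3}`, and let `N` be the nilradical. The
Leibniz identity says that every right multiplication `[·, z]` is a derivation. Since `N` is
generated by `E` and `g 0`, this derivation is triangular on `N`, with all eigenvalues determined by
two characters: `A(z)` on `E` and `B(z)` on `g 0` (`Extension.sub_mem_g`). The eigenvalue on `U`
comes from the symmetrised product on `N`, which is a quadratic form in the `E`- and `g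
0`-coordinates with values in the line of `U`.

An element outside `N` on which both characters vanish would lead to a nilpotent ideal larger than
`N`. So the common kernel is `N`, and codimension two makes `(A, B)` surjective onto `ℂ²`
(`Extension.exists_ch_eq`). Choose `z` with `A(z) = 1` and `B(z) = 3/2`. Then `[·, z]` is invertible
on `N` with simple eigenvalues `1` and `3/2`. The elements with `[w, z] = 0` supply a torus `X, Y`
with zero brackets, and the two eigenvectors `f, G` are joint weight vectors of weights `(1,0)` and
`(0,1)` generating `N` (`Extension.exists_weightData`).

Weights now fix all structure constants. `U` has weight `(2,0)`, `(1,1)` or `(0,2)`, so exactly one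
coefficient of the quadratic form survives and can be scaled to `1`. The last `g` has weight
`(M,1)`, or `(M-1,2)` when it arises as a product of two `g`'s. The algebra therefore has a
multiplication table `Model` with parameters `a, b, c, ε`: six cases (`WeightData.exists_model`,
`Model.iso`).

Conversely, each `H^k` is such a model in the basis starting with `e_1 - σ e_3`, and solvability,
the nilradical and the Leibniz identity are verified once for all models. For `M ≥ 3` the parameters
are isomorphism invariants, because the flag of the core, the span of `g 0` with the derived ideal
of the core, and that derived ideal is preserved (`Model.params_of_equiv`). -/

namespace LeibnizAlg

open Module Submodule

set_option linter.unusedSimpArgs false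

/-! ### Adapted bases: coordinates, the core and the descending tails. -/

section Frame

variable {L : Type*} [AddCommGroup L] [Module ℂ L]

/-- The vectors `f, u, x, y, g 0, …, g M` form a basis of `L`, and `g i = 0` for `i > M`. -/
structure Frame (M : ℕ) (f u x y : L) (g : ℕ → L) : Prop where
  g_zero : ∀ i, M < i → g i = 0
  span_eq : span ℂ ({f, u, x, y} ∪ Set.range g) = ⊤
  finrank_eq : finrank ℂ L = M + 5

/-- The span of `f`, `u` and all `g i`. -/
def core (f u : L) (g : ℕ → L) : Submodule ℂ L := span ℂ ({f, u} ∪ Set.range g)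

/-- The span of `u` and the `g i` with `i ≥ k`. -/
def tail (u : L) (g : ℕ → L) (k : ℕ) : Submodule ℂ L := span ℂ (insert u (g '' Set.Ici k))

namespace Frame

variable {M : ℕ} {f u x y : L} {g : ℕ → L}

/-- The family of the basis vectors of a frame. -/
def family (M : ℕ) (f u x y : L) (g : ℕ → L) : Fin 4 ⊕ Fin (M + 1) → L :=
  Sum.elim ![f, u, x, y] fun i => g i

theorem range_family (h : Frame M f u x y g) :
    ⊤ ≤ span ℂ (Set.range (family M f u x y g)) := by
  rw [← h.span_eq, span_le]
  rintro v (hv | ⟨i, rfl⟩)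
  · simp only [Set.mem_insert_iff, Set.mem_singleton_iff] at hv
    rcases hv with rfl | rfl | rfl | rfl
    exacts [subset_span ⟨.inl 0, rfl⟩, subset_span ⟨.inl 1, rfl⟩, subset_span ⟨.inl 2, rfl⟩,
      subset_span ⟨.inl 3, rfl⟩]
  · by_cases hi : M < i
    · simp [h.g_zero i hi]
    · exact subset_span ⟨.inr ⟨i, by omega⟩, rfl⟩

/-- The basis attached to a frame. -/
noncomputable def basis (h : Frame M f u x y g) : Basis (Fin 4 ⊕ Fin (M + 1)) ℂ L :=
  basisOfTopLeSpanOfCardEqFinrank (family M f u x y g) h.range_family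
    (by simp [h.finrank_eq]; omega)

theorem basis_apply (h : Frame M f u x y g) (i) : h.basis i = family M f u x y g i := by
  simp [basis]

theorem finiteDimensional (h : Frame M f u x y g) : FiniteDimensional ℂ L :=
  .of_finrank_pos (by rw [h.finrank_eq]; omega)

theorem basis_f (h : Frame M f u x y g) : h.basis (.inl 0) = f := h.basis_apply _
theorem basis_u (h : Frame M f u x y g) : h.basis (.inl 1) = u := h.basis_apply _
theorem basis_x (h : Frame M f u x y g) : h.basis (.inl 2) = x := h.basis_apply _
theorem basis_y (h : Frame M f u x y g) : h.basis (.inl 3) = y := h.basis_apply _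
theorem basis_g (h : Frame M f u x y g) (i : Fin (M + 1)) : h.basis (.inr i) = g i :=
  h.basis_apply _

/-- The coordinate of `f`. -/
noncomputable def cf (h : Frame M f u x y g) : L →ₗ[ℂ] ℂ := h.basis.coord (.inl 0)
/-- The coordinate of `u`. -/
noncomputable def cu (h : Frame M f u x y g) : L →ₗ[ℂ] ℂ := h.basis.coord (.inl 1)
/-- The coordinate of `x`. -/
noncomputable def cx (h : Frame M f u x y g) : L →ₗ[ℂ] ℂ := h.basis.coord (.inl 2)
/-- The coordinate of `y`. -/
noncomputable def cy (h : Frame M f u x y g) : L →ₗ[ℂ] ℂ := h.basis.coord (.inl 3)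
/-- The coordinate of `g i`. -/
noncomputable def cg (h : Frame M f u x y g) (i : ℕ) : L →ₗ[ℂ] ℂ :=
  if hi : i < M + 1 then h.basis.coord (.inr ⟨i, hi⟩) else 0

theorem coord_family (h : Frame M f u x y g) (j i) :
    h.basis.coord j (family M f u x y g i) = if j = i then 1 else 0 := by
  rw [← h.basis_apply, Basis.coord_apply, Basis.repr_self, Finsupp.single_apply]
  simp [eq_comm]

theorem coord_f (h : Frame M f u x y g) (j) :
    h.basis.coord j f = if j = .inl 0 then 1 else 0 := h.coord_family j (.inl 0)
theorem coord_u (h : Frame M f u x y g) (j) :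
    h.basis.coord j u = if j = .inl 1 then 1 else 0 := h.coord_family j (.inl 1)
theorem coord_x (h : Frame M f u x y g) (j) :
    h.basis.coord j x = if j = .inl 2 then 1 else 0 := h.coord_family j (.inl 2)
theorem coord_y (h : Frame M f u x y g) (j) :
    h.basis.coord j y = if j = .inl 3 then 1 else 0 := h.coord_family j (.inl 3)
theorem coord_g (h : Frame M f u x y g) (j) (i : Fin (M + 1)) :
    h.basis.coord j (g i) = if j = .inr i then 1 else 0 := h.coord_family j (.inr i)
theorem coord_inl_g (h : Frame M f u x y g) (j) (i : ℕ) :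
    h.basis.coord (.inl j) (g i) = 0 := by
  by_cases hi : M < i
  · simp [h.g_zero i hi]
  · have := h.coord_g (.inl j) ⟨i, by omega⟩
    simpa using this

@[simp] theorem cf_f (h : Frame M f u x y g) : h.cf f = 1 := by simp only [cf, coord_f]; simp
@[simp] theorem cf_u (h : Frame M f u x y g) : h.cf u = 0 := by simp only [cf, coord_u]; simp
@[simp] theorem cf_g (h : Frame M f u x y g) (i) : h.cf (g i) = 0 := h.coord_inl_g _ i
@[simp] theorem cu_u (h : Frame M f u x y g) : h.cu u = 1 := by simp only [cu, coord_u]; simp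
@[simp] theorem cu_g (h : Frame M f u x y g) (i) : h.cu (g i) = 0 := h.coord_inl_g _ i
@[simp] theorem cx_f (h : Frame M f u x y g) : h.cx f = 0 := by simp only [cx, coord_f]; simp
@[simp] theorem cx_u (h : Frame M f u x y g) : h.cx u = 0 := by simp only [cx, coord_u]; simp
@[simp] theorem cx_x (h : Frame M f u x y g) : h.cx x = 1 := by simp only [cx, coord_x]; simp
@[simp] theorem cx_y (h : Frame M f u x y g) : h.cx y = 0 := by simp only [cx, coord_y]; simp
@[simp] theorem cx_g (h : Frame M f u x y g) (i) : h.cx (g i) = 0 := h.coord_inl_g _ i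
@[simp] theorem cy_f (h : Frame M f u x y g) : h.cy f = 0 := by simp only [cy, coord_f]; simp
@[simp] theorem cy_u (h : Frame M f u x y g) : h.cy u = 0 := by simp only [cy, coord_u]; simp
@[simp] theorem cy_x (h : Frame M f u x y g) : h.cy x = 0 := by simp only [cy, coord_x]; simp
@[simp] theorem cy_y (h : Frame M f u x y g) : h.cy y = 1 := by simp only [cy, coord_y]; simp
@[simp] theorem cy_g (h : Frame M f u x y g) (i) : h.cy (g i) = 0 := h.coord_inl_g _ i
@[simp] theorem cg_f (h : Frame M f u x y g) (i) : h.cg i f = 0 := by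
  unfold cg; split_ifs <;> simp [coord_f, -Basis.coord_apply]
@[simp] theorem cg_u (h : Frame M f u x y g) (i) : h.cg i u = 0 := by
  unfold cg; split_ifs <;> simp [coord_u, -Basis.coord_apply]
theorem cg_g (h : Frame M f u x y g) (i j) : h.cg i (g j) = if i = j ∧ j ≤ M then 1 else 0 := by
  unfold cg
  by_cases hj : M < j
  · rw [h.g_zero j hj, map_zero, if_neg (by omega)]
  · split_ifs with h1 h2 h2
    · have := h.coord_g (.inr ⟨i, h1⟩) ⟨j, by omega⟩
      simpa [h2.1, -Basis.coord_apply] using this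
    · have := h.coord_g (.inr ⟨i, h1⟩) ⟨j, by omega⟩
      have h3 : i ≠ j := by omega
      simpa [h3, -Basis.coord_apply] using this
    · omega
    · rfl
theorem cg_g_self (h : Frame M f u x y g) {i} (hi : i ≤ M) : h.cg i (g i) = 1 := by
  simp [cg_g, hi]
theorem cg_g_ne (h : Frame M f u x y g) {i j} (hi : i ≠ j) : h.cg i (g j) = 0 := by
  simp [cg_g, hi]

theorem expand (h : Frame M f u x y g) (v : L) :
    v = h.cf v • f + h.cu v • u + h.cx v • x + h.cy v • y
      + ∑ i ∈ Finset.range (M + 1), h.cg i v • g i := by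
  conv_lhs => rw [← h.basis.sum_repr v]
  rw [Fintype.sum_sum_type, Fin.sum_univ_four, Finset.sum_range, basis_f, basis_u, basis_x,
    basis_y]
  congr 1
  refine Finset.sum_congr rfl fun i _ => ?_
  rw [basis_g, cg, dif_pos i.2]
  rfl

theorem induction {p : L → Prop} (h : Frame M f u x y g) (hf : p f) (hu : p u) (hx : p x)
    (hy : p y) (hg : ∀ i, p (g i)) (hadd : ∀ v w, p v → p w → p (v + w))
    (hsmul : ∀ (c : ℂ) v, p v → p (c • v)) (v : L) : p v := by
  have hv : v ∈ span ℂ ({f, u, x, y} ∪ Set.range g) := by rw [h.span_eq]; trivial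
  induction hv using span_induction with
  | mem v hv =>
    rcases hv with hv | ⟨i, rfl⟩
    · simp only [Set.mem_insert_iff, Set.mem_singleton_iff] at hv
      rcases hv with rfl | rfl | rfl | rfl <;> assumption
    · exact hg i
  | zero => simpa using hsmul 0 _ hf
  | add v w _ _ hv hw => exact hadd v w hv hw
  | smul c v _ hv => exact hsmul c v hv

end Frame

theorem f_mem_core (f u : L) (g : ℕ → L) : f ∈ core f u g := subset_span (by simp)
theorem u_mem_core (f u : L) (g : ℕ → L) : u ∈ core f u g := subset_span (by simp)
theorem g_mem_core (f u : L) (g : ℕ → L) (i : ℕ) : g i ∈ core f u g := subset_span (by simp)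
theorem u_mem_tail (u : L) (g : ℕ → L) (k : ℕ) : u ∈ tail u g k := subset_span (by simp)
theorem g_mem_tail (u : L) (g : ℕ → L) {i k : ℕ} (hi : k ≤ i) : g i ∈ tail u g k :=
  subset_span (Or.inr ⟨i, hi, rfl⟩)

theorem core_le {f u : L} {g : ℕ → L} {S : Submodule ℂ L} (hf : f ∈ S) (hu : u ∈ S)
    (hg : ∀ i, g i ∈ S) : core f u g ≤ S := by
  rw [core, span_le]
  rintro v (hv | ⟨i, rfl⟩)
  · simp only [Set.mem_insert_iff, Set.mem_singleton_iff] at hv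
    rcases hv with rfl | rfl <;> assumption
  · exact hg i

theorem tail_le {u : L} {g : ℕ → L} {k : ℕ} {S : Submodule ℂ L} (hu : u ∈ S)
    (hg : ∀ i, k ≤ i → g i ∈ S) : tail u g k ≤ S := by
  rw [tail, span_le]
  rintro v (rfl | ⟨i, hi, rfl⟩)
  · exact hu
  · exact hg i hi

theorem tail_anti (u : L) (g : ℕ → L) {k l : ℕ} (hkl : k ≤ l) : tail u g l ≤ tail u g k :=
  tail_le (u_mem_tail u g k) fun _ hi => g_mem_tail u g (hkl.trans hi)

theorem tail_le_core (f u : L) (g : ℕ → L) (k : ℕ) : tail u g k ≤ core f u g :=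
  tail_le (u_mem_core f u g) fun i _ => g_mem_core f u g i

namespace Frame

variable {M : ℕ} {f u x y : L} {g : ℕ → L}

theorem mem_core_iff (h : Frame M f u x y g) (v : L) :
    v ∈ core f u g ↔ h.cx v = 0 ∧ h.cy v = 0 := by
  constructor
  · intro hv
    have : core f u g ≤ LinearMap.ker h.cx ⊓ LinearMap.ker h.cy :=
      core_le (by simp) (by simp) (by simp)
    simpa using this hv
  · rintro ⟨h1, h2⟩
    rw [h.expand v, h1, h2, zero_smul, zero_smul, add_zero, add_zero]
    refine add_mem (add_mem (smul_mem _ _ (f_mem_core f u g)) (smul_mem _ _ (u_mem_core f u g)))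
      (sum_mem fun i _ => smul_mem _ _ (g_mem_core f u g i))

theorem mem_tail_iff (h : Frame M f u x y g) (v : L) (k : ℕ) :
    v ∈ tail u g k ↔ v ∈ core f u g ∧ h.cf v = 0 ∧ ∀ i < k, h.cg i v = 0 := by
  constructor
  · intro hv
    refine ⟨tail_le_core _ _ _ _ hv, ?_, fun i hi => ?_⟩
    · have : tail u g k ≤ LinearMap.ker h.cf := tail_le (by simp) (by simp)
      simpa using this hv
    · have : tail u g k ≤ LinearMap.ker (h.cg i) :=
        tail_le (by simp) fun j hj => h.cg_g_ne (by omega)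
      simpa using this hv
  · rintro ⟨h0, h1, h2⟩
    rw [h.mem_core_iff] at h0
    rw [h.expand v, h0.1, h0.2, h1, zero_smul, zero_smul, zero_smul, zero_add, add_zero, add_zero]
    refine add_mem (smul_mem _ _ (u_mem_tail u g k)) (sum_mem fun i _ => ?_)
    by_cases hi : i < k
    · simp [h2 i hi]
    · exact smul_mem _ _ (g_mem_tail u g (by omega))

theorem sub_mem_tail_zero (h : Frame M f u x y g) {v : L} (hv : v ∈ core f u g) :
    v - h.cf v • f ∈ tail u g 0 := by
  rw [h.mem_tail_iff]
  exact ⟨sub_mem hv (smul_mem _ _ (f_mem_core f u g)), by simp, by simp⟩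

/-- Removes one leading coordinate at a time; iterated up to `k = M` it leaves only a multiple of
`u`. Beyond `M` both `g k` and its coordinate are zero, so no bound on `k` is needed. -/
theorem sub_mem_tail_succ (h : Frame M f u x y g) {v : L} {k : ℕ} (hv : v ∈ tail u g k) :
    v - h.cg k v • g k ∈ tail u g (k + 1) := by
  rw [h.mem_tail_iff] at hv ⊢
  refine ⟨sub_mem hv.1 (smul_mem _ _ (g_mem_core f u g k)), by simp [hv.2.1], fun i hi => ?_⟩
  rcases Nat.lt_succ_iff_lt_or_eq.1 hi with hi | rfl
  · simp [hv.2.2 i hi, h.cg_g_ne hi.ne]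
  · by_cases hM : i ≤ M
    · simp [h.cg_g_self hM]
    · simp [h.g_zero i (by omega), cg, hM]

theorem sub_mem_span_u (h : Frame M f u x y g) {v : L} (hv : v ∈ tail u g (M + 1)) :
    v = h.cu v • u := by
  have h1 : tail u g (M + 1) ≤ span ℂ {u} :=
    tail_le (subset_span rfl) fun i hi => by simp [h.g_zero i (by omega)]
  obtain ⟨c, rfl⟩ := mem_span_singleton.1 (h1 hv)
  simp

theorem u_ne_zero (h : Frame M f u x y g) : u ≠ 0 := fun h0 => by
  simpa using congrArg h.cu h0

theorem g_ne_zero (h : Frame M f u x y g) {i : ℕ} (hi : i ≤ M) : g i ≠ 0 := fun h0 => by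
  simpa [h.cg_g_self hi] using congrArg (h.cg i) h0

theorem isCompl_core (h : Frame M f u x y g) : IsCompl (core f u g) (span ℂ {x, y}) := by
  constructor
  · rw [Submodule.disjoint_def]
    intro v hv hv'
    obtain ⟨s, t, rfl⟩ := mem_span_pair.1 hv'
    have := (h.mem_core_iff _).1 hv
    simp at this
    simp [this]
  · rw [codisjoint_iff, eq_top_iff, ← h.span_eq, span_le]
    rintro v (hv | ⟨i, rfl⟩)
    · simp only [Set.mem_insert_iff, Set.mem_singleton_iff] at hv
      rcases hv with rfl | rfl | rfl | rfl
      · exact mem_sup_left (f_mem_core _ _ _)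
      · exact mem_sup_left (u_mem_core _ _ _)
      · exact mem_sup_right (subset_span (by simp))
      · exact mem_sup_right (subset_span (by simp))
    · exact mem_sup_left (g_mem_core _ _ _ _)

theorem finrank_span_pair (h : Frame M f u x y g) : finrank ℂ (span ℂ {x, y}) = 2 := by
  have hli : LinearIndependent ℂ ![x, y] := by
    rw [LinearIndependent.pair_iff]
    intro s t hst
    have h1 := congrArg h.cx hst
    have h2 := congrArg h.cy hst
    simp at h1 h2
    exact ⟨h1, h2⟩
  have := finrank_span_eq_card hli
  rw [Matrix.range_cons, Matrix.range_cons, Matrix.range_empty, Set.union_empty,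
    Set.singleton_union] at this
  simpa using this

theorem finrank_core (h : Frame M f u x y g) : finrank ℂ (core f u g) = M + 3 := by
  have := h.finiteDimensional
  have := finrank_add_eq_of_isCompl h.isCompl_core
  rw [h.finrank_span_pair, h.finrank_eq] at this
  omega

theorem linearMap_ext {W : Type*} [AddCommGroup W] [Module ℂ W] (h : Frame M f u x y g)
    {A B : L →ₗ[ℂ] W} (hf : A f = B f) (hu : A u = B u) (hx : A x = B x) (hy : A y = B y)
    (hg : ∀ i, A (g i) = B (g i)) : A = B := by
  ext v
  induction v using h.induction with
  | hadd v w hv hw => rw [map_add, map_add, hv, hw]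
  | hsmul c v hv => rw [map_smul, map_smul, hv]
  | hg i => exact hg i
  | _ => assumption

end Frame
end Frame

/-! ### Tables in a basis of weight vectors, and the Leibniz identity for them. -/

section Model

variable {L : Type*} [AddCommGroup L] [Module ℂ L]

/-- The coefficient of `g (i + 1)` in `[g i, f]`. -/
noncomputable def stepCoeff (M : ℕ) (ε : ℂ) (i : ℕ) : ℂ :=
  if i + 1 < M then 1 else if i + 1 = M then 1 - ε else 0
/-- The weight of `g i` with respect to `x`. -/
noncomputable def weightX (M : ℕ) (ε : ℂ) (i : ℕ) : ℂ := if i = M then M - ε else i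
/-- The weight of `g i` with respect to `y`. -/
noncomputable def weightY (M : ℕ) (ε : ℂ) (i : ℕ) : ℂ := if i = M then 1 + ε else 1

/-- The coefficient of `g M` in `[g i, g j]`. -/
noncomputable def pairCoeff (M : ℕ) (ε : ℂ) (i j : ℕ) : ℂ :=
  if i + j + 1 = M then (-1) ^ (i + 1) * ε else 0

section Coefficients

variable {M : ℕ} {ε : ℂ}

theorem stepCoeff_of_lt {i : ℕ} (hi : i + 1 < M) : stepCoeff M ε i = 1 := by
  simp [stepCoeff, hi]

theorem stepCoeff_last {i : ℕ} (hi : i + 1 = M) : stepCoeff M ε i = 1 - ε := by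
  simp [stepCoeff, hi]

theorem stepCoeff_of_le {i : ℕ} (hi : M ≤ i) : stepCoeff M ε i = 0 := by
  simp [stepCoeff, show ¬ i + 1 < M by omega, show ¬ i + 1 = M by omega]

theorem stepCoeff_zero (h1 : 1 ≤ M) (h : ε = 0 ∨ ε = 1 ∧ Even M) : stepCoeff M ε 0 = 1 := by
  by_cases hM : M = 1
  · subst hM
    rcases h with rfl | ⟨_, h2⟩
    · simp [stepCoeff]
    · exact absurd h2 (by decide)
  · exact stepCoeff_of_lt (by omega)

theorem weightX_of_ne {i : ℕ} (hi : i ≠ M) : weightX M ε i = i := by simp [weightX, hi]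
theorem weightY_of_ne {i : ℕ} (hi : i ≠ M) : weightY M ε i = 1 := by simp [weightY, hi]
theorem weightX_self : weightX M ε M = M - ε := by simp [weightX]
theorem weightY_self : weightY M ε M = 1 + ε := by simp [weightY]

theorem pairCoeff_of_ne {i j : ℕ} (h : i + j + 1 ≠ M) : pairCoeff M ε i j = 0 := by
  simp [pairCoeff, h]

/-- Additivity of weights is required only where a structure constant is nonzero, so this identity
and the next three carry that constant as a factor. -/
theorem stepCoeff_mul_weightX (h : ε = 0 ∨ ε = 1) (i : ℕ) :
    stepCoeff M ε i * weightX M ε (i + 1) = stepCoeff M ε i * (weightX M ε i + 1) := by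
  rcases lt_trichotomy (i + 1) M with hi | hi | hi
  · rw [weightX_of_ne (by omega), weightX_of_ne (by omega)]; push_cast; ring
  · rw [stepCoeff_last hi, hi, weightX_self, weightX_of_ne (by omega), ← hi]
    rcases h with rfl | rfl <;> push_cast <;> ring
  · rw [stepCoeff_of_le (by omega), zero_mul, zero_mul]

theorem stepCoeff_mul_weightY (h : ε = 0 ∨ ε = 1) (i : ℕ) :
    stepCoeff M ε i * weightY M ε (i + 1) = stepCoeff M ε i * weightY M ε i := by
  rcases lt_trichotomy (i + 1) M with hi | hi | hi
  · rw [weightY_of_ne (by omega), weightY_of_ne (by omega)]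
  · rw [stepCoeff_last hi, hi, weightY_self, weightY_of_ne (by omega)]
    rcases h with rfl | rfl <;> ring
  · rw [stepCoeff_of_le (by omega), zero_mul, zero_mul]

theorem pairCoeff_mul_weightX (h : ε = 0 ∨ ε = 1) (i j : ℕ) :
    pairCoeff M ε i j * weightX M ε M = pairCoeff M ε i j * (weightX M ε i + weightX M ε j) := by
  by_cases hi : i + j + 1 = M
  · rw [weightX_self, weightX_of_ne (by omega), weightX_of_ne (by omega), pairCoeff, if_pos hi,
      ← hi]
    rcases h with rfl | rfl <;> push_cast <;> ring
  · rw [pairCoeff_of_ne hi, zero_mul, zero_mul]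

theorem pairCoeff_mul_weightY (h : ε = 0 ∨ ε = 1) (i j : ℕ) :
    pairCoeff M ε i j * weightY M ε M = pairCoeff M ε i j * (weightY M ε i + weightY M ε j) := by
  by_cases hi : i + j + 1 = M
  · rw [weightY_self, weightY_of_ne (by omega), weightY_of_ne (by omega), pairCoeff, if_pos hi]
    rcases h with rfl | rfl <;> ring
  · rw [pairCoeff_of_ne hi, zero_mul, zero_mul]

/-- On the antidiagonal `i + j = M - 1` the sum is odd for even `M`, so `i` and `j` have opposite
parity and the two signs differ. -/
theorem pairCoeff_comm (h : ε = 0 ∨ ε = 1 ∧ Even M) (i j : ℕ) :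
    pairCoeff M ε i j = -pairCoeff M ε j i := by
  by_cases hi : i + j + 1 = M
  · rw [pairCoeff, if_pos hi, pairCoeff, if_pos (by omega)]
    rcases h with rfl | ⟨rfl, hM⟩
    · simp
    · subst hi
      rcases Nat.even_or_odd i with h1 | h1
      · have h2 : Odd j := by grind
        rw [h1.add_one.neg_one_pow, h2.add_one.neg_one_pow]; norm_num
      · have h2 : Even j := by grind
        rw [h1.add_one.neg_one_pow, h2.add_one.neg_one_pow]; norm_num
  · rw [pairCoeff_of_ne hi, pairCoeff_of_ne (by omega), neg_zero]

/-- This expresses that `[·, f]` is a derivation for the pairing of the `g i`. If `i + j + 2 = M`,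
both steps stay below the last one and have coefficient `1`. -/
theorem stepCoeff_mul_pairCoeff (i j : ℕ) :
    stepCoeff M ε i * pairCoeff M ε (i + 1) j = -(stepCoeff M ε j * pairCoeff M ε i (j + 1)) := by
  by_cases hi : i + j + 2 = M
  · rw [pairCoeff, if_pos (by omega), pairCoeff, if_pos (by omega), stepCoeff, stepCoeff]
    by_cases h1 : i + 1 = M
    · omega
    by_cases h2 : j + 1 = M
    · omega
    rw [if_pos (by omega), if_pos (by omega)]
    ring
  · rw [pairCoeff_of_ne (by omega), pairCoeff_of_ne (by omega), mul_zero, mul_zero, neg_zero]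

end Coefficients

/-- The multiplication table of the algebras under study in a basis of weight vectors:
`f` and `g 0` generate the nilradical, `u` spans the squares, `x` and `y` span a torus. -/
structure Model (br : Mul₂ L) (M : ℕ) (a b c ε : ℂ) (f u x y : L) (g : ℕ → L) : Prop
    extends Frame M f u x y g where
  one_le : 1 ≤ M
  type : (a = 1 ∧ b = 0 ∧ c = 0) ∨ (a = 0 ∧ b = 1 ∧ c = 0) ∨ (a = 0 ∧ b = 0 ∧ c = 1)
  eps : ε = 0 ∨ ε = 1 ∧ Even M
  ff : br f f = a • u
  fu : br f u = 0
  fx : br f x = f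
  fy : br f y = 0
  fg : ∀ i, br f (g i) = -(stepCoeff M ε i • g (i + 1)) + (if i = 0 then b else 0) • u
  uf : br u f = 0
  uu : br u u = 0
  ux : br u x = (2 * a + b) • u
  uy : br u y = (b + 2 * c) • u
  ug : ∀ i, br u (g i) = 0
  xf : br x f = -f
  xu : br x u = 0
  xx : br x x = 0
  xy : br x y = 0
  xg : ∀ i, br x (g i) = -(weightX M ε i • g i) + (if i = 1 then b else 0) • u
  yf : br y f = 0
  yu : br y u = 0
  yx : br y x = 0
  yy : br y y = 0
  yg : ∀ i, br y (g i) = -(weightY M ε i • g i)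
  gf : ∀ i, br (g i) f = stepCoeff M ε i • g (i + 1)
  gu : ∀ i, br (g i) u = 0
  gx : ∀ i, br (g i) x = weightX M ε i • g i
  gy : ∀ i, br (g i) y = weightY M ε i • g i
  gg : ∀ i j, br (g i) (g j) = (if i = 0 ∧ j = 0 then c else 0) • u +
    pairCoeff M ε i j • g M

namespace Model

variable {br : Mul₂ L} {M : ℕ} {a b c ε : ℂ} {f u x y : L} {g : ℕ → L}

theorem isLeibniz_of_frame (h : Frame M f u x y g)
    (H : ∀ p ∈ ({f, u, x, y} ∪ Set.range g : Set L), ∀ q ∈ ({f, u, x, y} ∪ Set.range g : Set L),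
      ∀ r ∈ ({f, u, x, y} ∪ Set.range g : Set L),
      br p (br q r) = br (br p q) r - br (br p r) q) : IsLeibniz br := by
  intro p q r
  have hp : p ∈ span ℂ ({f, u, x, y} ∪ Set.range g) := by rw [h.span_eq]; trivial
  have hq : q ∈ span ℂ ({f, u, x, y} ∪ Set.range g) := by rw [h.span_eq]; trivial
  have hr : r ∈ span ℂ ({f, u, x, y} ∪ Set.range g) := by rw [h.span_eq]; trivial
  induction hp, hq using span_induction₂ with
  | mem_mem p q hp hq =>
    induction hr using span_induction with
    | mem r hr => exact H p hp q hq r hr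
    | zero => simp
    | add v w _ _ h1 h2 => simp only [map_add, LinearMap.add_apply, h1, h2]; abel
    | smul t v _ h1 => simp only [map_smul, LinearMap.smul_apply, h1, smul_sub]
  | zero_left => simp
  | zero_right => simp
  | add_left p p' q _ _ _ h1 h2 => simp only [map_add, LinearMap.add_apply, h1, h2]; abel
  | add_right p q q' _ _ _ h1 h2 => simp only [map_add, LinearMap.add_apply, h1, h2]; abel
  | smul_left t p q _ _ h1 => simp only [map_smul, LinearMap.smul_apply, h1, smul_sub]
  | smul_right t p q _ _ h1 => simp only [map_smul, LinearMap.smul_apply, h1, smul_sub]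

set_option maxHeartbeats 1000000 in
theorem isLeibniz (h : Model br M a b c ε f u x y g) : IsLeibniz br := by
  have hM := h.one_le
  -- These six identities say that `u` has the weight of whichever product of `f` and `g 0` produces
  -- it: `(2,0)`, `(1,1)` or `(0,2)`.
  have haX : a * (2 * a + b) = 2 * a := by
    rcases h.type with ⟨rfl, rfl, rfl⟩ | ⟨rfl, rfl, rfl⟩ | ⟨rfl, rfl, rfl⟩ <;> norm_num
  have hbX : b * (2 * a + b) = b := by
    rcases h.type with ⟨rfl, rfl, rfl⟩ | ⟨rfl, rfl, rfl⟩ | ⟨rfl, rfl, rfl⟩ <;> norm_num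
  have hcX : c * (2 * a + b) = 0 := by
    rcases h.type with ⟨rfl, rfl, rfl⟩ | ⟨rfl, rfl, rfl⟩ | ⟨rfl, rfl, rfl⟩ <;> norm_num
  have haY : a * (b + 2 * c) = 0 := by
    rcases h.type with ⟨rfl, rfl, rfl⟩ | ⟨rfl, rfl, rfl⟩ | ⟨rfl, rfl, rfl⟩ <;> norm_num
  have hbY : b * (b + 2 * c) = b := by
    rcases h.type with ⟨rfl, rfl, rfl⟩ | ⟨rfl, rfl, rfl⟩ | ⟨rfl, rfl, rfl⟩ <;> norm_num
  have hcY : c * (b + 2 * c) = 2 * c := by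
    rcases h.type with ⟨rfl, rfl, rfl⟩ | ⟨rfl, rfl, rfl⟩ | ⟨rfl, rfl, rfl⟩ <;> norm_num
  have hz : g (M + 1) = 0 := h.g_zero _ (Nat.lt_succ_self M)
  have hε : ε = 0 ∨ ε = 1 := h.eps.imp_right And.left
  have hsX := fun i => stepCoeff_mul_weightX (M := M) hε i
  have hsY := fun i => stepCoeff_mul_weightY (M := M) hε i
  have hpX := fun i j => pairCoeff_mul_weightX (M := M) hε i j
  have hpY := fun i j => pairCoeff_mul_weightY (M := M) hε i j
  have hps := fun i j => stepCoeff_mul_pairCoeff (M := M) (ε := ε) i j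
  have hp1 := fun j => pairCoeff_of_ne (M := M) (ε := ε) (i := M) (j := j) (by omega)
  have hp2 := fun i => pairCoeff_of_ne (M := M) (ε := ε) (i := i) (j := M) (by omega)
  have hM0 : M ≠ 0 := by omega
  have hX0 : weightX M ε 0 = 0 := by rw [weightX_of_ne (by omega), Nat.cast_zero]
  have hY0 : weightY M ε 0 = 1 := weightY_of_ne (by omega)
  have hM1 : M = 1 → ε = 0 := by
    rintro rfl
    rcases h.eps with rfl | ⟨_, h2⟩
    · rfl
    · exact absurd h2 (by decide)
  have hX1 : weightX M ε 1 = 1 := by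
    by_cases h1 : M = 1
    · simp [weightX, h1, hM1 h1]
    · rw [weightX_of_ne (by omega), Nat.cast_one]
  have hY1 : weightY M ε 1 = 1 := by
    by_cases h1 : M = 1
    · simp [weightY, h1, hM1 h1]
    · rw [weightY_of_ne (by omega)]
  have hs0 : stepCoeff M ε 0 = 1 := stepCoeff_zero hM h.eps
  have hp3 : M = 1 → ∀ i j, pairCoeff M ε i j = 0 := fun h1 i j => by
    simp [pairCoeff, hM1 h1]
  have hpc := fun i j => pairCoeff_comm h.eps i j
  refine isLeibniz_of_frame h.toFrame ?_
  simp only [Set.mem_union, Set.mem_insert_iff, Set.mem_singleton_iff, Set.mem_range]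
  rintro p ((rfl | rfl | rfl | rfl) | ⟨i, rfl⟩) q ((rfl | rfl | rfl | rfl) | ⟨j, rfl⟩)
    r ((rfl | rfl | rfl | rfl) | ⟨k, rfl⟩) <;>
  simp only [h.ff, h.fu, h.fx, h.fy, h.fg, h.uf, h.uu, h.ux, h.uy, h.ug, h.xf, h.xu, h.xx, h.xy,
    h.xg, h.yf, h.yu, h.yx, h.yy, h.yg, h.gf, h.gu, h.gx, h.gy, h.gg, map_add, map_smul, map_neg,
    map_zero, LinearMap.add_apply, LinearMap.smul_apply, LinearMap.neg_apply, LinearMap.zero_apply,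
    hp1, hp2, hM0, smul_zero, zero_add, add_zero, sub_self, neg_zero, sub_zero, smul_smul, smul_add,
    smul_neg, hz, neg_neg]
  all_goals match_scalars
  all_goals try grind
  all_goals split_ifs with hi
  all_goals try obtain ⟨rfl, rfl⟩ := hi
  all_goals try grind
  
end Model
end Model

/-! ### Models with equal parameters; solvability and the nilradical of a model. -/

section ModelConsequences

variable {L : Type*} [AddCommGroup L] [Module ℂ L]

theorem map₂_span_le {br : Mul₂ L} {s t : Set L} {S : Submodule ℂ L}
    (H : ∀ v ∈ s, ∀ w ∈ t, br v w ∈ S) : map₂ br (span ℂ s) (span ℂ t) ≤ S := by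
  rw [map₂_span_span, span_le]
  rintro _ ⟨v, hv, w, hw, rfl⟩
  exact H v hv w hw

namespace Model

variable {br : Mul₂ L} {M : ℕ} {a b c ε : ℂ} {f u x y : L} {g : ℕ → L}

theorem iso {L' : Type*} [AddCommGroup L'] [Module ℂ L'] {br' : Mul₂ L'} {f' u' x' y' : L'}
    {g' : ℕ → L'} (h : Model br M a b c ε f u x y g) (h' : Model br' M a b c ε f' u' x' y' g') :
    Iso br br' := by
  let φ := h.basis.equiv h'.basis (Equiv.refl _)
  have hb : ∀ i, φ (h.basis i) = h'.basis i := fun i => by simp [φ]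
  have hf : φ f = f' := by simpa only [h.basis_f, h'.basis_f] using hb (.inl 0)
  have hu : φ u = u' := by simpa only [h.basis_u, h'.basis_u] using hb (.inl 1)
  have hx : φ x = x' := by simpa only [h.basis_x, h'.basis_x] using hb (.inl 2)
  have hy : φ y = y' := by simpa only [h.basis_y, h'.basis_y] using hb (.inl 3)
  have hg : ∀ i, φ (g i) = g' i := fun i => by
    by_cases hi : M < i
    · rw [h.g_zero i hi, h'.g_zero i hi, map_zero]
    · simpa only [h.basis_g, h'.basis_g] using hb (.inr ⟨i, by omega⟩)
  have key : br.compr₂ φ.toLinearMap = br'.compl₁₂ φ.toLinearMap φ.toLinearMap := by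
    refine h.linearMap_ext ?_ ?_ ?_ ?_ fun i => ?_ <;>
    refine h.linearMap_ext ?_ ?_ ?_ ?_ fun j => ?_ <;>
    simp only [LinearMap.compr₂_apply, LinearMap.compl₁₂_apply, LinearEquiv.coe_coe, hf, hu, hx,
      hy, hg, h.ff, h.fu, h.fx, h.fy, h.fg, h.uf, h.uu, h.ux, h.uy, h.ug, h.xf, h.xu, h.xx, h.xy,
      h.xg, h.yf, h.yu, h.yx, h.yy, h.yg, h.gf, h.gu, h.gx, h.gy, h.gg, h'.ff, h'.fu, h'.fx,
      h'.fy, h'.fg, h'.uf, h'.uu, h'.ux, h'.uy, h'.ug, h'.xf, h'.xu, h'.xx, h'.xy, h'.xg, h'.yf,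
      h'.yu, h'.yx, h'.yy, h'.yg, h'.gf, h'.gu, h'.gx, h'.gy, h'.gg, map_add, map_smul, map_neg,
      map_zero]
  exact ⟨φ, fun v w => LinearMap.congr_fun₂ key v w⟩

theorem map₂_top_le (h : Model br M a b c ε f u x y g) : map₂ br ⊤ ⊤ ≤ core f u g := by
  have hf := f_mem_core f u g
  have hu := u_mem_core f u g
  have hg := g_mem_core f u g
  rw [← h.span_eq]
  refine map₂_span_le ?_
  simp only [Set.mem_union, Set.mem_insert_iff, Set.mem_singleton_iff, Set.mem_range]
  rintro p ((rfl | rfl | rfl | rfl) | ⟨i, rfl⟩) q ((rfl | rfl | rfl | rfl) | ⟨j, rfl⟩) <;>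
  simp only [h.ff, h.fu, h.fx, h.fy, h.fg, h.uf, h.uu, h.ux, h.uy, h.ug, h.xf, h.xu, h.xx, h.xy,
    h.xg, h.yf, h.yu, h.yx, h.yy, h.yg, h.gf, h.gu, h.gx, h.gy, h.gg] <;>
  repeat' first
    | exact hf
    | exact hu
    | exact hg _
    | exact zero_mem _
    | refine add_mem ?_ ?_
    | refine neg_mem ?_
    | refine smul_mem _ _ ?_

theorem map₂_core_le (h : Model br M a b c ε f u x y g) :
    map₂ br (core f u g) (core f u g) ≤ tail u g 1 := by
  have hM := h.one_le
  have hu := u_mem_tail u g 1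
  have hg : ∀ i, g (i + 1) ∈ tail u g 1 := fun i => g_mem_tail u g (by omega)
  have hgM : g M ∈ tail u g 1 := g_mem_tail u g hM
  refine map₂_span_le ?_
  simp only [Set.mem_union, Set.mem_insert_iff, Set.mem_singleton_iff, Set.mem_range]
  rintro p ((rfl | rfl) | ⟨i, rfl⟩) q ((rfl | rfl) | ⟨j, rfl⟩) <;>
  simp only [h.ff, h.fu, h.fg, h.uf, h.uu, h.ug, h.gf, h.gu, h.gg] <;>
  repeat' first
    | exact hu
    | exact hg _
    | exact hgM
    | exact zero_mem _
    | refine add_mem ?_ ?_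
    | refine neg_mem ?_
    | refine smul_mem _ _ ?_

theorem map₂_tail_core_le (h : Model br M a b c ε f u x y g) (k : ℕ) :
    map₂ br (tail u g k) (core f u g) ≤ tail u g (k + 1) := by
  have hM := h.one_le
  have hu := u_mem_tail u g (k + 1)
  refine map₂_span_le ?_
  rintro p (rfl | ⟨i, hi, rfl⟩) q ((rfl | rfl) | ⟨j, rfl⟩)
  · simp [h.uf]
  · simp [h.uu]
  · simp [h.ug]
  · rw [h.gf]
    exact smul_mem _ _ (g_mem_tail u g (Nat.succ_le_succ hi))
  · simp [h.gu]
  · rw [h.gg]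
    refine add_mem (smul_mem _ _ hu) ?_
    have hi : k ≤ i := hi
    by_cases hij : i + j + 1 = M
    · exact smul_mem _ _ (g_mem_tail u g (by omega))
    · simp [pairCoeff_of_ne hij]

theorem map₂_tail_one_le (h : Model br M a b c ε f u x y g) :
    map₂ br (tail u g 1) (tail u g 1) ≤ span ℂ {g M} := by
  refine map₂_span_le ?_
  rintro p (rfl | ⟨i, hi, rfl⟩) q (rfl | ⟨j, hj, rfl⟩)
  · simp [h.uu]
  · simp [h.ug]
  · simp [h.gu]
  · have hi : 1 ≤ i := hi
    rw [h.gg, if_neg (by omega), zero_smul, zero_add]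
    exact smul_mem _ _ (mem_span_singleton_self _)

/-- The derived series descends through the core, `tail u g 1` and the line of `g M`, whose square
is zero. -/
theorem isSolvable (h : Model br M a b c ε f u x y g) : IsSolvable br := by
  have h1 : derivedSeries br 1 ≤ core f u g := h.map₂_top_le
  have h2 : derivedSeries br 2 ≤ tail u g 1 := (map₂_le_map₂ h1 h1).trans h.map₂_core_le
  have h3 : derivedSeries br 3 ≤ span ℂ {g M} := (map₂_le_map₂ h2 h2).trans h.map₂_tail_one_le
  refine ⟨4, le_bot_iff.1 ((map₂_le_map₂ h3 h3).trans (map₂_span_le ?_))⟩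
  rintro _ rfl _ rfl
  have := h.one_le
  rw [h.gg, if_neg (by omega), pairCoeff_of_ne (by omega)]
  simp

theorem isIdeal_core (h : Model br M a b c ε f u x y g) : IsIdeal br (core f u g) :=
  fun _ _ _ => ⟨h.map₂_top_le (apply_mem_map₂ _ trivial trivial),
    h.map₂_top_le (apply_mem_map₂ _ trivial trivial)⟩

/-- Each multiplication by the core raises the tail index. After `M + 1` of them only multiples of
`u` remain, and `[u, core] = 0`. -/
theorem isNilpotentIdeal_core (h : Model br M a b c ε f u x y g) :
    IsNilpotentIdeal br (core f u g) := by
  refine ⟨h.isIdeal_core, M + 2, ?_⟩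
  have key : ∀ k, lowerSeries br (core f u g) (k + 1) ≤ tail u g (k + 1) := by
    intro k
    induction k with
    | zero => exact h.map₂_core_le
    | succ k ih => exact (map₂_le_map₂_left ih).trans (h.map₂_tail_core_le _)
  refine le_bot_iff.1 ((map₂_le_map₂_left (key M)).trans ?_)
  have h1 : tail u g (M + 1) ≤ span ℂ {u} :=
    tail_le (subset_span rfl) fun i hi => by simp [h.g_zero i (by omega)]
  refine (map₂_le_map₂_left h1).trans (map₂_span_le ?_)
  rintro p rfl q ((rfl | rfl) | ⟨j, rfl⟩)
  · simp [h.uf]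
  · simp [h.uu]
  · simp [h.ug]

/-- The `x`-coordinate of a right factor is the scalar by which it acts on `f`-coordinates. This
detects elements outside the nilradical, and later the `x`-part of an image under an isomorphism. -/
theorem cf_bracket (h : Model br M a b c ε f u x y g) {p : L} (hp : p ∈ core f u g) (v : L) :
    h.cf (br p v) = h.cf p * h.cx v := by
  have key : core f u g ≤ LinearMap.eqLocus (br.compr₂ h.cf)
      ((LinearMap.mul ℂ ℂ).compl₁₂ h.cf h.cx) := by
    refine core_le ?_ ?_ fun i => ?_ <;> refine h.linearMap_ext ?_ ?_ ?_ ?_ fun j => ?_ <;>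
    simp [h.ff, h.fu, h.fx, h.fy, h.fg, h.uf, h.uu, h.ux, h.uy, h.ug, h.gf, h.gu, h.gx, h.gy, h.gg,
      -ite_smul]
  exact LinearMap.congr_fun (key hp) v

theorem bracket_mem_tail_zero (h : Model br M a b c ε f u x y g) {p : L} (hp : p ∈ tail u g 0)
    (v : L) : br p v ∈ tail u g 0 := by
  rw [h.mem_tail_iff] at hp ⊢
  exact ⟨h.map₂_top_le (apply_mem_map₂ _ trivial trivial), by simp [h.cf_bracket hp.1, hp.2.1],
    by simp⟩

theorem cg_zero_bracket (h : Model br M a b c ε f u x y g) {p : L} (hp : p ∈ tail u g 0) (v : L) :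
    h.cg 0 (br p v) = h.cg 0 p * h.cy v := by
  have hM := h.one_le
  have key : tail u g 0 ≤ LinearMap.eqLocus (br.compr₂ (h.cg 0))
      ((LinearMap.mul ℂ ℂ).compl₁₂ (h.cg 0) h.cy) := by
    refine tail_le ?_ fun i _ => ?_ <;> refine h.linearMap_ext ?_ ?_ ?_ ?_ fun j => ?_
    · simp [h.uf]
    · simp [h.uu]
    · simp [h.ux]
    · simp [h.uy]
    · simp [h.ug]
    · simp [h.gf, h.cg_g]
    · simp [h.gu]
    · by_cases hi : 0 = i
      · subst hi; simp [h.gx, weightX_of_ne (show 0 ≠ M by omega)]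
      · simp [h.gx, h.cg_g_ne hi]
    · by_cases hi : 0 = i
      · subst hi; simp [h.gy, weightY_of_ne (show 0 ≠ M by omega)]
      · simp [h.gy, h.cg_g_ne hi]
    · simp [h.gg, h.cg_g_ne (show 0 ≠ M by omega), -ite_smul]
  exact LinearMap.congr_fun (key hp) v

/-- An element of the ideal with nonzero `x`-coordinate acts on `f`-coordinates by a nonzero scalar,
so iterated products starting from `f` never vanish. If that coordinate is zero but the
`y`-coordinate is not, the same happens with `g 0`. -/
theorem le_core_of_isNilpotentIdeal (h : Model br M a b c ε f u x y g) {I : Submodule ℂ L}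
    (hI : IsNilpotentIdeal br I) : I ≤ core f u g := by
  intro v hv
  obtain ⟨hI, k, hk⟩ := hI
  rw [h.mem_core_iff]
  have h1 : h.cx v = 0 := by
    by_contra h0
    have : ∀ k, ∃ p ∈ lowerSeries br I k, p ∈ core f u g ∧ h.cf p ≠ 0 := by
      intro k
      induction k with
      | zero =>
        exact ⟨br f v, (hI v hv f).2, h.map₂_top_le (apply_mem_map₂ _ trivial trivial),
          by simpa [h.cf_bracket (f_mem_core f u g)] using h0⟩
      | succ k ih =>
        obtain ⟨p, hp, hp1, hp2⟩ := ih
        exact ⟨br p v, apply_mem_map₂ _ hp hv,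
          h.map₂_top_le (apply_mem_map₂ _ trivial trivial),
          by simpa [h.cf_bracket hp1] using ⟨hp2, h0⟩⟩
    obtain ⟨p, hp, _, hp2⟩ := this k
    rw [hk, mem_bot] at hp
    exact hp2 (by rw [hp, map_zero])
  refine ⟨h1, ?_⟩
  by_contra h0
  have : ∀ k, ∃ p ∈ lowerSeries br I k, p ∈ tail u g 0 ∧ h.cg 0 p ≠ 0 := by
    intro k
    induction k with
    | zero =>
      refine ⟨br (g 0) v, (hI v hv _).2, h.bracket_mem_tail_zero (g_mem_tail u g le_rfl) v, ?_⟩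
      rw [h.cg_zero_bracket (g_mem_tail u g le_rfl), h.cg_g_self (Nat.zero_le _), one_mul]
      exact h0
    | succ k ih =>
      obtain ⟨p, hp, hp1, hp2⟩ := ih
      exact ⟨br p v, apply_mem_map₂ _ hp hv, h.bracket_mem_tail_zero hp1 v,
        by rw [h.cg_zero_bracket hp1]; exact mul_ne_zero hp2 h0⟩
  obtain ⟨p, hp, _, hp2⟩ := this k
  rw [hk, mem_bot] at hp
  exact hp2 (by rw [hp, map_zero])

theorem hasNilradicalCodimTwo (h : Model br M a b c ε f u x y g) {L' : Type*} [AddCommGroup L']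
    [Module ℂ L'] {br' : Mul₂ L'} (hs : SubIso br (core f u g) br') :
    HasNilradicalCodimTwo br br' :=
  ⟨h.isLeibniz, h.isSolvable, core f u g, span ℂ {x, y},
    ⟨h.isNilpotentIdeal_core, fun _ hI => h.le_core_of_isNilpotentIdeal hI⟩, hs,
    h.isCompl_core, h.finrank_span_pair⟩

end Model
end ModelConsequences

/-! ### The parameters of a model are isomorphism invariants. -/

section NonIsomorphic

variable {L : Type*} [AddCommGroup L] [Module ℂ L] {L' : Type*} [AddCommGroup L'] [Module ℂ L']

theorem map₂_le_comap {br : Mul₂ L} {br' : Mul₂ L'} {ψ : L' ≃ₗ[ℂ] L}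
    (hψ : ∀ v w, ψ (br' v w) = br (ψ v) (ψ w)) {P' Q' : Submodule ℂ L'} {P Q : Submodule ℂ L}
    (hP : P' ≤ P.comap ψ.toLinearMap) (hQ : Q' ≤ Q.comap ψ.toLinearMap) :
    map₂ br' P' Q' ≤ (map₂ br P Q).comap ψ.toLinearMap := by
  rw [map₂_le]
  intro v hv w hw
  rw [mem_comap, LinearEquiv.coe_coe, hψ]
  exact apply_mem_map₂ _ (hP hv) (hQ hw)

theorem stepCoeff_ne_zero {M i : ℕ} {ε : ℂ} (hi : i + 1 < M ∨ i + 1 = M ∧ ε = 0) :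
    stepCoeff M ε i = 1 := by
  rcases hi with hi | ⟨hi, rfl⟩
  · exact stepCoeff_of_lt hi
  · simp [stepCoeff_last hi]

namespace Model

variable {br : Mul₂ L} {M : ℕ} {a b c ε : ℂ} {f u x y : L} {g : ℕ → L}
variable {br' : Mul₂ L'} {a' b' c' ε' : ℂ} {f' u' x' y' : L'} {g' : ℕ → L'}

/-- `u` is produced by the one nonzero parameter among `a, b, c`. For `ε = 1` the step from `g (M -
1)` to `g M` under `f` is zero, and `g M` is obtained from `[g (M - 1), g 0]` instead. -/
theorem map₂_core_eq (h : Model br M a b c ε f u x y g) :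
    map₂ br (core f u g) (core f u g) = tail u g 1 := by
  refine le_antisymm h.map₂_core_le (tail_le ?_ fun i hi => ?_)
  · have hff := apply_mem_map₂ br (f_mem_core f u g) (f_mem_core f u g)
    have hfg := apply_mem_map₂ br (f_mem_core f u g) (g_mem_core f u g 0)
    have hgf := apply_mem_map₂ br (g_mem_core f u g 0) (f_mem_core f u g)
    have hgg := apply_mem_map₂ br (g_mem_core f u g 0) (g_mem_core f u g 0)
    rcases h.type with ⟨rfl, rfl, rfl⟩ | ⟨rfl, rfl, rfl⟩ | ⟨rfl, rfl, rfl⟩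
    · simpa [h.ff] using hff
    · simpa [h.fg, h.gf] using add_mem hfg hgf
    · by_cases hM : M = 1
      · rcases h.eps with rfl | ⟨rfl, h1⟩
        · simpa [h.gg, pairCoeff] using hgg
        · rw [hM] at h1; exact absurd h1 (by decide)
      · rw [h.gg, pairCoeff_of_ne (by omega)] at hgg
        simpa using hgg
  · obtain ⟨i, rfl⟩ : ∃ j, i = j + 1 := ⟨i - 1, by omega⟩
    have hgf := apply_mem_map₂ br (g_mem_core f u g i) (f_mem_core f u g)
    have hgg := apply_mem_map₂ br (g_mem_core f u g i) (g_mem_core f u g 0)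
    by_cases hM : M < i + 1
    · simp [h.g_zero _ hM]
    by_cases hi : stepCoeff M ε i = 1
    · simpa [h.gf, hi] using hgf
    · rcases h.eps with rfl | ⟨rfl, h1⟩
      · exact absurd (stepCoeff_ne_zero
          ((Nat.lt_or_eq_of_le (not_lt.1 hM)).imp_right (⟨·, rfl⟩))) hi
      · have hiM : i + 1 = M := by
          by_contra h2
          exact hi (stepCoeff_of_lt (by omega))
        have hi0 : i ≠ 0 := by
          rintro rfl
          rw [← hiM] at h1; exact absurd h1 (by decide)
        rw [h.gg, if_neg (by omega), zero_smul, zero_add, pairCoeff, if_pos (by omega)] at hgg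
        rw [hiM]
        have := smul_mem _ ((-1) ^ (i + 1)) hgg
        rwa [smul_smul, mul_one, ← mul_pow, neg_one_mul, neg_neg, one_pow, one_smul] at this

/-- With `map₂_core_eq` this makes the core and `tail u g 1` characteristic: they are the derived
ideal and the derived ideal of that. -/
theorem map₂_top_eq (h : Model br M a b c ε f u x y g) : map₂ br ⊤ ⊤ = core f u g := by
  refine le_antisymm h.map₂_top_le (core_le ?_ ?_ fun i => ?_)
  · simpa [h.fx] using apply_mem_map₂ br (mem_top (x := f)) (mem_top (x := x))
  · exact map₂_le_map₂ le_top le_top (h.map₂_core_eq.ge (u_mem_tail u g 1))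
  · have := apply_mem_map₂ br (mem_top (x := g i)) (mem_top (x := y))
    rw [h.gy] at this
    refine (smul_mem_iff _ ?_).1 this
    unfold weightY
    rcases h.eps with rfl | ⟨rfl, _⟩ <;> split_ifs <;> norm_num

theorem core_le_comap (h : Model br M a b c ε f u x y g)
    (h' : Model br' M a' b' c' ε' f' u' x' y' g') {ψ : L' ≃ₗ[ℂ] L}
    (hψ : ∀ v w, ψ (br' v w) = br (ψ v) (ψ w)) :
    core f' u' g' ≤ (core f u g).comap ψ.toLinearMap := by
  rw [← h.map₂_top_eq, ← h'.map₂_top_eq]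
  exact map₂_le_comap hψ (by simp) (by simp)

theorem tail_one_le_comap (h : Model br M a b c ε f u x y g)
    (h' : Model br' M a' b' c' ε' f' u' x' y' g') {ψ : L' ≃ₗ[ℂ] L}
    (hψ : ∀ v w, ψ (br' v w) = br (ψ v) (ψ w)) :
    tail u' g' 1 ≤ (tail u g 1).comap ψ.toLinearMap := by
  rw [← h.map₂_core_eq, ← h'.map₂_core_eq]
  exact map₂_le_comap hψ (h.core_le_comap h' hψ) (h.core_le_comap h' hψ)

/-- The invariant behind `ε`: this product is zero for `ε = 0`, whereas for `ε = 1` it contains `[g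
(M - 1), g 0] = ± g M`. -/
theorem map₂_tail_one_tail_zero_le (h : Model br M a b c ε f u x y g) :
    map₂ br (tail u g 1) (tail u g 0) ≤ span ℂ {ε • g M} := by
  refine map₂_span_le ?_
  rintro p (rfl | ⟨i, hi, rfl⟩) q (rfl | ⟨j, hj, rfl⟩)
  · simp [h.uu]
  · simp [h.ug]
  · simp [h.gu]
  · have hi : 1 ≤ i := hi
    rw [h.gg, if_neg (by omega), zero_smul, zero_add, pairCoeff]
    split_ifs
    · rw [mul_smul]
      exact smul_mem _ _ (mem_span_singleton_self _)
    · simp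

theorem g_last_bracket (h : Model br M a b c ε f u x y g) {v : L} (hv : v ∈ tail u g 0) :
    br (g M) v = 0 := by
  have hM := h.one_le
  have key : tail u g 0 ≤ LinearMap.ker (br (g M)) := by
    refine tail_le (by simp [h.gu]) fun i _ => ?_
    rw [LinearMap.mem_ker, h.gg, if_neg (by omega), pairCoeff_of_ne (by omega)]
    simp
  exact key hv

/-- Modulo `u` the core is anticommutative. The right side is the polarisation of the form `a s² + b
s t + c t²`, where `s, t` are the coordinates of `f` and `g 0`. -/
theorem bracket_add_bracket (h : Model br M a b c ε f u x y g) {p q : L} (hp : p ∈ core f u g)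
    (hq : q ∈ core f u g) :
    br p q + br q p = (2 * a * (h.cf p * h.cf q) + b * (h.cf p * h.cg 0 q + h.cg 0 p * h.cf q)
      + 2 * c * (h.cg 0 p * h.cg 0 q)) • u := by
  have hM := h.one_le
  have aux : ∀ i, h.cg 0 (g i) = if i = 0 then 1 else 0 := fun i => by
    rw [h.cg_g]; congr 1; exact propext ⟨fun h => h.1.symm, fun h => ⟨h.symm, by omega⟩⟩
  induction hp, hq using span_induction₂ with
  | mem_mem p q hp hq =>
    rcases hp with (rfl | rfl) | ⟨i, rfl⟩ <;> rcases hq with (rfl | rfl) | ⟨j, rfl⟩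
    · simp [h.ff]; module
    · simp [h.fu, h.uf]
    · simp [h.fg, h.gf, aux, -ite_smul]
    · simp [h.fu, h.uf]
    · simp [h.uu]
    · simp [h.gu, h.ug]
    · simp [h.fg, h.gf, aux, -ite_smul]
    · simp [h.gu, h.ug]
    · rw [h.gg, h.gg, pairCoeff_comm h.eps j i]
      simp only [aux, h.cf_g]
      match_scalars
      · grind
      · ring
  | zero_left => simp
  | zero_right => simp
  | add_left p p' q _ _ _ h1 h2 =>
    simp only [map_add, LinearMap.add_apply]
    linear_combination (norm := module) h1 + h2
  | add_right p q q' _ _ _ h1 h2 =>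
    simp only [map_add, LinearMap.add_apply]
    linear_combination (norm := module) h1 + h2
  | smul_left t p q _ _ h1 =>
    simp only [map_smul, LinearMap.smul_apply, smul_eq_mul]
    linear_combination (norm := module) t • h1
  | smul_right t p q _ _ h1 =>
    simp only [map_smul, LinearMap.smul_apply, smul_eq_mul]
    linear_combination (norm := module) t • h1

theorem params_of_equiv (h : Model br M a b c ε f u x y g)
    (h' : Model br' M a' b' c' ε' f' u' x' y' g') (hM : 3 ≤ M) {ψ : L' ≃ₗ[ℂ] L}
    (hψ : ∀ v w, ψ (br' v w) = br (ψ v) (ψ w)) :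
    (a = a' ∧ b = b' ∧ c = c') ∧ (ε = 0 → ε' = 0) := by
  have hφ : ∀ v w, ψ.symm (br v w) = br' (ψ.symm v) (ψ.symm w) := fun v w => by
    rw [LinearEquiv.symm_apply_eq, hψ]; simp
  have hf : ψ f' ∈ core f u g := h.core_le_comap h' hψ (f_mem_core _ _ _)
  have hg : ψ (g' 0) ∈ core f u g := h.core_le_comap h' hψ (g_mem_core _ _ _ 0)
  have hg1 : ∀ i, 1 ≤ i → ψ (g' i) ∈ tail u g 1 := fun i hi =>
    h.tail_one_le_comap h' hψ (g_mem_tail _ _ hi)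
  -- Otherwise the image of `f'` lies in `tail u g 0`, and two right multiplications by it kill
  -- `tail u g 1`. But `[[g' 1, f'], f'] = g' 3 ≠ 0`; this is where `M ≥ 3` enters, and for `M = 3`
  -- parity gives `ε' = 0`.
  have hA : h.cf (ψ f') ≠ 0 := by
    intro h0
    have hf0 : ψ f' ∈ tail u g 0 := (h.mem_tail_iff _ _).2 ⟨hf, h0, by simp⟩
    have h1 := h.map₂_tail_one_tail_zero_le (apply_mem_map₂ _ (hg1 1 le_rfl) hf0)
    obtain ⟨t, ht⟩ := mem_span_singleton.1 h1
    have h2 : br (br (ψ (g' 1)) (ψ f')) (ψ f') = 0 := by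
      rw [← ht]; simp [h.g_last_bracket hf0]
    rw [← hψ, ← hψ, h'.gf, map_smul, LinearMap.smul_apply, h'.gf, stepCoeff_of_lt (by omega),
      stepCoeff_ne_zero, one_smul, one_smul] at h2
    · exact h'.g_ne_zero hM ((map_eq_zero_iff ψ ψ.injective).1 h2)
    · rcases hM.eq_or_lt with rfl | hM
      · rcases h'.eps with h0 | ⟨_, h0⟩
        · exact .inr ⟨rfl, h0⟩
        · exact absurd h0 (by decide)
      · exact .inl hM
  -- `[f', y'] = 0` forces the image of `y'` to have no `x`-part. Then `[g' 0, y'] = g' 0` forces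
  -- the image of `g' 0` to have no `f`-part.
  have hY : h.cx (ψ y') = 0 := by
    have := h.cf_bracket hf (ψ y')
    rw [← hψ, h'.fy, map_zero, map_zero, eq_comm, mul_eq_zero] at this
    exact this.resolve_left hA
  have hg0 : h.cf (ψ (g' 0)) = 0 := by
    have := h.cf_bracket hg (ψ y')
    rwa [hY, mul_zero, ← hψ, h'.gy, weightY_of_ne (by omega), one_smul] at this
  have hC : h.cg 0 (ψ (g' 0)) ≠ 0 := by
    intro h0
    have h1 : ψ (g' 0) ∈ tail u g 1 := (h.mem_tail_iff _ _).2 ⟨hg, hg0, by simpa using h0⟩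
    have h2 := h'.tail_one_le_comap h hφ h1
    rw [mem_comap, LinearEquiv.coe_coe, ψ.symm_apply_apply, h'.mem_tail_iff] at h2
    simpa [h'.cg_g_self (Nat.zero_le M)] using h2.2.2 0 one_pos
  have hu : ψ u' ≠ 0 := (map_ne_zero_iff ψ ψ.injective).2 h'.u_ne_zero
  have hu0 := h.u_ne_zero
  -- The images respect the flag, so two numbers decide the type: the form at `g 0` is nonzero only
  -- for `c = 1`, and if it is zero there, the polar form of `f` and `g 0` is nonzero only for `b =
  -- 1`.
  constructor
  · have h1 := h.bracket_add_bracket hf hg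
    have h2 := h.bracket_add_bracket hg hg
    rw [← hψ, ← hψ, ← map_add, h'.bracket_add_bracket (f_mem_core _ _ _) (g_mem_core _ _ _ _)] at h1
    rw [← hψ, ← map_add, h'.bracket_add_bracket (g_mem_core _ _ _ _) (g_mem_core _ _ _ _)] at h2
    simp only [h'.cf_f, h'.cf_g, h'.cg_f, h'.cg_g_self (Nat.zero_le M), hg0, map_smul] at h1 h2
    rw [← sub_eq_zero] at h1 h2
    rcases h.type with ⟨rfl, rfl, rfl⟩ | ⟨rfl, rfl, rfl⟩ | ⟨rfl, rfl, rfl⟩ <;>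
    rcases h'.type with ⟨rfl, rfl, rfl⟩ | ⟨rfl, rfl, rfl⟩ | ⟨rfl, rfl, rfl⟩ <;>
    first
      | exact ⟨rfl, rfl, rfl⟩
      | (exfalso; revert h1; simp [hu, hu0, hA, hC]; done)
      | (exfalso; revert h2; simp [hu, hu0, hA, hC])
  · rintro rfl
    rcases h'.eps with h0 | ⟨rfl, h1⟩
    · exact h0
    have hg' : ψ (g' 0) ∈ tail u g 0 := (h.mem_tail_iff _ _).2 ⟨hg, hg0, by simp⟩
    have h2 := h.map₂_tail_one_tail_zero_le (apply_mem_map₂ _ (hg1 (M - 1) (by omega)) hg')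
    rw [zero_smul, span_zero_singleton, mem_bot, ← hψ, map_eq_zero_iff ψ ψ.injective, h'.gg,
      if_neg (by omega), zero_smul, zero_add, pairCoeff, if_pos (by omega)] at h2
    exact absurd h2 (smul_ne_zero (by simp) (h'.g_ne_zero le_rfl))

theorem params_of_iso (h : Model br M a b c ε f u x y g)
    (h' : Model br' M a' b' c' ε' f' u' x' y' g') (hM : 3 ≤ M) (hi : Iso br br') :
    a = a' ∧ b = b' ∧ c = c' ∧ ε = ε' := by
  obtain ⟨φ, hφ⟩ := hi
  have hψ : ∀ v w, φ.symm (br' v w) = br (φ.symm v) (φ.symm w) := fun v w => by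
    rw [LinearEquiv.symm_apply_eq, hφ]; simp
  obtain ⟨⟨ha, hb, hc⟩, h1⟩ := h.params_of_equiv h' hM hψ
  have h2 := (h'.params_of_equiv h hM hφ).2
  refine ⟨ha, hb, hc, ?_⟩
  rcases h.eps with rfl | ⟨rfl, _⟩
  · exact (h1 rfl).symm
  · rcases h'.eps with rfl | ⟨rfl, _⟩
    · exact h2 rfl
    · rfl

end Model
end NonIsomorphic

/-! ### The table of `G(α, β, γ)` and its embedding in a larger coordinate space. -/

section NilTable

variable {L : Type*} [AddCommGroup L] [Module ℂ L] {L' : Type*} [AddCommGroup L'] [Module ℂ L']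

/-- The multiplication table of `G(α, β, γ)` with `[e_1, e_1] = δ e_2` in place of `e_2`, where
`E = e_1`, `U = e_2` and `g i = e_{i+3}`. -/
structure NilTable (br : Mul₂ L) (M : ℕ) (α δ β γ : ℂ) (E U : L) (g : ℕ → L) : Prop where
  EE : br E E = δ • U
  EU : br E U = 0
  Eg : ∀ i, br E (g i) = -g (i + 1) + (if i = 0 then β else 0) • U
  UE : br U E = 0
  UU : br U U = 0
  Ug : ∀ i, br U (g i) = 0
  gE : ∀ i, br (g i) E = g (i + 1)
  gU : ∀ i, br (g i) U = 0
  gg : ∀ i j, br (g i) (g j) = (if i = 0 ∧ j = 0 then γ else 0) • U + pairCoeff M α i j • g M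

namespace NilTable

variable {br : Mul₂ L} {br' : Mul₂ L'} {M : ℕ} {α δ β γ : ℂ} {E U : L} {g : ℕ → L}

theorem map (t : NilTable br M α δ β γ E U g) (φ : L →ₗ[ℂ] L')
    (hφ : ∀ v w, φ (br v w) = br' (φ v) (φ w)) :
    NilTable br' M α δ β γ (φ E) (φ U) fun i => φ (g i) := by
  constructor <;> intros <;>
  simp only [← hφ, t.EE, t.EU, t.Eg, t.UE, t.UU, t.Ug, t.gE, t.gU, t.gg, map_add, map_smul,
    map_neg, map_zero]

theorem map_bracket_of_mem (t : NilTable br M α δ β γ E U g) {φ : L →ₗ[ℂ] L'}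
    (t' : NilTable br' M α δ β γ (φ E) (φ U) fun i => φ (g i)) {v w : L}
    (hv : v ∈ core E U g) (hw : w ∈ core E U g) : φ (br v w) = br' (φ v) (φ w) := by
  induction hv, hw using span_induction₂ with
  | mem_mem v w hv hw =>
    rcases hv with (rfl | rfl) | ⟨i, rfl⟩ <;> rcases hw with (rfl | rfl) | ⟨j, rfl⟩ <;>
    simp only [t.EE, t.EU, t.Eg, t.UE, t.UU, t.Ug, t.gE, t.gU, t.gg, t'.EE, t'.EU, t'.Eg, t'.UE,
      t'.UU, t'.Ug, t'.gE, t'.gU, t'.gg, map_add, map_smul, map_neg, map_zero]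
  | zero_left => simp
  | zero_right => simp
  | add_left p p' q _ _ _ h1 h2 => simp only [map_add, LinearMap.add_apply, h1, h2]
  | add_right p q q' _ _ _ h1 h2 => simp only [map_add, LinearMap.add_apply, h1, h2]
  | smul_left t p q _ _ h1 => simp only [map_smul, LinearMap.smul_apply, h1]
  | smul_right t p q _ _ h1 => simp only [map_smul, LinearMap.smul_apply, h1]

end NilTable

theorem gTable_right_one (n : ℕ) (α β γ : ℂ) {m i : ℕ} (hi : 3 ≤ i) :
    (gTable n α β γ i 1 : Fin m → ℂ) = if i + 1 ≤ n then e (i + 1) else 0 := by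
  unfold gTable
  rw [if_neg (by omega), if_neg (by omega : ¬ (i = 1 ∧ 1 = 3)), if_neg (by omega : ¬ (i = 1 ∧ _)),
    if_neg (by omega : ¬ (i = 3 ∧ 1 = 3)),
    if_neg (by omega : ¬ (3 ≤ i ∧ i + 1 ≤ n ∧ i + 1 = n + 2))]
  simp [hi]

theorem gTable_left_one (n : ℕ) (α β γ : ℂ) {m j : ℕ} (hn : 4 ≤ n) (hj : 3 ≤ j) :
    (gTable n α β γ 1 j : Fin m → ℂ)
      = (if j + 1 ≤ n then -e (j + 1) else 0) + (if j = 3 then β else 0) • e 2 := by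
  unfold gTable
  rw [if_neg (by omega), if_neg (by omega), if_neg (by omega : ¬ (1 = 3 ∧ _)),
    if_neg (by omega : ¬ (3 ≤ 1 ∧ _))]
  by_cases h3 : j = 3
  · subst h3; simp [hn]
  · have h4 : 4 ≤ j := by omega
    simp [h3, h4]

theorem gTable_of_three_le (n : ℕ) (α β γ : ℂ) {m i j : ℕ} (hi : 3 ≤ i) (hj : 3 ≤ j) :
    (gTable n α β γ i j : Fin m → ℂ) = (if i = 3 ∧ j = 3 then γ else 0) • e 2
      + (if i + j = n + 2 then (-1) ^ i * α else 0) • e n := by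
  unfold gTable
  rw [if_neg (by omega), if_neg (by omega), if_neg (by omega : ¬ (i = 1 ∧ _)),
    if_neg (by omega : ¬ (i = 1 ∧ _))]
  by_cases h1 : i + j = n + 2
  · have h2 : i + 1 ≤ n := by omega
    simp [h1, h2, hi]
  · simp [h1]

theorem gTable_left_two (n : ℕ) (α β γ : ℂ) {m j : ℕ} : (gTable n α β γ 2 j : Fin m → ℂ) = 0 := by
  simp [gTable]

theorem gTable_right_two (n : ℕ) (α β γ : ℂ) {m i : ℕ} : (gTable n α β γ i 2 : Fin m → ℂ) = 0 := by
  simp only [gTable]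
  rw [if_neg (by omega : ¬ (3 ≤ i ∧ i + 1 ≤ n ∧ i + 2 = n + 2))]
  simp

theorem gTable_one_one (n : ℕ) (α β γ : ℂ) {m : ℕ} : (gTable n α β γ 1 1 : Fin m → ℂ) = e 2 := by
  simp [gTable]

/-- The vectors `e 3, e 4, …, e (M + 3)` followed by zeros. -/
def eShift {m : ℕ} (M i : ℕ) : Fin m → ℂ := if i ≤ M then e (i + 3) else 0

theorem eShift_of_le {m M i : ℕ} (hi : i ≤ M) : (eShift M i : Fin m → ℂ) = e (i + 3) := if_pos hi
theorem eShift_of_lt {m M i : ℕ} (hi : M < i) : (eShift M i : Fin m → ℂ) = 0 :=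
  if_neg (by omega)

theorem nilTable_ofTable {m M : ℕ} (hM : 1 ≤ M) (hm : M + 3 ≤ m) (α β γ : ℂ)
    {T : ℕ → ℕ → Fin m → ℂ}
    (hT : ∀ i j, i ≤ M + 3 → j ≤ M + 3 → T i j = gTable (M + 3) α β γ i j) :
    NilTable (ofTable T) M α 1 β γ (e 1) (e 2) (eShift M) := by
  have key : ∀ i j, 1 ≤ i → i ≤ M + 3 → 1 ≤ j → j ≤ M + 3 →
      ofTable T (e i) (e j) = gTable (M + 3) α β γ i j := fun i j h1 h2 h3 h4 => by
    rw [ofTable_e T i j h1 (by omega) h3 (by omega), hT i j h2 h4]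
  have hs : ∀ i, (if i + 3 + 1 ≤ M + 3 then e (i + 3 + 1) else 0 : Fin m → ℂ) = eShift M (i + 1) :=
    fun i => by
      by_cases hi : i + 1 ≤ M
      · rw [eShift_of_le hi, if_pos (by omega)]
      · rw [eShift_of_lt (by omega), if_neg (by omega)]
  refine ⟨?_, ?_, fun i => ?_, ?_, ?_, fun i => ?_, fun i => ?_, fun i => ?_, fun i j => ?_⟩
  · rw [key _ _ (by omega) (by omega) (by omega) (by omega), gTable_one_one, one_smul]
  · rw [key _ _ (by omega) (by omega) (by omega) (by omega), gTable_right_two]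
  · by_cases hi : i ≤ M
    · rw [eShift_of_le hi, key _ _ (by omega) (by omega) (by omega) (by omega),
        gTable_left_one _ _ _ _ (by omega) (by omega), ← hs]
      congr 1
      · split_ifs <;> simp
      · simp
    · rw [eShift_of_lt (by omega), eShift_of_lt (by omega), if_neg (by omega)]; simp
  · rw [key _ _ (by omega) (by omega) (by omega) (by omega), gTable_left_two]
  · rw [key _ _ (by omega) (by omega) (by omega) (by omega), gTable_left_two]
  · by_cases hi : i ≤ M
    · rw [eShift_of_le hi, key _ _ (by omega) (by omega) (by omega) (by omega), gTable_left_two]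
    · rw [eShift_of_lt (by omega), map_zero]
  · by_cases hi : i ≤ M
    · rw [eShift_of_le hi, key _ _ (by omega) (by omega) (by omega) (by omega),
        gTable_right_one _ _ _ _ (by omega), hs]
    · rw [eShift_of_lt (by omega), eShift_of_lt (by omega), map_zero, LinearMap.zero_apply]
  · by_cases hi : i ≤ M
    · rw [eShift_of_le hi, key _ _ (by omega) (by omega) (by omega) (by omega), gTable_right_two]
    · rw [eShift_of_lt (by omega), map_zero, LinearMap.zero_apply]
  · by_cases hi : i ≤ M
    · by_cases hj : j ≤ M
      · rw [eShift_of_le hi, eShift_of_le hj, eShift_of_le le_rfl,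
          key _ _ (by omega) (by omega) (by omega) (by omega),
          gTable_of_three_le _ _ _ _ (by omega) (by omega)]
        congr 2
        · simp
        · unfold pairCoeff
          -- The index shift by `3` turns the sign `(-1) ^ (i + 3)` into `(-1) ^ (i + 1)`.
          by_cases h1 : i + j + 1 = M
          · rw [if_pos h1, if_pos (by omega)]; ring
          · rw [if_neg h1, if_neg (by omega)]
      · rw [eShift_of_lt (by omega : M < j), map_zero, if_neg (by omega),
          pairCoeff_of_ne (by omega)]
        simp
    · rw [eShift_of_lt (by omega : M < i), map_zero, if_neg (by omega), pairCoeff_of_ne (by omega)]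
      simp

theorem span_range_e (m : ℕ) : span ℂ (Set.range fun k => (e k : Fin m → ℂ)) = ⊤ := by
  rw [eq_top_iff]
  intro v _
  have : v = ∑ i, v i • (e ((i : ℕ) + 1) : Fin m → ℂ) := by
    ext j
    simp [e, Fin.val_inj]
  rw [this]
  exact sum_mem fun i _ => smul_mem _ _ (subset_span ⟨_, rfl⟩)

theorem e_mem_of {m : ℕ} {S : Submodule ℂ (Fin m → ℂ)} (h : ∀ k, 1 ≤ k → k ≤ m → e k ∈ S) :
    S = ⊤ := by
  rw [eq_top_iff, ← span_range_e, span_le]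
  rintro _ ⟨k, rfl⟩
  by_cases hk : 1 ≤ k ∧ k ≤ m
  · exact h k hk.1 hk.2
  · have : (e k : Fin m → ℂ) = 0 := by
      ext i
      simp only [e, Pi.zero_apply, ite_eq_right_iff]
      omega
    simp [this]

theorem frame_e (M : ℕ) :
    Frame M (e 1 : Fin (M + 3 + 2) → ℂ) (e 2) (e (M + 3 + 1)) (e (M + 3 + 2)) (eShift M) := by
  refine ⟨fun i hi => eShift_of_lt hi, e_mem_of fun k h1 h2 => subset_span ?_, by simp⟩
  by_cases hk : 3 ≤ k ∧ k ≤ M + 3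
  · right
    exact ⟨k - 3, by rw [eShift_of_le (by omega), Nat.sub_add_cancel hk.1]⟩
  · have : k = 1 ∨ k = 2 ∨ k = M + 3 + 1 ∨ k = M + 3 + 2 := by omega
    left
    rcases this with rfl | rfl | rfl | rfl <;> simp

theorem core_e (M : ℕ) : core (e 1 : Fin (M + 3) → ℂ) (e 2) (eShift M) = ⊤ := by
  refine e_mem_of fun k h1 h2 => ?_
  by_cases hk : 3 ≤ k
  · have := g_mem_core (e 1 : Fin (M + 3) → ℂ) (e 2) (eShift M) (k - 3)
    rwa [eShift_of_le (by omega), Nat.sub_add_cancel hk] at this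
  · have : k = 1 ∨ k = 2 := by omega
    rcases this with rfl | rfl
    · exact f_mem_core _ _ _
    · exact u_mem_core _ _ _

/-- The embedding `ℂ^n → ℂ^m` by zeros. -/
def padZero (n m : ℕ) : (Fin n → ℂ) →ₗ[ℂ] (Fin m → ℂ) where
  toFun v j := if h : (j : ℕ) < n then v ⟨j, h⟩ else 0
  map_add' v w := by ext j; by_cases h : (j : ℕ) < n <;> simp [h]
  map_smul' c v := by ext j; by_cases h : (j : ℕ) < n <;> simp [h]

theorem padZero_e {n m k : ℕ} (hk : k ≤ n) : padZero n m (e k) = e k := by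
  ext j
  by_cases h : (j : ℕ) < n
  · simp [padZero, e, h]
  · have : ¬ ((j : ℕ) + 1 = k) := by omega
    simp [padZero, e, h, this]

theorem padZero_injective {n m : ℕ} (h : n ≤ m) : Function.Injective (padZero n m) := by
  intro v w hvw
  ext i
  simpa [padZero] using congrFun hvw ⟨i, by omega⟩

theorem map_core (f u : L) (g : ℕ → L) (φ : L →ₗ[ℂ] L') :
    (core f u g).map φ = core (φ f) (φ u) fun i => φ (g i) := by
  rw [core, core, map_span, Set.image_union, Set.image_pair, ← Set.range_comp]
  rfl

theorem subIso_core {M : ℕ} (hM : 1 ≤ M) {α β γ : ℂ} {br : Mul₂ (Fin (M + 3 + 2) → ℂ)}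
    (t : NilTable br M α 1 β γ (e 1) (e 2) (eShift M)) :
    SubIso br (core (e 1) (e 2) (eShift M)) (G (M + 3) α β γ) := by
  set ι := padZero (M + 3) (M + 3 + 2) with hι
  have h1 : ι (e 1) = e 1 := padZero_e (by omega)
  have h2 : ι (e 2) = e 2 := padZero_e (by omega)
  have h3 : ∀ i, ι (eShift M i) = eShift M i := fun i => by
    by_cases hi : i ≤ M
    · rw [eShift_of_le hi, eShift_of_le hi]; exact padZero_e (by omega)
    · rw [eShift_of_lt (by omega), eShift_of_lt (by omega), map_zero]
  have hr : LinearMap.range ι = core (e 1) (e 2) (eShift M) := by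
    rw [LinearMap.range_eq_map, ← core_e, map_core, h1, h2, funext h3]
  have tG : NilTable (G (M + 3) α β γ) M α 1 β γ (e 1) (e 2) (eShift M) :=
    nilTable_ofTable hM le_rfl α β γ fun _ _ _ _ => rfl
  have t' : NilTable br M α 1 β γ (ι (e 1)) (ι (e 2)) fun i => ι (eShift M i) := by
    simpa only [h1, h2, h3] using t
  refine ⟨(LinearEquiv.ofInjective ι (padZero_injective (by omega))).trans
    (LinearEquiv.ofEq _ _ hr), fun v w => ?_⟩
  exact tG.map_bracket_of_mem t' (by rw [core_e]; trivial) (by rw [core_e]; trivial)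

end NilTable

/-! ### The six algebras `H^k` are models. -/

section StandardModels

variable {L : Type*} [AddCommGroup L] [Module ℂ L]

/-- The vectors `g i`, with `g 1` replaced by `g 1 - s U`. -/
def shiftOne (g : ℕ → L) (U : L) (s : ℂ) (i : ℕ) : L := g i - (if i = 1 then s else 0) • U

theorem core_shiftOne (E U : L) (g : ℕ → L) (σ s : ℂ) :
    core (E - σ • g 0) U (shiftOne g U s) = core E U g := by
  apply le_antisymm
  · exact core_le (sub_mem (f_mem_core _ _ _) (smul_mem _ _ (g_mem_core _ _ _ _)))
      (u_mem_core _ _ _) fun i => sub_mem (g_mem_core _ _ _ _) (smul_mem _ _ (u_mem_core _ _ _))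
  · have hU := u_mem_core (E - σ • g 0) U (shiftOne g U s)
    have hg : ∀ i, g i ∈ core (E - σ • g 0) U (shiftOne g U s) := fun i => by
      have := add_mem (g_mem_core (E - σ • g 0) U (shiftOne g U s) i)
        (smul_mem _ (if i = 1 then s else 0) hU)
      rwa [shiftOne, sub_add_cancel] at this
    refine core_le ?_ hU hg
    simpa using add_mem (f_mem_core (E - σ • g 0) U (shiftOne g U s)) (smul_mem _ σ (hg 0))

theorem Frame.of_core_eq {M : ℕ} {E U E' U' x y : L} {g g' : ℕ → L} (h : Frame M E U x y g)
    (hc : core E' U' g' = core E U g) (hz : ∀ i, M < i → g' i = 0) : Frame M E' U' x y g' := by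
  refine ⟨hz, ?_, h.finrank_eq⟩
  have h1 : core E' U' g' ≤ span ℂ ({E', U', x, y} ∪ Set.range g') := by
    refine span_mono (Set.union_subset_union_left _ ?_)
    intro v; simp; tauto
  rw [hc] at h1
  rw [eq_top_iff, ← h.span_eq, span_le]
  rintro v (hv | ⟨i, rfl⟩)
  · simp only [Set.mem_insert_iff, Set.mem_singleton_iff] at hv
    rcases hv with rfl | rfl | rfl | rfl
    · exact h1 (f_mem_core _ _ _)
    · exact h1 (u_mem_core _ _ _)
    · exact subset_span (by simp)
    · exact subset_span (by simp)
  · exact h1 (g_mem_core _ _ _ _)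

theorem Frame.shift {M : ℕ} {E U x y : L} {g : ℕ → L} (h : Frame M E U x y g) (hM : 1 ≤ M)
    (σ s : ℂ) : Frame M (E - σ • g 0) U x y (shiftOne g U s) := by
  refine h.of_core_eq (core_shiftOne E U g σ s) fun i hi => ?_
  rw [shiftOne, h.g_zero i hi, if_neg (by omega)]
  simp

/-- The form on the nilradical is `s² + β s t + γ t²`; `a`, `b` and `c` are its value at `E - σ g
0`, its polar value with `g 0`, and its value at `g 0`. Replacing `g 1` by `g 1 - σγ U` restores `[g
0, f] = g 1` for the new `f`. -/
theorem NilTable.model {br : Mul₂ L} {M : ℕ} {α β γ a b c σ : ℂ} {E U x y : L} {g : ℕ → L}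
    (t : NilTable br M α 1 β γ E U g) (h : Frame M E U x y g) (hM : 1 ≤ M)
    (ha : a = 1 - σ * β + σ * σ * γ) (hb : b = β - 2 * (σ * γ)) (hc : c = γ)
    (type : (a = 1 ∧ b = 0 ∧ c = 0) ∨ (a = 0 ∧ b = 1 ∧ c = 0) ∨ (a = 0 ∧ b = 0 ∧ c = 1))
    (eps : α = 0 ∨ α = 1 ∧ Even M) (hσ : α = 1 → σ = 1)
    (fx : br (E - σ • g 0) x = E - σ • g 0) (fy : br (E - σ • g 0) y = 0)
    (ux : br U x = (2 * a + b) • U) (uy : br U y = (b + 2 * c) • U)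
    (xf : br x (E - σ • g 0) = -(E - σ • g 0)) (xu : br x U = 0) (xx : br x x = 0)
    (xy : br x y = 0)
    (yf : br y (E - σ • g 0) = 0) (yu : br y U = 0) (yx : br y x = 0) (yy : br y y = 0)
    (gx : ∀ i, br (shiftOne g U (σ * γ) i) x = weightX M α i • shiftOne g U (σ * γ) i)
    (gy : ∀ i, br (shiftOne g U (σ * γ) i) y = weightY M α i • shiftOne g U (σ * γ) i)
    (xg : ∀ i, br x (shiftOne g U (σ * γ) i)
      = -(weightX M α i • shiftOne g U (σ * γ) i) + (if i = 1 then b else 0) • U)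
    (yg : ∀ i, br y (shiftOne g U (σ * γ) i) = -(weightY M α i • shiftOne g U (σ * γ) i)) :
    Model br M a b c α (E - σ • g 0) U x y (shiftOne g U (σ * γ)) := by
  have hg0 : ∀ i, M < i → g i = 0 := h.g_zero
  have hs := h.shift hM σ (σ * γ)
  have hp0 : pairCoeff M α 0 0 = 0 := by
    by_cases h1 : M = 1
    · subst h1
      rcases eps with rfl | ⟨_, h2⟩
      · simp [pairCoeff]
      · exact absurd h2 (by decide)
    · exact pairCoeff_of_ne (by omega)
  have hgM : ∀ i j, pairCoeff M α i j • g M = pairCoeff M α i j • shiftOne g U (σ * γ) M := by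
    intro i j
    by_cases h1 : M = 1
    · subst h1
      rcases eps with rfl | ⟨_, h2⟩
      · simp [pairCoeff]
      · exact absurd h2 (by decide)
    · simp [shiftOne, h1]
  -- The left side is `[g i, E - σ g 0]`. For `α = 1` one has `σ = 1` and `M` even, so at `i = M -
  -- 1` the two contributions to `g M` cancel, in agreement with the step coefficient `1 - ε = 0`.
  have hstep : ∀ i, g (i + 1) - (σ * if i = 0 then γ else 0) • U - (σ * pairCoeff M α i 0) • g M
      = stepCoeff M α i • shiftOne g U (σ * γ) (i + 1) := by
    intro i
    by_cases hi : i = 0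
    · subst hi
      rw [hp0, shiftOne, stepCoeff_zero hM eps, if_pos rfl, if_pos rfl]
      simp
    · rcases lt_trichotomy (i + 1) M with h1 | h1 | h1
      · rw [if_neg hi, pairCoeff_of_ne (by omega), stepCoeff_of_lt h1, shiftOne, if_neg (by omega)]
        simp
      · rw [if_neg hi, stepCoeff_last h1, pairCoeff, if_pos (by omega), shiftOne,
          if_neg (by omega), h1]
        rcases eps with rfl | ⟨rfl, h2⟩
        · simp
        · simp [hσ rfl, h2.neg_one_pow]
      · rw [stepCoeff_of_le (by omega), hg0 _ h1, pairCoeff_of_ne (by omega), if_neg hi]; simp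
  refine ⟨hs, hM, type, eps, ?_, ?_, fx, fy, ?_, ?_, t.UU, ux, uy, ?_, xf, xu, xx, xy, xg, yf, yu,
    yx, yy, yg, ?_, ?_, gx, gy, ?_⟩
  · simp only [map_sub, map_smul, LinearMap.sub_apply, LinearMap.smul_apply, t.EE, t.Eg, t.gE, t.gg,
      hp0, ha]
    simp
    module
  · simp [t.EU, t.gU]
  · intro i
    rw [← hstep, shiftOne]
    simp only [map_sub, map_smul, LinearMap.sub_apply, LinearMap.smul_apply, t.EU, t.Eg, t.gU, t.gg,
      pairCoeff_comm eps 0 i, hb]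
    match_scalars <;> grind
  · simp [t.UE, t.Ug]
  · intro i
    simp [shiftOne, t.Ug, t.UU, -ite_smul]
  · intro i
    rw [← hstep, shiftOne]
    simp only [map_sub, map_smul, LinearMap.sub_apply, LinearMap.smul_apply, t.UE, t.Ug, t.gE, t.gg]
    match_scalars <;> grind
  · intro i
    simp [shiftOne, t.gU, t.UU, -ite_smul]
  · intro i j
    rw [← hgM]
    simp only [shiftOne, map_sub, map_smul, LinearMap.sub_apply, LinearMap.smul_apply, t.gU, t.Ug,
      t.UU, t.gg, hc]
    match_scalars <;> grind

section Extend

variable {n : ℕ} {α β γ : ℂ} {rx lx ry ly : ℕ → Fin (n + 2) → ℂ}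

theorem extend_right_x {i : ℕ} (h1 : 1 ≤ i) (h2 : i ≤ n) :
    extend n α β γ rx lx ry ly (e i) (e (n + 1)) = rx i := by
  rw [extend, ofTable_e _ _ _ h1 (by omega) (by omega) (by omega), if_neg (by omega),
    if_pos ⟨h2, rfl⟩]

theorem extend_left_x {i : ℕ} (h1 : 1 ≤ i) (h2 : i ≤ n) :
    extend n α β γ rx lx ry ly (e (n + 1)) (e i) = lx i := by
  rw [extend, ofTable_e _ _ _ (by omega) (by omega) h1 (by omega), if_neg (by omega),
    if_neg (by omega), if_pos ⟨rfl, h2⟩]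

theorem extend_right_y {i : ℕ} (h1 : 1 ≤ i) (h2 : i ≤ n) :
    extend n α β γ rx lx ry ly (e i) (e (n + 2)) = ry i := by
  rw [extend, ofTable_e _ _ _ h1 (by omega) (by omega) (by omega), if_neg (by omega),
    if_neg (by omega), if_neg (by omega), if_pos ⟨h2, rfl⟩]

theorem extend_left_y {i : ℕ} (h1 : 1 ≤ i) (h2 : i ≤ n) :
    extend n α β γ rx lx ry ly (e (n + 2)) (e i) = ly i := by
  rw [extend, ofTable_e _ _ _ (by omega) (by omega) h1 (by omega), if_neg (by omega),
    if_neg (by omega), if_neg (by omega), if_neg (by omega), if_pos ⟨rfl, h2⟩]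

theorem extend_torus {i j : ℕ} (h1 : n < i) (h2 : i ≤ n + 2) (h3 : n < j) (h4 : j ≤ n + 2) :
    extend n α β γ rx lx ry ly (e i) (e j) = 0 := by
  rw [extend, ofTable_e _ _ _ (by omega) h2 (by omega) h4, if_neg (by omega), if_neg (by omega),
    if_neg (by omega), if_neg (by omega), if_neg (by omega)]

end Extend

/-- The algebra `br` on `ℂ^{M+5}` contains `G(α, β, γ)` on its first `M + 3` basis vectors
and has the given multiplication table in a basis of weight vectors. -/
def IsStandard (M : ℕ) (br : Mul₂ (Fin (M + 3 + 2) → ℂ)) (α β γ a b c : ℂ) : Prop :=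
  NilTable br M α 1 β γ (e 1) (e 2) (eShift M) ∧
    ∃ σ : ℂ, Model br M a b c α (e 1 - σ • eShift M 0) (e 2) (e (M + 3 + 1)) (e (M + 3 + 2))
      (shiftOne (eShift M) (e 2) (σ * γ))

theorem isStandard_extend {M : ℕ} (hM : 1 ≤ M) {α β γ a b c : ℂ} (σ : ℂ)
    {rx lx ry ly : ℕ → Fin (M + 3 + 2) → ℂ}
    (ha : a = 1 - σ * β + σ * σ * γ) (hb : b = β - 2 * (σ * γ)) (hc : c = γ)
    (type : (a = 1 ∧ b = 0 ∧ c = 0) ∨ (a = 0 ∧ b = 1 ∧ c = 0) ∨ (a = 0 ∧ b = 0 ∧ c = 1))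
    (eps : α = 0 ∨ α = 1 ∧ Even M) (hσ : α = 1 → σ = 1)
    (rx1 : rx 1 - σ • rx 3 = e 1 - σ • e 3) (ry1 : ry 1 - σ • ry 3 = 0)
    (lx1 : lx 1 - σ • lx 3 = -(e 1 - σ • e 3)) (ly1 : ly 1 - σ • ly 3 = 0)
    (rx2 : rx 2 = (2 * a + b) • e 2) (ry2 : ry 2 = (b + 2 * c) • e 2) (lx2 : lx 2 = 0)
    (ly2 : ly 2 = 0)
    (rxg : ∀ i ≤ M, rx (i + 3) - (if i = 1 then σ * γ else 0) • rx 2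
      = weightX M α i • (e (i + 3) - (if i = 1 then σ * γ else 0) • e 2))
    (ryg : ∀ i ≤ M, ry (i + 3) - (if i = 1 then σ * γ else 0) • ry 2
      = weightY M α i • (e (i + 3) - (if i = 1 then σ * γ else 0) • e 2))
    (lxg : ∀ i ≤ M, lx (i + 3) = -(weightX M α i • (e (i + 3)
      - (if i = 1 then σ * γ else 0) • e 2)) + (if i = 1 then b else 0) • e 2)
    (lyg : ∀ i ≤ M, ly (i + 3) = -(weightY M α i • (e (i + 3)
      - (if i = 1 then σ * γ else 0) • e 2))) :
    IsStandard M (extend (M + 3) α β γ rx lx ry ly) α β γ a b c := by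
  have t : NilTable (extend (M + 3) α β γ rx lx ry ly) M α 1 β γ (e 1) (e 2) (eShift M) :=
    nilTable_ofTable hM (by omega) α β γ fun i j hi hj => if_pos ⟨hi, hj⟩
  have h0 : (eShift M 0 : Fin (M + 3 + 2) → ℂ) = e 3 := eShift_of_le (Nat.zero_le M)
  have hz : ∀ i, ¬ i ≤ M → shiftOne (eShift M) (e 2 : Fin (M + 3 + 2) → ℂ) (σ * γ) i = 0 := by
    intro i hi
    rw [shiftOne, eShift_of_lt (by omega), if_neg (by omega)]; simp
  have hs : ∀ i ≤ M, shiftOne (eShift M) (e 2 : Fin (M + 3 + 2) → ℂ) (σ * γ) i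
      = e (i + 3) - (if i = 1 then σ * γ else 0) • e 2 := by
    intro i hi
    rw [shiftOne, eShift_of_le hi]
  refine ⟨t, σ, t.model (frame_e M) hM ha hb hc type eps hσ ?_ ?_ ?_ ?_ ?_ ?_ ?_ ?_ ?_ ?_ ?_ ?_
    (fun i => ?_) (fun i => ?_) (fun i => ?_) (fun i => ?_)⟩
  · rw [h0, map_sub, map_smul, LinearMap.sub_apply, LinearMap.smul_apply,
      extend_right_x (by omega) (by omega), extend_right_x (by omega) (by omega), rx1]
  · rw [h0, map_sub, map_smul, LinearMap.sub_apply, LinearMap.smul_apply,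
      extend_right_y (by omega) (by omega), extend_right_y (by omega) (by omega), ry1]
  · rw [extend_right_x (by omega) (by omega), rx2]
  · rw [extend_right_y (by omega) (by omega), ry2]
  · rw [h0, map_sub, map_smul, extend_left_x (by omega) (by omega),
      extend_left_x (by omega) (by omega), lx1]
  · rw [extend_left_x (by omega) (by omega), lx2]
  · exact extend_torus (by omega) (by omega) (by omega) (by omega)
  · exact extend_torus (by omega) (by omega) (by omega) (by omega)
  · rw [h0, map_sub, map_smul, extend_left_y (by omega) (by omega),
      extend_left_y (by omega) (by omega), ly1]
  · rw [extend_left_y (by omega) (by omega), ly2]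
  · exact extend_torus (by omega) (by omega) (by omega) (by omega)
  · exact extend_torus (by omega) (by omega) (by omega) (by omega)
  · by_cases hi : i ≤ M
    · rw [hs i hi, map_sub, map_smul, LinearMap.sub_apply, LinearMap.smul_apply,
        extend_right_x (by omega) (by omega), extend_right_x (by omega) (by omega), rxg i hi]
    · rw [hz i hi]; simp
  · by_cases hi : i ≤ M
    · rw [hs i hi, map_sub, map_smul, LinearMap.sub_apply, LinearMap.smul_apply,
        extend_right_y (by omega) (by omega), extend_right_y (by omega) (by omega), ryg i hi]
    · rw [hz i hi]; simp
  · by_cases hi : i ≤ M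
    · rw [hs i hi, map_sub, map_smul, extend_left_x (by omega) (by omega),
        extend_left_x (by omega) (by omega), lx2, smul_zero, sub_zero, lxg i hi]
    · rw [hz i hi, if_neg (by omega)]; simp
  · by_cases hi : i ≤ M
    · rw [hs i hi, map_sub, map_smul, extend_left_y (by omega) (by omega),
        extend_left_y (by omega) (by omega), ly2, smul_zero, sub_zero, lyg i hi]
    · rw [hz i hi]; simp

theorem weightX_zero (M i : ℕ) : weightX M 0 i = i := by
  unfold weightX; split_ifs with h <;> simp [h]

theorem weightY_zero (M i : ℕ) : weightY M 0 i = 1 := by simp [weightY]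

/-- Here `e_1` is itself a weight vector, so `σ = 0`; in the other five algebras the weight vector
is `e_1 - e_3`. -/
theorem isStandard_H1 {M : ℕ} (hM : 1 ≤ M) : IsStandard M (H1 (M + 3)) 0 0 0 1 0 0 := by
  refine isStandard_extend hM 0 (by norm_num) (by norm_num) rfl (by norm_num) (.inl rfl) (by simp)
    ?_ ?_ ?_ ?_ ?_ ?_ ?_ ?_ (fun i hi => ?_) (fun i hi => ?_) (fun i hi => ?_) (fun i hi => ?_)
  iterate 8 (simp; try module)
  all_goals
    by_cases hi1 : i = 1
    · subst hi1
      simp [weightX_zero, weightY_zero]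
      try norm_num
      try module
    · simp [weightX_zero, weightY_zero, hi1]

/-- The form is `s (s + t)`; both `e_1 - e_3` and `e_3` are isotropic, which gives type `b = 1`. -/
theorem isStandard_H2 {M : ℕ} (hM : 1 ≤ M) : IsStandard M (H2 (M + 3)) 0 1 0 0 1 0 := by
  refine isStandard_extend hM 1 (by norm_num) (by norm_num) rfl (by norm_num) (.inl rfl) (by simp)
    ?_ ?_ ?_ ?_ ?_ ?_ ?_ ?_ (fun i hi => ?_) (fun i hi => ?_) (fun i hi => ?_) (fun i hi => ?_)
  iterate 8 (simp; try module)
  all_goals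
    by_cases hi1 : i = 1
    · subst hi1
      simp [weightX_zero, weightY_zero]
      try norm_num
      try module
    · simp [weightX_zero, weightY_zero, hi1]

/-- The form is `(s + t)²`, with radical spanned by `e_1 - e_3`, which gives type `c = 1`. -/
theorem isStandard_H3 {M : ℕ} (hM : 1 ≤ M) : IsStandard M (H3 (M + 3)) 0 2 1 0 0 1 := by
  refine isStandard_extend hM 1 (by norm_num) (by norm_num) rfl (by norm_num) (.inl rfl) (by simp)
    ?_ ?_ ?_ ?_ ?_ ?_ ?_ ?_ (fun i hi => ?_) (fun i hi => ?_) (fun i hi => ?_) (fun i hi => ?_)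
  iterate 8 (simp; try module)
  all_goals
    by_cases hi1 : i = 1
    · subst hi1
      simp [weightX_zero, weightY_zero]
      try norm_num
      try module
    · simp [weightX_zero, weightY_zero, hi1]

theorem isStandard_H4 {M : ℕ} (hM : 1 ≤ M) (he : Even M) :
    IsStandard M (H4 (M + 3)) 1 0 0 1 0 0 := by
  have h1 : 1 ≠ M := by rintro rfl; exact absurd he (by decide)
  have h0 : 0 ≠ M := by omega
  refine isStandard_extend hM 1 (by norm_num) (by norm_num) rfl (by norm_num) (.inr ⟨rfl, he⟩)
    (by simp)
    ?_ ?_ ?_ ?_ ?_ ?_ ?_ ?_ (fun i hi => ?_) (fun i hi => ?_) (fun i hi => ?_) (fun i hi => ?_)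
  iterate 8 (simp [h0, h0.symm]; try module)
  all_goals
    by_cases hi1 : i = 1
    · subst hi1
      simp [weightX_of_ne h1, weightY_of_ne h1, h1, h1.symm]
      try norm_num
      try module
    by_cases hiM : i = M
    · subst hiM
      simp [weightX_self, weightY_self, hi1]
      try module
    · simp [weightX_of_ne hiM, weightY_of_ne hiM, hi1, hiM]

theorem isStandard_H5 {M : ℕ} (hM : 1 ≤ M) (he : Even M) :
    IsStandard M (H5 (M + 3)) 1 1 0 0 1 0 := by
  have h1 : 1 ≠ M := by rintro rfl; exact absurd he (by decide)
  have h0 : 0 ≠ M := by omega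
  refine isStandard_extend hM 1 (by norm_num) (by norm_num) rfl (by norm_num) (.inr ⟨rfl, he⟩)
    (by simp)
    ?_ ?_ ?_ ?_ ?_ ?_ ?_ ?_ (fun i hi => ?_) (fun i hi => ?_) (fun i hi => ?_) (fun i hi => ?_)
  iterate 8 (simp [h0, h0.symm]; try module)
  all_goals
    by_cases hi1 : i = 1
    · subst hi1
      simp [weightX_of_ne h1, weightY_of_ne h1, h1, h1.symm]
      try norm_num
      try module
    by_cases hiM : i = M
    · subst hiM
      simp [weightX_self, weightY_self, hi1]
      try module
    · simp [weightX_of_ne hiM, weightY_of_ne hiM, hi1, hiM]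

theorem isStandard_H6 {M : ℕ} (hM : 1 ≤ M) (he : Even M) :
    IsStandard M (H6 (M + 3)) 1 2 1 0 0 1 := by
  have h1 : 1 ≠ M := by rintro rfl; exact absurd he (by decide)
  have h0 : 0 ≠ M := by omega
  refine isStandard_extend hM 1 (by norm_num) (by norm_num) rfl (by norm_num) (.inr ⟨rfl, he⟩)
    (by simp)
    ?_ ?_ ?_ ?_ ?_ ?_ ?_ ?_ (fun i hi => ?_) (fun i hi => ?_) (fun i hi => ?_) (fun i hi => ?_)
  iterate 8 (simp [h0, h0.symm]; try module)
  all_goals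
    by_cases hi1 : i = 1
    · subst hi1
      simp [weightX_of_ne h1, weightY_of_ne h1, h1, h1.symm]
      try norm_num
      try module
    by_cases hiM : i = M
    · subst hiM
      simp [weightX_self, weightY_self, hi1]
      try module
    · simp [weightX_of_ne hiM, weightY_of_ne hiM, hi1, hiM]

end StandardModels

/-! ### Right multiplications act triangularly on the nilradical. -/

section Triangular

variable {L : Type*} [AddCommGroup L] [Module ℂ L]

theorem IsLeibniz.bracket_bracket {br : Mul₂ L} (h : IsLeibniz br) (p q z : L) :
    br (br p q) z = br p (br q z) + br (br p z) q := by
  rw [h p q z, sub_add_cancel]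

namespace NilTable

variable {br : Mul₂ L} {M : ℕ} {α δ β γ : ℂ} {E U x y : L} {g : ℕ → L}

theorem map₂_core_le (t : NilTable br M α δ β γ E U g) (hM : 1 ≤ M) :
    map₂ br (core E U g) (core E U g) ≤ tail U g 1 := by
  have hu := u_mem_tail U g 1
  have hg : ∀ i, g (i + 1) ∈ tail U g 1 := fun i => g_mem_tail U g (by omega)
  have hgM : g M ∈ tail U g 1 := g_mem_tail U g hM
  refine map₂_span_le ?_
  rintro p ((rfl | rfl) | ⟨i, rfl⟩) q ((rfl | rfl) | ⟨j, rfl⟩) <;>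
  simp only [t.EE, t.EU, t.Eg, t.UE, t.UU, t.Ug, t.gE, t.gU, t.gg] <;>
  repeat' first
    | exact hu
    | exact hg _
    | exact hgM
    | exact zero_mem _
    | refine add_mem ?_ ?_
    | refine neg_mem ?_
    | refine smul_mem _ _ ?_

theorem map₂_tail_core_le (t : NilTable br M α δ β γ E U g) (k : ℕ) :
    map₂ br (tail U g k) (core E U g) ≤ tail U g (k + 1) := by
  have hu := u_mem_tail U g (k + 1)
  refine map₂_span_le ?_
  rintro p (rfl | ⟨i, hi, rfl⟩) q ((rfl | rfl) | ⟨j, rfl⟩)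
  · simp [t.UE]
  · simp [t.UU]
  · simp [t.Ug]
  · rw [t.gE]
    exact g_mem_tail U g (Nat.succ_le_succ hi)
  · simp [t.gU]
  · rw [t.gg]
    refine add_mem (smul_mem _ _ hu) ?_
    have hi : k ≤ i := hi
    by_cases hij : i + j + 1 = M
    · exact smul_mem _ _ (g_mem_tail U g (by omega))
    · simp [pairCoeff_of_ne hij]

/-- Products of the `g i` involve only `U`, which lies in every tail, and `α g M`. The latter is
harmless if `α = 0`, if `g M` lies in the target, or if the indices exceed the antidiagonal `i + j =
M - 1`. -/
theorem map₂_tail_tail_le (t : NilTable br M α δ β γ E U g) {k l m : ℕ}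
    (h : α = 0 ∨ m ≤ M ∨ M ≤ k + l) : map₂ br (tail U g k) (tail U g l) ≤ tail U g m := by
  have hu := u_mem_tail U g m
  refine map₂_span_le ?_
  rintro p (rfl | ⟨i, hi, rfl⟩) q (rfl | ⟨j, hj, rfl⟩)
  · simp [t.UU]
  · simp [t.Ug]
  · simp [t.gU]
  · rw [t.gg]
    refine add_mem (smul_mem _ _ hu) ?_
    have hi : k ≤ i := hi
    have hj : l ≤ j := hj
    rcases h with rfl | h | h
    · simp [pairCoeff]
    · exact smul_mem _ _ (g_mem_tail U g h)
    · rw [pairCoeff_of_ne (by omega)]; simp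

theorem bracket_add_bracket (t : NilTable br M α δ β γ E U g) (h : Frame M E U x y g)
    (hα : α = 0 ∨ α = 1 ∧ Even M) {p q : L} (hp : p ∈ core E U g) (hq : q ∈ core E U g) :
    br p q + br q p = (2 * δ * (h.cf p * h.cf q) + β * (h.cf p * h.cg 0 q + h.cg 0 p * h.cf q)
      + 2 * γ * (h.cg 0 p * h.cg 0 q)) • U := by
  have aux : ∀ i, h.cg 0 (g i) = if i = 0 then 1 else 0 := fun i => by
    rw [h.cg_g]; congr 1; exact propext ⟨fun h => h.1.symm, fun h => ⟨h.symm, by omega⟩⟩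
  induction hp, hq using span_induction₂ with
  | mem_mem p q hp hq =>
    rcases hp with (rfl | rfl) | ⟨i, rfl⟩ <;> rcases hq with (rfl | rfl) | ⟨j, rfl⟩
    · simp [t.EE]; module
    · simp [t.EU, t.UE]
    · simp [t.Eg, t.gE, aux, -ite_smul]
    · simp [t.EU, t.UE]
    · simp [t.UU]
    · simp [t.gU, t.Ug]
    · simp [t.Eg, t.gE, aux, -ite_smul]
    · simp [t.gU, t.Ug]
    · rw [t.gg, t.gg, pairCoeff_comm hα j i]
      simp only [aux, h.cf_g]
      match_scalars
      · grind
      · ring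
  | zero_left => simp
  | zero_right => simp
  | add_left p p' q _ _ _ h1 h2 =>
    simp only [map_add, LinearMap.add_apply]
    linear_combination (norm := module) h1 + h2
  | add_right p q q' _ _ _ h1 h2 =>
    simp only [map_add, LinearMap.add_apply]
    linear_combination (norm := module) h1 + h2
  | smul_left t p q _ _ h1 =>
    simp only [map_smul, LinearMap.smul_apply, smul_eq_mul]
    linear_combination (norm := module) t • h1
  | smul_right t p q _ _ h1 =>
    simp only [map_smul, LinearMap.smul_apply, smul_eq_mul]
    linear_combination (norm := module) t • h1

end NilTable

/-- A Leibniz algebra with an ideal of codimension two that has the multiplication table of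
`G(α, β, γ)`, normalised such that `g 0` spans an invariant line modulo the derived ideal. -/
structure Extension (br : Mul₂ L) (M : ℕ) (α δ β γ : ℂ) (E U x y : L) (g : ℕ → L) : Prop
    extends Frame M E U x y g, NilTable br M α δ β γ E U g where
  one_le : 1 ≤ M
  leibniz : IsLeibniz br
  ideal : IsIdeal br (core E U g)
  coeff : δ ≠ 0 ∨ β ≠ 0 ∨ γ ≠ 0
  alpha : α = 0 ∨ α = 1 ∧ Even M ∧ 4 ≤ M
  isotropic : M = 1 → γ = 0

namespace Extension

variable {br : Mul₂ L} {M : ℕ} {α δ β γ : ℂ} {E U x y : L} {g : ℕ → L}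

theorem alpha_even (h : Extension br M α δ β γ E U x y g) : α = 0 ∨ α = 1 ∧ Even M :=
  h.alpha.imp_right fun h => ⟨h.1, h.2.1⟩

theorem bracket_mem (h : Extension br M α δ β γ E U x y g) {v : L} (hv : v ∈ core E U g) (z : L) :
    br v z ∈ core E U g := (h.ideal v hv z).1

/-- The eigenvalue of `[·, z]` on `E` modulo the span of the other basis vectors. -/
noncomputable def chA (h : Extension br M α δ β γ E U x y g) : L →ₗ[ℂ] ℂ := h.cf ∘ₗ br E
/-- The eigenvalue of `[·, z]` on `g 0` modulo the derived ideal. -/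
noncomputable def chB (h : Extension br M α δ β γ E U x y g) : L →ₗ[ℂ] ℂ := h.cg 0 ∘ₗ br (g 0)

/-- Only `[g 1, E]` contributes to `g 2`: the pairing has values in the line of `g M`, which differs
from `g 2` because `α ≠ 0` requires `M ≥ 4`. -/
theorem cg_two_bracket (h : Extension br M α δ β γ E U x y g) (hM : 2 ≤ M) {v w : L}
    (hv : v ∈ tail U g 1) (hw : w ∈ core E U g) : h.cg 2 (br v w) = h.cg 1 v * h.cf w := by
  have hp : ∀ i j, pairCoeff M α i j * h.cg 2 (g M) = 0 := fun i j => by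
    rcases h.alpha with rfl | ⟨_, _, h4⟩
    · simp [pairCoeff]
    · rw [h.cg_g_ne (by omega), mul_zero]
  induction hv, hw using span_induction₂ with
  | mem_mem v w hv hw =>
    rcases hv with rfl | ⟨i, hi, rfl⟩ <;> rcases hw with (rfl | rfl) | ⟨j, rfl⟩
    · simp [h.UE]
    · simp [h.UU]
    · simp [h.Ug]
    · rw [h.gE, h.cg_g, h.cg_g, h.cf_f]
      by_cases hi1 : i = 1
      · subst hi1; rw [if_pos ⟨rfl, hM⟩, if_pos ⟨rfl, by omega⟩, one_mul]
      · rw [if_neg (by omega), if_neg (by omega), zero_mul]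
    · simp [h.gU]
    · simp [h.gg, hp, -ite_smul]
  | zero_left => simp
  | zero_right => simp
  | add_left p p' q _ _ _ h1 h2 => simp only [map_add, LinearMap.add_apply, h1, h2]; ring
  | add_right p q q' _ _ _ h1 h2 => simp only [map_add, h1, h2]; ring
  | smul_left t p q _ _ h1 => simp only [map_smul, LinearMap.smul_apply, h1, smul_eq_mul]; ring
  | smul_right t p q _ _ h1 => simp only [map_smul, h1, smul_eq_mul]; ring

theorem bracket_core_mem (h : Extension br M α δ β γ E U x y g) {v w : L} (hv : v ∈ core E U g)
    (hw : w ∈ core E U g) : br v w ∈ tail U g 1 :=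
  h.map₂_core_le h.one_le (apply_mem_map₂ _ hv hw)

/-- The symmetrised bracket of a product with `z`. -/
theorem symm_bracket (h : Extension br M α δ β γ E U x y g) (p q z : L) :
    br (br p q + br q p) z = (br p (br q z) + br (br q z) p) + (br (br p z) q + br q (br p z)) := by
  rw [map_add, LinearMap.add_apply, h.leibniz.bracket_bracket p q, h.leibniz.bracket_bracket q p]
  abel

/-- The fact for which the normalisation in `Extension` is made. For `M ≥ 2`, apply the derivation
`[·, z]` to `[g 1, g 0] = 0` and read off the coefficient of `g 2`. For `M = 1` the form plays this
role: `g 0` is isotropic, and a derivation must preserve the form up to a scalar. -/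
theorem cf_bracket_g_zero (h : Extension br M α δ β γ E U x y g) (z : L) :
    h.cf (br (g 0) z) = 0 := by
  have hE := f_mem_core E U g
  have hg := g_mem_core E U g
  have hw := h.bracket_mem (hg 0) z
  have hv := h.bracket_mem hE z
  by_cases hM : 2 ≤ M
  · have h1 : br (g 1) (g 0) = 0 := by
      rw [h.gg, if_neg (by omega), pairCoeff]
      split_ifs with h2
      · rcases h.alpha with rfl | ⟨_, _, h4⟩
        · simp
        · omega
      · simp
    have h2 := h.leibniz.bracket_bracket (g 1) (g 0) z
    have h3 : br (g 1) z ∈ tail U g 1 := by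
      have := h.leibniz.bracket_bracket (g 0) E z
      rw [h.gE] at this
      rw [this]
      exact add_mem (h.bracket_core_mem (hg 0) hv) (h.bracket_core_mem hw hE)
    have h4 := congrArg (h.cg 2) h2
    rw [h1, map_zero, LinearMap.zero_apply, map_zero, map_add,
      h.cg_two_bracket hM (g_mem_tail U g le_rfl) hw, h.cg_two_bracket hM h3 (hg 0), h.cf_g,
      h.cg_g_self h.one_le] at h4
    simpa using h4.symm
  · have hM1 : M = 1 := by have := h.one_le; omega
    have hγ := h.isotropic hM1
    have hU := h.u_ne_zero
    -- If `β ≠ 0`, differentiate the zero square of `g 0`. If `β = 0`, then `δ ≠ 0`, and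
    -- differentiating the vanishing symmetrised product of `E` and `g 0` gives the claim.
    have hs := fun {p q : L} => h.bracket_add_bracket h.toFrame h.alpha_even (p := p) (q := q)
    have h1 := h.symm_bracket (g 0) (g 0) z
    have h2 := h.symm_bracket E (g 0) z
    rw [hs (hg 0) (hg 0), hs (hg 0) hw, hs hw (hg 0)] at h1
    rw [hs hE (hg 0), hs hE hw, hs hv (hg 0)] at h2
    simp only [h.cf_f, h.cf_g, h.cg_f, h.cg_g_self (Nat.zero_le M), hγ] at h1 h2
    by_cases hβ : β = 0
    · simp only [hβ] at h2
      rw [← sub_eq_zero] at h2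
      simp [hU] at h2
      have := h.coeff
      simp [hβ, hγ] at this
      simpa [this] using h2
    · simp at h1
      have h3 : (β * h.cf (br (g 0) z) + β * h.cf (br (g 0) z)) • U = 0 := by
        rw [add_smul]; exact h1.symm
      simpa [hU, ← two_mul, hβ] using h3

theorem sub_mem_E (h : Extension br M α δ β γ E U x y g) (z : L) :
    br E z - h.chA z • E ∈ tail U g 0 :=
  h.sub_mem_tail_zero (h.bracket_mem (f_mem_core E U g) z)

theorem sub_mem_g_zero (h : Extension br M α δ β γ E U x y g) (z : L) :
    br (g 0) z - h.chB z • g 0 ∈ tail U g 1 :=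
  h.sub_mem_tail_succ ((h.mem_tail_iff _ _).2
    ⟨h.bracket_mem (g_mem_core E U g 0) z, h.cf_bracket_g_zero z, by simp⟩)

/-- Differentiate a nonzero symmetrised product: of `g 0` with itself if `γ ≠ 0`, of `E` and `g 0`
if `γ = 0 ≠ β`, of `E` with itself otherwise. The natural numbers `i, j` count the factors `E` and
`g 0`. -/
theorem exists_weight_U (h : Extension br M α δ β γ E U x y g) :
    ∃ i j : ℕ, i + j = 2 ∧ ∀ z, br U z = (i * h.chA z + j * h.chB z) • U := by
  have hE := f_mem_core E U g
  have hg := g_mem_core E U g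
  have hs := fun {p q : L} => h.bracket_add_bracket h.toFrame h.alpha_even (p := p) (q := q)
  have hA : ∀ z, h.cf (br E z) = h.chA z := fun _ => rfl
  have hB : ∀ z, h.cg 0 (br (g 0) z) = h.chB z := fun _ => rfl
  by_cases hγ : γ = 0
  · subst hγ
    by_cases hβ : β = 0
    · subst hβ
      have hδ : δ ≠ 0 := by simpa using h.coeff
      refine ⟨2, 0, rfl, fun z => ?_⟩
      have h1 := h.symm_bracket E E z
      rw [hs hE hE, hs hE (h.bracket_mem hE z), hs (h.bracket_mem hE z) hE] at h1
      simp only [h.cf_f, h.cg_f, hA, map_smul, LinearMap.smul_apply] at h1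
      refine smul_right_injective L (mul_ne_zero two_ne_zero hδ) ?_
      simp only
      linear_combination (norm := (push_cast; module)) h1
    · refine ⟨1, 1, rfl, fun z => ?_⟩
      have h1 := h.symm_bracket E (g 0) z
      rw [hs hE (hg 0), hs hE (h.bracket_mem (hg 0) z), hs (h.bracket_mem hE z) (hg 0)] at h1
      simp only [h.cf_f, h.cf_g, h.cg_f, h.cg_g_self (Nat.zero_le M), h.cf_bracket_g_zero, hA,
        hB, map_smul, LinearMap.smul_apply] at h1
      refine smul_right_injective L hβ ?_
      simp only
      linear_combination (norm := (push_cast; module)) h1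
  · refine ⟨0, 2, rfl, fun z => ?_⟩
    have h1 := h.symm_bracket (g 0) (g 0) z
    rw [hs (hg 0) (hg 0), hs (hg 0) (h.bracket_mem (hg 0) z),
      hs (h.bracket_mem (hg 0) z) (hg 0)] at h1
    simp only [h.cf_g, h.cg_g_self (Nat.zero_le M), h.cf_bracket_g_zero, hB, map_smul,
      LinearMap.smul_apply] at h1
    refine smul_right_injective L (mul_ne_zero two_ne_zero hγ) ?_
    simp only
    linear_combination (norm := (push_cast; module)) h1

/-- Since `g (j + 1) = [g j, E]`, each step adds the eigenvalue of `E`. For `α = 1` the last step is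
excluded, because a `g 0`-part of `[E, z]` then also contributes to `g M`. -/
theorem sub_mem_g_aux (h : Extension br M α δ β γ E U x y g) (z : L) (j : ℕ)
    (hj : α = 0 ∨ j < M) : br (g j) z - (j * h.chA z + h.chB z) • g j ∈ tail U g (j + 1) := by
  induction j with
  | zero => simpa using h.sub_mem_g_zero z
  | succ j ih =>
    have ih := ih (hj.imp_right fun hj => by omega)
    have h1 := h.leibniz.bracket_bracket (g j) E z
    rw [h.gE] at h1
    have h2 := h.map₂_tail_core_le (j + 1) (apply_mem_map₂ _ ih (f_mem_core E U g))
    have h3 : br (g j) (br E z - h.chA z • E) ∈ tail U g (j + 1 + 1) :=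
      h.map₂_tail_tail_le (hj.imp_right fun hj => .inl (by omega))
        (apply_mem_map₂ _ (g_mem_tail U g le_rfl) (h.sub_mem_E z))
    have h4 := add_mem h2 h3
    simp only [map_sub, map_smul, LinearMap.sub_apply, LinearMap.smul_apply, h.gE] at h4
    rw [h1]
    convert h4 using 1
    push_cast
    module

/-- `[·, z]` is triangular on the nilradical. -/
theorem sub_mem_g (h : Extension br M α δ β γ E U x y g) (z : L) (j : ℕ) :
    br (g j) z - (weightX M α j * h.chA z + weightY M α j * h.chB z) • g j
      ∈ tail U g (j + 1) := by
  rcases lt_trichotomy j M with hj | rfl | hj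
  · simpa [weightX_of_ne hj.ne, weightY_of_ne hj.ne] using h.sub_mem_g_aux z j (.inr hj)
  · rcases h.alpha with rfl | ⟨rfl, he, h4⟩
    · simpa [weightX_self, weightY_self] using h.sub_mem_g_aux z j (.inl rfl)
    · obtain ⟨k, rfl⟩ : ∃ k, j = k + 1 := ⟨j - 1, by omega⟩
      have h0 : br (g k) (g 0) = g (k + 1) := by
        rw [h.gg, if_neg (by omega), pairCoeff, if_pos (by omega), he.neg_one_pow]
        simp
      have h1 := h.leibniz.bracket_bracket (g k) (g 0) z
      rw [h0] at h1
      have h2 := h.map₂_tail_core_le (k + 1)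
        (apply_mem_map₂ _ (h.sub_mem_g_aux z k (.inr (by omega))) (g_mem_core E U g 0))
      have h3 : br (g k) (br (g 0) z - h.chB z • g 0) ∈ tail U g (k + 1 + 1) :=
        h.map₂_tail_tail_le (.inr (.inr le_rfl))
          (apply_mem_map₂ _ (g_mem_tail U g le_rfl) (h.sub_mem_g_zero z))
      have h5 := add_mem h2 h3
      simp only [map_sub, map_smul, LinearMap.sub_apply, LinearMap.smul_apply, h0] at h5
      rw [h1, weightX_self, weightY_self]
      convert h5 using 1
      push_cast
      module
  · simp [h.g_zero j hj]

end Extension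
end Triangular

/-! ### The common kernel of the two characters is the nilradical. -/

section Nilradical

variable {L : Type*} [AddCommGroup L] [Module ℂ L]

/-- Otherwise the nonzero solvable quotient by `N` would equal its own derived algebra. -/
theorem IsSolvable.sup_map₂_ne_top {br : Mul₂ L} (hs : IsSolvable br) {N : Submodule ℂ L}
    (hN : IsIdeal br N) (hN' : N ≠ ⊤) : N ⊔ map₂ br ⊤ ⊤ ≠ ⊤ := by
  intro h
  obtain ⟨s, hs⟩ := hs
  have key : ∀ s, N ⊔ derivedSeries br s = ⊤ := by
    intro s
    induction s with
    | zero => simp [derivedSeries]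
    | succ s ih =>
      refine eq_top_iff.2 (h.ge.trans (sup_le le_sup_left ?_))
      rw [map₂_le]
      intro v _ w _
      have hv : v ∈ N ⊔ derivedSeries br s := by rw [ih]; trivial
      have hw : w ∈ N ⊔ derivedSeries br s := by rw [ih]; trivial
      obtain ⟨n, hn, d, hd, rfl⟩ := mem_sup.1 hv
      obtain ⟨n', hn', d', hd', rfl⟩ := mem_sup.1 hw
      rw [LinearMap.map_add₂, map_add (br d), ← add_assoc]
      exact add_mem (mem_sup_left (add_mem (hN n hn _).1 (hN n' hn' d).2))
        (mem_sup_right (apply_mem_map₂ _ hd hd'))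
  have := key s
  rw [hs, sup_bot_eq] at this
  exact hN' this

theorem isIdeal_of_map₂_top_le {br : Mul₂ L} {J : Submodule ℂ L} (h : map₂ br ⊤ ⊤ ≤ J) :
    IsIdeal br J :=
  fun _ _ _ => ⟨h (apply_mem_map₂ _ trivial trivial), h (apply_mem_map₂ _ trivial trivial)⟩

namespace Extension

variable {br : Mul₂ L} {M : ℕ} {α δ β γ : ℂ} {E U x y : L} {g : ℕ → L}

theorem chA_of_mem_core (h : Extension br M α δ β γ E U x y g) {v : L} (hv : v ∈ core E U g) :
    h.chA v = 0 :=
  ((h.mem_tail_iff _ _).1 (h.bracket_core_mem (f_mem_core E U g) hv)).2.1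

theorem chB_of_mem_core (h : Extension br M α δ β γ E U x y g) {v : L} (hv : v ∈ core E U g) :
    h.chB v = 0 :=
  ((h.mem_tail_iff _ _).1 (h.bracket_core_mem (g_mem_core E U g 0) hv)).2.2 0 one_pos

theorem bracket_tail (h : Extension br M α δ β γ E U x y g) {k : ℕ} {v : L}
    (hv : v ∈ tail U g k) (z : L) : br v z ∈ tail U g k := by
  have key : tail U g k ≤ (tail U g k).comap (br.flip z) := by
    refine tail_le ?_ fun i hi => ?_
    · obtain ⟨i, j, _, hU⟩ := h.exists_weight_U
      rw [mem_comap, LinearMap.flip_apply, hU]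
      exact smul_mem _ _ (u_mem_tail U g k)
    · rw [mem_comap, LinearMap.flip_apply]
      have := add_mem (tail_anti U g (by omega) (h.sub_mem_g z i) : _ ∈ tail U g k)
        (smul_mem _ (weightX M α i * h.chA z + weightY M α i * h.chB z) (g_mem_tail U g hi))
      rwa [sub_add_cancel] at this
  exact key hv

theorem bracket_tail_succ (h : Extension br M α δ β γ E U x y g) {k : ℕ} {v z : L}
    (hv : v ∈ tail U g k) (hA : h.chA z = 0) (hB : h.chB z = 0) : br v z ∈ tail U g (k + 1) := by
  have key : tail U g k ≤ (tail U g (k + 1)).comap (br.flip z) := by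
    refine tail_le ?_ fun i hi => ?_
    · obtain ⟨i, j, _, hU⟩ := h.exists_weight_U
      rw [mem_comap, LinearMap.flip_apply, hU, hA, hB]
      simp
    · rw [mem_comap, LinearMap.flip_apply]
      simpa [hA, hB] using
        (tail_anti U g (by omega) (h.sub_mem_g z i) : _ ∈ tail U g (k + 1))
  exact key hv

theorem cf_bracket (h : Extension br M α δ β γ E U x y g) {v : L} (hv : v ∈ core E U g) (z : L) :
    h.cf (br v z) = h.cf v * h.chA z := by
  have h1 := h.bracket_tail (h.sub_mem_tail_zero hv) z
  have h2 := ((h.mem_tail_iff _ _).1 h1).2.1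
  simp only [map_sub, map_smul, LinearMap.sub_apply, LinearMap.smul_apply, sub_eq_zero] at h2
  exact h2

theorem cg_zero_bracket (h : Extension br M α δ β γ E U x y g) {v : L} (hv : v ∈ tail U g 0)
    (z : L) : h.cg 0 (br v z) = h.cg 0 v * h.chB z := by
  have h1 := h.bracket_tail (h.sub_mem_tail_succ hv) z
  have h2 := ((h.mem_tail_iff _ _).1 h1).2.2 0 one_pos
  simp only [map_sub, map_smul, LinearMap.sub_apply, LinearMap.smul_apply, sub_eq_zero] at h2
  exact h2

theorem g_zero_mem_tail (_ : Extension br M α δ β γ E U x y g) : g 0 ∈ tail U g 0 :=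
  g_mem_tail U g le_rfl

/-- Right multiplications act on the leading coordinate by scalars, and scalars commute, so the
commutator acts by zero. -/
theorem chA_bracket (h : Extension br M α δ β γ E U x y g) (v w : L) : h.chA (br v w) = 0 := by
  have hE := f_mem_core E U g
  change h.cf (br E (br v w)) = 0
  rw [h.leibniz, map_sub, h.cf_bracket (h.bracket_mem hE v), h.cf_bracket (h.bracket_mem hE w),
    h.cf_bracket hE, h.cf_bracket hE]
  ring

theorem chB_bracket (h : Extension br M α δ β γ E U x y g) (v w : L) : h.chB (br v w) = 0 := by
  have hg := h.g_zero_mem_tail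
  change h.cg 0 (br (g 0) (br v w)) = 0
  rw [h.leibniz, map_sub, h.cg_zero_bracket (h.bracket_tail hg v),
    h.cg_zero_bracket (h.bracket_tail hg w), h.cg_zero_bracket hg, h.cg_zero_bracket hg]
  ring

/-- Both characters vanish on the larger ideal, so right multiplication by it kills the leading
coordinates and raises the tail index; `U` is killed last. -/
theorem isNilpotentIdeal_sup_span (h : Extension br M α δ β γ E U x y g) {v : L}
    (hv : v ∉ core E U g) (hA : h.chA v = 0) (hB : h.chB v = 0)
    (hJ : IsIdeal br (core E U g ⊔ span ℂ {v})) :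
    IsNilpotentIdeal br (core E U g ⊔ span ℂ {v}) := by
  set N := core E U g with hN
  set J := N ⊔ span ℂ {v} with hJd
  have hvJ : v ∈ J := mem_sup_right (mem_span_singleton_self v)
  have hAJ : ∀ z ∈ J, h.chA z = 0 ∧ h.chB z = 0 := by
    intro z hz
    obtain ⟨n, hn, w, hw, rfl⟩ := mem_sup.1 hz
    obtain ⟨s, rfl⟩ := mem_span_singleton.1 hw
    simp [hA, hB, h.chA_of_mem_core hn, h.chB_of_mem_core hn]
  have hvv : br v v ∈ N := by
    -- Write `[v, v] = n + s v`. The Leibniz identity gives `[v, [v, v]] = 0`, hence `s² v ∈ N` and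
    -- `s = 0`.
    obtain ⟨n, hn, w, hw, hnw⟩ := mem_sup.1 (hJ v hvJ v).1
    obtain ⟨s, rfl⟩ := mem_span_singleton.1 hw
    have h1 : br v (br v v) = 0 := by rw [h.leibniz, sub_self]
    rw [← hnw, map_add, map_smul, ← hnw, smul_add, smul_smul, ← add_assoc] at h1
    have h2 : (s * s) • v ∈ N := by
      rw [← neg_eq_of_add_eq_zero_right h1]
      exact neg_mem (add_mem (h.ideal n hn v).2 (smul_mem _ _ hn))
    by_cases hs : s = 0
    · rw [← hnw, hs, zero_smul, add_zero]; exact hn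
    · exact absurd ((smul_mem_iff _ (mul_ne_zero hs hs)).1 h2) hv
  have h1 : lowerSeries br J 1 ≤ N := by
    refine map₂_le.2 fun p hp q hq => ?_
    obtain ⟨n, hn, w, hw, rfl⟩ := mem_sup.1 (hp : p ∈ J)
    obtain ⟨s, rfl⟩ := mem_span_singleton.1 hw
    obtain ⟨n', hn', w', hw', rfl⟩ := mem_sup.1 hq
    obtain ⟨s', rfl⟩ := mem_span_singleton.1 hw'
    rw [LinearMap.map_add₂, map_add (br (s • v)), ← add_assoc]
    refine add_mem (add_mem (h.ideal n hn _).1 (h.ideal n' hn' _).2) ?_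
    rw [map_smul, map_smul, LinearMap.smul_apply]
    exact smul_mem _ _ (smul_mem _ _ hvv)
  have h2 : lowerSeries br J 2 ≤ tail U g 0 := by
    refine map₂_le.2 fun p hp q hq => (h.mem_tail_iff _ _).2 ⟨h.bracket_mem (h1 hp) q, ?_, by simp⟩
    rw [h.cf_bracket (h1 hp), (hAJ q hq).1, mul_zero]
  have h3 : ∀ k, lowerSeries br J (k + 2) ≤ tail U g k := by
    intro k
    induction k with
    | zero => exact h2
    | succ k ih =>
      exact map₂_le.2 fun p hp q hq => h.bracket_tail_succ (ih hp) (hAJ q hq).1 (hAJ q hq).2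
  refine ⟨hJ, M + 1 + 2 + 1, ?_⟩
  rw [eq_bot_iff]
  refine map₂_le.2 fun p hp q hq => ?_
  obtain ⟨i, j, _, hU⟩ := h.exists_weight_U
  rw [h.sub_mem_span_u (h3 _ hp), map_smul, LinearMap.smul_apply, hU, (hAJ q hq).1, (hAJ q hq).2]
  simp

/-- By maximality of the nilradical `N` it suffices that `N` and the element span an ideal, which is
clear if `[L, L] ⊆ N`. Otherwise pick `w ∈ [L, L]` outside `N`. By solvability `N + [L, L]` is
proper, so codimension two makes it equal to `N + ℂ w`. This is an ideal, and both characters vanish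
at `w`: a contradiction. -/
theorem mem_core_of_ch_eq_zero (h : Extension br M α δ β γ E U x y g)
    (hN : IsNilradical br (core E U g)) (hs : IsSolvable br) {v : L}
    (hA : h.chA v = 0) (hB : h.chB v = 0) : v ∈ core E U g := by
  have hfin := h.finiteDimensional
  have key : ∀ w, h.chA w = 0 → h.chB w = 0 → IsIdeal br (core E U g ⊔ span ℂ {w}) →
      w ∈ core E U g := by
    intro w hA hB hJ
    by_contra hw
    exact hw (hN.2 (h.isNilpotentIdeal_sup_span hw hA hB hJ)
      (mem_sup_right (mem_span_singleton_self w)))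
  by_cases hR : map₂ br ⊤ ⊤ ≤ core E U g
  · exact key v hA hB (isIdeal_of_map₂_top_le (hR.trans le_sup_left))
  · exfalso
    obtain ⟨w, hw, hwN⟩ := SetLike.not_le_iff_exists.1 hR
    have hwA : h.chA w = 0 ∧ h.chB w = 0 := by
      have : map₂ br ⊤ ⊤ ≤ LinearMap.ker h.chA ⊓ LinearMap.ker h.chB :=
        map₂_le.2 fun p _ q _ => ⟨h.chA_bracket p q, h.chB_bracket p q⟩
      exact this hw
    have hNtop : core E U g ≠ ⊤ := fun h0 => hwN (h0 ▸ mem_top)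
    have hJtop := hs.sup_map₂_ne_top h.ideal hNtop
    have hle : core E U g ⊔ span ℂ {w} ≤ core E U g ⊔ map₂ br ⊤ ⊤ :=
      sup_le_sup_left ((span_singleton_le_iff_mem _ _).2 hw) _
    have h1 : finrank ℂ (core E U g) < finrank ℂ (core E U g ⊔ span ℂ {w} : Submodule ℂ L) :=
      finrank_lt_finrank_of_lt (lt_of_le_of_ne le_sup_left fun h0 =>
        hwN (h0 ▸ mem_sup_right (mem_span_singleton_self w)))
    have h2 := finrank_lt (lt_top_iff_ne_top.2 hJtop).ne
    rw [h.finrank_core] at h1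
    rw [h.finrank_eq] at h2
    have h3 := eq_of_le_of_finrank_le hle (by omega)
    exact hwN (key w hwA.1 hwA.2 (by rw [h3]; exact isIdeal_of_map₂_top_le le_sup_right))

theorem bracket_mem_core (h : Extension br M α δ β γ E U x y g)
    (hN : IsNilradical br (core E U g)) (hs : IsSolvable br) (v w : L) :
    br v w ∈ core E U g :=
  h.mem_core_of_ch_eq_zero hN hs (h.chA_bracket v w) (h.chB_bracket v w)

/-- Dimension count: the pair of characters maps to `ℂ²` with kernel of codimension two, so it is
surjective. -/
theorem exists_ch_eq (h : Extension br M α δ β γ E U x y g)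
    (hN : IsNilradical br (core E U g)) (hs : IsSolvable br) (s t : ℂ) :
    ∃ z, h.chA z = s ∧ h.chB z = t := by
  have hfin := h.finiteDimensional
  have hker : LinearMap.ker (h.chA.prod h.chB) = core E U g := by
    apply le_antisymm
    · intro v hv
      have hv : (h.chA v, h.chB v) = 0 := hv
      rw [Prod.mk_eq_zero] at hv
      exact h.mem_core_of_ch_eq_zero hN hs hv.1 hv.2
    · intro v hv
      change (h.chA v, h.chB v) = 0
      rw [h.chA_of_mem_core hv, h.chB_of_mem_core hv]
      rfl
  have h1 := LinearMap.finrank_range_add_finrank_ker (h.chA.prod h.chB)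
  rw [hker, h.finrank_core, h.finrank_eq] at h1
  have h2 : LinearMap.range (h.chA.prod h.chB) = ⊤ := by
    apply eq_top_of_finrank_eq
    rw [finrank_prod, finrank_self]
    omega
  obtain ⟨z, hz⟩ := LinearMap.range_eq_top.1 h2 (s, t)
  exact ⟨z, congrArg Prod.fst hz, congrArg Prod.snd hz⟩

end Extension
end Nilradical

/-! ### A torus complementary to the nilradical, with two generating weight vectors. -/

section Torus

variable {L : Type*} [AddCommGroup L] [Module ℂ L]

theorem exists_sub_smul_eq [FiniteDimensional ℂ L] {S : Submodule ℂ L} {T : L →ₗ[ℂ] L} {s : ℂ}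
    (hS : ∀ v ∈ S, T v ∈ S) (hinj : ∀ v ∈ S, T v = s • v → v = 0) {w : L} (hw : w ∈ S) :
    ∃ v ∈ S, T v - s • v = w := by
  let T' : S →ₗ[ℂ] S := (T - s • LinearMap.id).restrict fun v hv =>
    sub_mem (hS v hv) (smul_mem _ _ hv)
  have h1 : Function.Injective T' := by
    rw [← LinearMap.ker_eq_bot, LinearMap.ker_eq_bot']
    intro v hv
    have h2 : T v - s • (v : L) = 0 := congrArg Subtype.val hv
    exact Subtype.ext (hinj v v.2 (sub_eq_zero.1 h2))
  obtain ⟨v, hv⟩ := LinearMap.injective_iff_surjective.1 h1 ⟨w, hw⟩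
  exact ⟨v, v.2, congrArg Subtype.val hv⟩

/-- Symmetrised products annihilate from the right. This yields `[v, U] = 0` and fixes the left
action of the torus from its right action. -/
theorem IsLeibniz.bracket_comm_eq_zero {br : Mul₂ L} (h : IsLeibniz br) (p q r : L) :
    br p (br q r + br r q) = 0 := by
  rw [map_add, h p q r, h p r q]; abel

namespace Extension

variable {br : Mul₂ L} {M : ℕ} {α δ β γ : ℂ} {E U x y : L} {g : ℕ → L}

theorem cg_bracket (h : Extension br M α δ β γ E U x y g) {k : ℕ} (hk : k ≤ M) {v : L}
    (hv : v ∈ tail U g k) (z : L) :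
    h.cg k (br v z) = h.cg k v * (weightX M α k * h.chA z + weightY M α k * h.chB z) := by
  have h1 := ((h.mem_tail_iff _ _).1 (h.bracket_tail (h.sub_mem_tail_succ hv) z)).2.2 k
    (Nat.lt_succ_self k)
  have h2 := ((h.mem_tail_iff _ _).1 (h.sub_mem_g z k)).2.2 k (Nat.lt_succ_self k)
  simp only [map_sub, map_smul, LinearMap.sub_apply, LinearMap.smul_apply, smul_eq_mul,
    h.cg_g_self hk] at h1 h2
  linear_combination h1 + h.cg k v * h2

/-- Doubling the eigenvalues of an element with characters `1` and `3/2` makes them natural numbers,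
so that they can be compared by arithmetic. -/
theorem two_mul_weight (h : Extension br M α δ β γ E U x y g) {k : ℕ} (hk : 1 ≤ k) :
    ∃ n : ℕ, 4 ≤ n ∧ 2 * (weightX M α k * 1 + weightY M α k * (3 / 2)) = n := by
  by_cases hkM : k = M
  · subst hkM
    rcases h.alpha with rfl | ⟨rfl, _, h4⟩
    · exact ⟨2 * k + 3, by omega, by rw [weightX_self, weightY_self]; push_cast; ring⟩
    · exact ⟨2 * k + 4, by omega, by rw [weightX_self, weightY_self]; push_cast; ring⟩
  · exact ⟨2 * k + 3, by omega, by rw [weightX_of_ne hkM, weightY_of_ne hkM]; push_cast; ring⟩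

/-- On the derived ideal, `[·, z]` has eigenvalues at least `2`. -/
theorem eq_zero_of_mem_tail_one (h : Extension br M α δ β γ E U x y g) {z : L}
    (hA : h.chA z = 1) (hB : h.chB z = 3 / 2) {s : ℂ} {m : ℕ} (hm : m ≤ 3) (hs : 2 * s = m)
    {v : L} (hv : v ∈ tail U g 1) (hvz : br v z = s • v) : v = 0 := by
  have key : ∀ k, v ∈ tail U g (k + 1) := by
    intro k
    induction k with
    | zero => exact hv
    | succ k ih =>
      by_cases hk : k + 1 ≤ M
      · obtain ⟨n, hn, hn'⟩ := h.two_mul_weight (k := k + 1) (by omega)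
        have h1 := h.cg_bracket hk ih z
        rw [hvz, map_smul, hA, hB, smul_eq_mul] at h1
        have h2 : h.cg (k + 1) v * ((n : ℂ) - m) = 0 := by
          rw [← hn', ← hs]; linear_combination -2 * h1
        have h3 : (n : ℂ) - m ≠ 0 := sub_ne_zero.2 (by norm_cast; omega)
        have h4 := h.sub_mem_tail_succ ih
        rwa [(mul_eq_zero.1 h2).resolve_right h3, zero_smul, sub_zero] at h4
      · have h4 := h.sub_mem_tail_succ ih
        rwa [h.g_zero _ (by omega), smul_zero, sub_zero] at h4
  have h1 := h.sub_mem_span_u (key M)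
  obtain ⟨i, j, hij, hU⟩ := h.exists_weight_U
  rw [h1, map_smul, LinearMap.smul_apply, hU, hA, hB, smul_smul, smul_smul, ← sub_eq_zero,
    ← sub_smul, smul_eq_zero, or_iff_left h.u_ne_zero] at hvz
  have h2 : h.cu v * (((2 * i + 3 * j : ℕ) : ℂ) - m) = 0 := by
    rw [← hs]; push_cast; linear_combination 2 * hvz
  have h3 : ((2 * i + 3 * j : ℕ) : ℂ) - m ≠ 0 := sub_ne_zero.2 (by norm_cast; omega)
  rw [h1, (mul_eq_zero.1 h2).resolve_right h3, zero_smul]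

theorem eq_zero_of_mem_tail_zero (h : Extension br M α δ β γ E U x y g) {z : L}
    (hA : h.chA z = 1) (hB : h.chB z = 3 / 2) {s : ℂ} {m : ℕ} (hm : m ≤ 2) (hs : 2 * s = m)
    {v : L} (hv : v ∈ tail U g 0) (hvz : br v z = s • v) : v = 0 := by
  refine h.eq_zero_of_mem_tail_one hA hB (by omega) hs ?_ hvz
  have h1 := h.cg_zero_bracket hv z
  rw [hvz, map_smul, hB, smul_eq_mul] at h1
  have h2 : h.cg 0 v * (((3 : ℕ) : ℂ) - m) = 0 := by
    rw [← hs]; push_cast; linear_combination -2 * h1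
  have h3 : ((3 : ℕ) : ℂ) - m ≠ 0 := sub_ne_zero.2 (by norm_cast; omega)
  have h4 := h.sub_mem_tail_succ hv
  rwa [(mul_eq_zero.1 h2).resolve_right h3, zero_smul, sub_zero] at h4

theorem eq_zero_of_mem_core (h : Extension br M α δ β γ E U x y g) {z : L}
    (hA : h.chA z = 1) (hB : h.chB z = 3 / 2) {v : L} (hv : v ∈ core E U g)
    (hvz : br v z = 0) : v = 0 := by
  refine h.eq_zero_of_mem_tail_zero hA hB (s := 0) (m := 0) (by omega) (by simp) ?_ (by simpa)
  have h1 := h.cf_bracket hv z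
  rw [hvz, map_zero, hA, mul_one] at h1
  simpa [← h1] using h.sub_mem_tail_zero hv

/-- A two-dimensional torus `X, Y` complementary to the nilradical, with weight vectors `f` and
`G` that generate the nilradical. -/
structure WeightData (h : Extension br M α δ β γ E U x y g) (X Y f G : L) : Prop where
  chA_X : h.chA X = 1
  chB_X : h.chB X = 0
  chA_Y : h.chA Y = 0
  chB_Y : h.chB Y = 1
  XX : br X X = 0
  XY : br X Y = 0
  YX : br Y X = 0
  YY : br Y Y = 0
  f_mem : f ∈ core E U g
  cf_f : h.cf f = 1
  G_mem : G ∈ tail U g 0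
  cg_G : h.cg 0 G = 1
  fX : br f X = f
  fY : br f Y = 0
  GX : br G X = 0
  GY : br G Y = G
  Xf : br X f = -f
  Yf : br Y f = 0
  XG : br X G = 0
  YG : br Y G = -G

theorem cg_succ_bracket (h : Extension br M α δ β γ E U x y g) {k : ℕ}
    (hk : k + 1 < M ∨ α = 0 ∧ k + 1 ≤ M) {v w : L} (hv : v ∈ tail U g k) (hw : w ∈ core E U g) :
    h.cg (k + 1) (br v w) = h.cg k v * h.cf w := by
  have hp : ∀ i j, pairCoeff M α i j * h.cg (k + 1) (g M) = 0 := fun i j => by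
    rcases hk with hk | ⟨rfl, _⟩
    · rw [h.cg_g_ne (by omega), mul_zero]
    · simp [pairCoeff]
  induction hv, hw using span_induction₂ with
  | mem_mem v w hv hw =>
    rcases hv with rfl | ⟨i, hi, rfl⟩ <;> rcases hw with (rfl | rfl) | ⟨j, rfl⟩
    · simp [h.UE]
    · simp [h.UU]
    · simp [h.Ug]
    · rw [h.gE, h.cg_g, h.cg_g, h.cf_f]
      by_cases hi1 : k = i
      · subst hi1; rw [if_pos ⟨rfl, by omega⟩, if_pos ⟨rfl, by omega⟩, one_mul]
      · rw [if_neg (by omega), if_neg (by omega), zero_mul]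
    · simp [h.gU]
    · simp [h.gg, hp, -ite_smul]
  | zero_left => simp
  | zero_right => simp
  | add_left p p' q _ _ _ h1 h2 => simp only [map_add, LinearMap.add_apply, h1, h2]; ring
  | add_right p q q' _ _ _ h1 h2 => simp only [map_add, h1, h2]; ring
  | smul_left t p q _ _ h1 => simp only [map_smul, LinearMap.smul_apply, h1, smul_eq_mul]; ring
  | smul_right t p q _ _ h1 => simp only [map_smul, h1, smul_eq_mul]; ring

theorem one_lt_or (h : Extension br M α δ β γ E U x y g) : 0 + 1 < M ∨ α = 0 ∧ 0 + 1 ≤ M := by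
  have := h.one_le
  rcases h.alpha with h0 | ⟨_, _, h4⟩
  · exact .inr ⟨h0, by omega⟩
  · exact .inl (by omega)

/-- Everything follows from one element `z` in general position: torus and weight vectors are
eigenvectors of `[·, z]`, and the simplicity of its small eigenvalues determines their products. -/
theorem exists_weightData (h : Extension br M α δ β γ E U x y g)
    (hN : IsNilradical br (core E U g)) (hs : IsSolvable br) :
    ∃ X Y f G, WeightData h X Y f G := by
  have hfin := h.finiteDimensional
  have hcore := h.bracket_mem_core hN hs
  have hder := h.leibniz.bracket_bracket
  obtain ⟨X, Y, hXA, hXB, hYA, hYB, hXX, hXY, hYX, hYY⟩ : ∃ X Y, h.chA X = 1 ∧ h.chB X = 0 ∧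
      h.chA Y = 0 ∧ h.chB Y = 1 ∧ br X X = 0 ∧ br X Y = 0 ∧ br Y X = 0 ∧ br Y Y = 0 := by
    -- The value `3/2` separates `g 0` from `E` (eigenvalue `1`) and from the derived ideal of the
    -- nilradical (eigenvalues at least `2`, with `2` possible for `U`).
    obtain ⟨z, hA, hB⟩ := h.exists_ch_eq hN hs 1 (3 / 2)
    -- `[·, z]` is bijective on the nilradical, so a correction by a nilradical element makes `[v,
    -- z]` vanish without changing the characters.
    have lift : ∀ v, ∃ w, h.chA w = h.chA v ∧ h.chB w = h.chB v ∧ br w z = 0 := by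
      intro v
      obtain ⟨n, hn, hn'⟩ := exists_sub_smul_eq (S := core E U g) (T := br.flip z) (s := 0)
        (fun n _ => hcore n z)
        (fun n hn h0 => h.eq_zero_of_mem_core hA hB hn (by simpa using h0)) (hcore v z)
      refine ⟨v - n, ?_, ?_, ?_⟩
      · rw [map_sub, h.chA_of_mem_core hn, sub_zero]
      · rw [map_sub, h.chB_of_mem_core hn, sub_zero]
      · rw [zero_smul, sub_zero, LinearMap.flip_apply] at hn'
        rw [LinearMap.map_sub₂, hn', sub_self]
    -- The product lies in the nilradical and is killed by the derivation `[·, z]`, which is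
    -- injective there.
    have comm : ∀ v w, br v z = 0 → br w z = 0 → br v w = 0 := by
      intro v w hv hw
      refine h.eq_zero_of_mem_core hA hB (hcore v w) ?_
      rw [hder, hw, hv, map_zero, map_zero, LinearMap.zero_apply, add_zero]
    obtain ⟨X₀, hX1, hX2⟩ := h.exists_ch_eq hN hs 1 0
    obtain ⟨Y₀, hY1, hY2⟩ := h.exists_ch_eq hN hs 0 1
    obtain ⟨X, hXA, hXB, hXz⟩ := lift X₀
    obtain ⟨Y, hYA, hYB, hYz⟩ := lift Y₀
    exact ⟨X, Y, hXA.trans hX1, hXB.trans hX2, hYA.trans hY1, hYB.trans hY2, comm _ _ hXz hXz,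
      comm _ _ hXz hYz, comm _ _ hYz hXz, comm _ _ hYz hYz⟩
  -- This new `z` lies in the torus and has the same characters, so that also `[X, z] = [Y, z] = 0`.
  set z := X + (3 / 2 : ℂ) • Y with hz
  have hA : h.chA z = 1 := by simp [hz, hXA, hYA]
  have hB : h.chB z = 3 / 2 := by simp [hz, hXB, hYB]
  have hXz : br X z = 0 := by simp [hz, hXX, hXY]
  have hYz : br Y z = 0 := by simp [hz, hYX, hYY]
  have hinj0 : ∀ v ∈ tail U g 0, br v z = v → v = 0 := fun v hv h0 =>
    h.eq_zero_of_mem_tail_zero hA hB (s := 1) (m := 2) le_rfl (by norm_num) hv (by simpa)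
  have hinj1 : ∀ v ∈ tail U g 1, br v z = (3 / 2 : ℂ) • v → v = 0 := fun v hv h0 =>
    h.eq_zero_of_mem_tail_one hA hB (m := 3) le_rfl (by norm_num) hv h0
  obtain ⟨f, hf, hcf, hfz⟩ : ∃ f ∈ core E U g, h.cf f = 1 ∧ br f z = f := by
    have h1 := h.sub_mem_E z
    rw [hA] at h1
    obtain ⟨n, hn, hn'⟩ := exists_sub_smul_eq (S := tail U g 0) (T := br.flip z) (s := 1)
      (fun n hn => h.bracket_tail hn z) (fun n hn h0 => hinj0 n hn (by simpa using h0)) h1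
    have hn2 := (h.mem_tail_iff _ _).1 hn
    refine ⟨E - n, sub_mem (f_mem_core E U g) hn2.1, by rw [map_sub, h.cf_f, hn2.2.1, sub_zero], ?_⟩
    rw [one_smul, one_smul, LinearMap.flip_apply] at hn'
    rw [LinearMap.map_sub₂]
    linear_combination (norm := module) -hn'
  obtain ⟨G, hG, hcG, hGz⟩ : ∃ G ∈ tail U g 0, h.cg 0 G = 1 ∧ br G z = (3 / 2 : ℂ) • G := by
    have h1 := h.sub_mem_g_zero z
    rw [hB] at h1
    obtain ⟨n, hn, hn'⟩ := exists_sub_smul_eq (S := tail U g 1) (T := br.flip z) (s := 3 / 2)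
      (fun n hn => h.bracket_tail hn z) (fun n hn h0 => hinj1 n hn (by simpa using h0)) h1
    have hn2 := (h.mem_tail_iff _ _).1 hn
    refine ⟨g 0 - n, sub_mem h.g_zero_mem_tail (tail_anti U g zero_le_one hn), ?_, ?_⟩
    · rw [map_sub, h.cg_g_self (Nat.zero_le M), hn2.2.2 0 one_pos, sub_zero]
    · rw [LinearMap.flip_apply] at hn'
      rw [LinearMap.map_sub₂]
      linear_combination (norm := module) -hn'
  have hGcore := tail_le_core E U g 0 hG
  have hGf := ((h.mem_tail_iff _ _).1 hG).2.1
  -- If `[w, z] = 0`, then right and left multiplication by `w` commute with `[·, z]` on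
  -- eigenvectors, so they preserve its one-dimensional eigenspaces spanned by `f` and `G`.
  have right_f : ∀ w, br w z = 0 → br f w = h.chA w • f := by
    intro w hw
    rw [← sub_eq_zero]
    refine hinj0 _ ((h.mem_tail_iff _ _).2
      ⟨sub_mem (hcore _ _) (smul_mem _ _ hf), ?_, by simp⟩) ?_
    · rw [map_sub, h.cf_bracket hf, map_smul, hcf, one_mul, smul_eq_mul, mul_one, sub_self]
    · rw [LinearMap.map_sub₂, hder, hw, hfz, map_zero, zero_add, LinearMap.map_smul₂, hfz]
  have right_G : ∀ w, br w z = 0 → br G w = h.chB w • G := by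
    intro w hw
    rw [← sub_eq_zero]
    refine hinj1 _ ((h.mem_tail_iff _ _).2
      ⟨sub_mem (hcore _ _) (smul_mem _ _ hGcore), ?_, fun i hi => ?_⟩) ?_
    · rw [map_sub, h.cf_bracket hGcore, map_smul, hGf, zero_mul, smul_zero, sub_zero]
    · obtain rfl : i = 0 := by omega
      rw [map_sub, h.cg_zero_bracket hG, map_smul, hcG, one_mul, smul_eq_mul, mul_one, sub_self]
    · rw [LinearMap.map_sub₂, hder, hw, hGz, map_zero, zero_add, LinearMap.map_smul₂,
        LinearMap.map_smul₂, hGz]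
      module
  have left_f : ∀ w, br w z = 0 → ∃ κ : ℂ, br w f = κ • f := by
    intro w hw
    have h1 : br (br w f) z = br w f := by
      rw [hder, hfz, hw, map_zero, LinearMap.zero_apply, add_zero]
    refine ⟨h.cf (br w f), ?_⟩
    rw [← sub_eq_zero]
    refine hinj0 _ ((h.mem_tail_iff _ _).2
      ⟨sub_mem (hcore _ _) (smul_mem _ _ hf), by simp [hcf], by simp⟩) ?_
    rw [LinearMap.map_sub₂, h1, LinearMap.map_smul₂, hfz]
  have left_G : ∀ w, br w z = 0 → ∃ κ : ℂ, br w G = κ • G := by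
    intro w hw
    have h1 : br (br w G) z = (3 / 2 : ℂ) • br w G := by
      rw [hder, hGz, hw, map_zero, LinearMap.zero_apply, add_zero, map_smul]
    have h2 : h.cf (br w G) = 0 := by
      have := h.cf_bracket (hcore w G) z
      rw [h1, map_smul, hA, smul_eq_mul] at this
      linear_combination 2 * this
    refine ⟨h.cg 0 (br w G), ?_⟩
    rw [← sub_eq_zero]
    refine hinj1 _ ((h.mem_tail_iff _ _).2
      ⟨sub_mem (hcore _ _) (smul_mem _ _ hGcore), by simp [h2, hGf], fun i hi => ?_⟩) ?_
    · obtain rfl : i = 0 := by omega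
      simp [hcG]
    · rw [LinearMap.map_sub₂, h1, LinearMap.map_smul₂, hGz]
      module
  have hGf1 : h.cg 1 (br G f) = 1 := by
    rw [h.cg_succ_bracket h.one_lt_or hG hf, hcG, hcf, one_mul]
  have hfG1 : h.cg 1 (br f G) = -1 := by
    have h1 := h.bracket_add_bracket h.toFrame h.alpha_even hf hGcore
    have h2 := congrArg (h.cg 1) h1
    rw [map_add, hGf1, map_smul, h.cg_u, smul_zero] at h2
    exact eq_neg_of_add_eq_zero_left h2
  -- The symmetrised product of `w` and `f` is a multiple of `f` that `G` annihilates from the left;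
  -- since `[G, f]` has `g 1`-coordinate `1`, the multiple is zero. The same works for `G`, as `[f,
  -- G]` has `g 1`-coordinate `-1`.
  have hkey : ∀ w, br w z = 0 → br w f = -(h.chA w • f) ∧ br w G = -(h.chB w • G) := by
    intro w hw
    obtain ⟨κ, hκ⟩ := left_f w hw
    obtain ⟨μ, hμ⟩ := left_G w hw
    have h1 := h.leibniz.bracket_comm_eq_zero G w f
    have h2 := h.leibniz.bracket_comm_eq_zero f w G
    rw [hκ, right_f w hw, ← add_smul, map_smul] at h1
    rw [hμ, right_G w hw, ← add_smul, map_smul] at h2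
    have h3 := congrArg (h.cg 1) h1
    have h4 := congrArg (h.cg 1) h2
    simp only [map_smul, hGf1, hfG1, map_zero, smul_eq_mul] at h3 h4
    rw [hκ, hμ, ← neg_smul, ← neg_smul]
    refine ⟨congrArg (· • f) ?_, congrArg (· • G) ?_⟩
    · linear_combination h3
    · linear_combination -h4
  refine ⟨X, Y, f, G, hXA, hXB, hYA, hYB, hXX, hXY, hYX, hYY, hf, hcf, hG, hcG, ?_, ?_, ?_, ?_,
    ?_, ?_, ?_, ?_⟩
  · rw [right_f X hXz, hXA, one_smul]
  · rw [right_f Y hYz, hYA, zero_smul]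
  · rw [right_G X hXz, hXB, zero_smul]
  · rw [right_G Y hYz, hYB, one_smul]
  · rw [(hkey X hXz).1, hXA, one_smul]
  · rw [(hkey Y hYz).1, hYA, zero_smul, neg_zero]
  · rw [(hkey X hXz).2, hXB, zero_smul, neg_zero]
  · rw [(hkey Y hYz).2, hYB, one_smul]

end Extension
end Torus

/-! ### The basis of weight vectors and its structure constants. -/

section WeightBasis

variable {L : Type*} [AddCommGroup L] [Module ℂ L]

/-- The iterated products `[…[[G, f], f], …, f]`. -/
noncomputable def ladder (br : Mul₂ L) (f G : L) : ℕ → L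
  | 0 => G
  | i + 1 => br (ladder br f G i) f

@[simp] theorem ladder_zero (br : Mul₂ L) (f G : L) : ladder br f G 0 = G := rfl

theorem ladder_succ (br : Mul₂ L) (f G : L) (i : ℕ) :
    ladder br f G (i + 1) = br (ladder br f G i) f := rfl

namespace Extension

variable {br : Mul₂ L} {M : ℕ} {α δ β γ : ℂ} {E U x y : L} {g : ℕ → L}

/-- `U` is a multiple of some symmetrised product, because the form is nonzero. -/
theorem bracket_U (h : Extension br M α δ β γ E U x y g) (v : L) : br v U = 0 := by
  have hs := fun {p q : L} => h.bracket_add_bracket h.toFrame h.alpha_even (p := p) (q := q)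
  have key : ∀ (p q : L) (s : ℂ), s ≠ 0 → br p q + br q p = s • U → br v U = 0 := by
    intro p q s hs hpq
    have h1 := h.leibniz.bracket_comm_eq_zero v p q
    rw [hpq, map_smul] at h1
    exact (smul_eq_zero.1 h1).resolve_left hs
  have hE := f_mem_core E U g
  have hg := g_mem_core E U g 0
  have h0 := h.cg_g_self (Nat.zero_le M)
  rcases h.coeff with hc | hc | hc
  · exact key E E (2 * δ) (mul_ne_zero two_ne_zero hc) (by rw [hs hE hE]; simp)
  · exact key E (g 0) β hc (by rw [hs hE hg]; simp [h0])
  · exact key (g 0) (g 0) (2 * γ) (mul_ne_zero two_ne_zero hc) (by rw [hs hg hg]; simp [h0])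

theorem U_bracket (h : Extension br M α δ β γ E U x y g) {v : L} (hv : v ∈ core E U g) :
    br U v = 0 := by
  obtain ⟨i, j, _, hU⟩ := h.exists_weight_U
  rw [hU, h.chA_of_mem_core hv, h.chB_of_mem_core hv]
  simp

theorem bracket_tail_tail_eq_zero (h : Extension br M α δ β γ E U x y g) {k l : ℕ} {v w : L}
    (hkl : α = 0 ∧ 1 ≤ k + l ∨ M ≤ k + l) (hv : v ∈ tail U g k) (hw : w ∈ tail U g l) :
    br v w = 0 := by
  have key : map₂ br (tail U g k) (tail U g l) ≤ ⊥ := by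
    have h1 := h.one_le
    refine map₂_span_le ?_
    rintro p (rfl | ⟨i, hi, rfl⟩) q (rfl | ⟨j, hj, rfl⟩)
    · simp [h.UU]
    · simp [h.Ug]
    · simp [h.gU]
    · have hi : k ≤ i := hi
      have hj : l ≤ j := hj
      rw [h.gg]
      rcases hkl with ⟨rfl, h2⟩ | h2
      · rw [if_neg (by omega)]
        simp [pairCoeff]
      · rw [pairCoeff_of_ne (by omega), if_neg (by omega)]
        simp
  exact (mem_bot ℂ).1 (key (apply_mem_map₂ _ hv hw))

theorem bracket_tail_tail_mem (h : Extension br M α δ β γ E U x y g) {k l : ℕ} {v w : L}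
    (hkl : 1 ≤ k + l) (hv : v ∈ tail U g k) (hw : w ∈ tail U g l) :
    ∃ s : ℂ, br v w = s • g M := by
  have key : map₂ br (tail U g k) (tail U g l) ≤ span ℂ {g M} := by
    refine map₂_span_le ?_
    rintro p (rfl | ⟨i, hi, rfl⟩) q (rfl | ⟨j, hj, rfl⟩)
    · simp [h.UU]
    · simp [h.Ug]
    · simp [h.gU]
    · have hi : k ≤ i := hi
      have hj : l ≤ j := hj
      rw [h.gg, if_neg (by omega), zero_smul, zero_add]
      exact smul_mem _ _ (mem_span_singleton_self _)
  obtain ⟨s, hs⟩ := mem_span_singleton.1 (key (apply_mem_map₂ _ hv hw))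
  exact ⟨s, hs.symm⟩

theorem bracket_tail_last (h : Extension br M α δ β γ E U x y g) {v w : L}
    (hv : v ∈ tail U g M) (hw : w ∈ core E U g) : br v w = 0 := by
  have h1 := h.bracket_tail_tail_eq_zero (.inr (by omega)) hv (h.sub_mem_tail_zero hw)
  have h2 := h.sub_mem_tail_succ hv
  rw [map_sub, map_smul, sub_eq_zero] at h1
  rw [h1, sub_eq_iff_eq_add.1 (h.sub_mem_span_u h2), LinearMap.map_add₂, LinearMap.map_smul₂,
    LinearMap.map_smul₂, h.gE, h.UE, h.g_zero _ (Nat.lt_succ_self M)]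
  simp

namespace WeightData

variable {h : Extension br M α δ β γ E U x y g} {X Y f G : L}

local notation "P" => ladder br f G

theorem cf_G (t : WeightData h X Y f G) : h.cf G = 0 := ((h.mem_tail_iff _ _).1 t.G_mem).2.1

theorem ladder_mem (t : WeightData h X Y f G) (i : ℕ) : P i ∈ tail U g i := by
  induction i with
  | zero => exact t.G_mem
  | succ i ih => exact h.map₂_tail_core_le i (apply_mem_map₂ _ ih t.f_mem)

theorem ladder_mem_core (t : WeightData h X Y f G) (i : ℕ) : P i ∈ core E U g :=
  tail_le_core _ _ _ _ (t.ladder_mem i)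

/-- Leading coefficients are preserved along the ladder. For `α = 1` the last rung is excluded; it
turns out to vanish in `exists_top`. -/
theorem cg_ladder (t : WeightData h X Y f G) (i : ℕ) (hi : i < M ∨ α = 0 ∧ i ≤ M) :
    h.cg i (P i) = 1 := by
  induction i with
  | zero => exact t.cg_G
  | succ i ih =>
    rw [ladder_succ, h.cg_succ_bracket hi (t.ladder_mem i) t.f_mem, t.cf_f, mul_one]
    exact ih (by rcases hi with hi | ⟨h0, hi⟩ <;> [left; (right; refine ⟨h0, ?_⟩)] <;> omega)

theorem ladder_eq_zero (t : WeightData h X Y f G) {i : ℕ} (hi : M < i) : P i = 0 := by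
  obtain ⟨k, rfl⟩ := Nat.exists_eq_add_of_le' hi
  rw [Nat.add_succ, ladder_succ]
  exact h.bracket_tail_last (tail_anti U g (by omega) (t.ladder_mem (k + M))) t.f_mem

theorem ladder_X (t : WeightData h X Y f G) (i : ℕ) : br (P i) X = (i : ℂ) • P i := by
  induction i with
  | zero => simp [t.GX]
  | succ i ih =>
    rw [ladder_succ, h.leibniz.bracket_bracket, t.fX, ih, LinearMap.map_smul₂]
    push_cast
    module

theorem ladder_Y (t : WeightData h X Y f G) (i : ℕ) : br (P i) Y = P i := by
  induction i with
  | zero => simp [t.GY]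
  | succ i ih => rw [ladder_succ, h.leibniz.bracket_bracket, t.fY, ih, map_zero, zero_add]

theorem bracket_f_f (t : WeightData h X Y f G) :
    br f f = (δ + β * h.cg 0 f + γ * h.cg 0 f ^ 2) • U := by
  have h1 := h.bracket_add_bracket h.toFrame h.alpha_even t.f_mem t.f_mem
  rw [t.cf_f] at h1
  refine smul_right_injective L (two_ne_zero (α := ℂ)) ?_
  simp only
  linear_combination (norm := module) h1

theorem bracket_f_G (t : WeightData h X Y f G) :
    br f G = -br G f + (β + 2 * γ * h.cg 0 f) • U := by
  have h1 := h.bracket_add_bracket h.toFrame h.alpha_even t.f_mem (t.ladder_mem_core 0)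
  rw [ladder_zero, t.cf_f, t.cg_G, t.cf_G] at h1
  linear_combination (norm := module) h1

theorem bracket_G_G (t : WeightData h X Y f G) : br G G = γ • U := by
  have h1 := h.bracket_add_bracket h.toFrame h.alpha_even (t.ladder_mem_core 0)
    (t.ladder_mem_core 0)
  rw [ladder_zero, t.cg_G, t.cf_G] at h1
  refine smul_right_injective L (two_ne_zero (α := ℂ)) ?_
  simp only
  linear_combination (norm := module) h1

theorem bracket_f_of_mem (t : WeightData h X Y f G) {v : L} (hv : v ∈ tail U g 1) :
    br f v = -br v f := by
  have h2 := (h.mem_tail_iff _ _).1 hv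
  have h1 := h.bracket_add_bracket h.toFrame h.alpha_even t.f_mem h2.1
  rw [h2.2.1, h2.2.2 0 one_pos] at h1
  linear_combination (norm := module) h1

theorem bracket_f_ladder (t : WeightData h X Y f G) (i : ℕ) :
    br f (P i) = -P (i + 1) + (if i = 0 then β + 2 * γ * h.cg 0 f else 0) • U := by
  rcases i with _ | i
  · simp [t.bracket_f_G, ladder_succ]
  · rw [t.bracket_f_of_mem (tail_anti U g (by omega) (t.ladder_mem (i + 1)))]
    simp [ladder_succ]

theorem Y_ladder (t : WeightData h X Y f G) (i : ℕ) : br Y (P i) = -P i := by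
  induction i with
  | zero => exact t.YG
  | succ i ih =>
    rw [ladder_succ, h.leibniz, ih, t.Yf]
    simp

/-- The `U`-term comes from `[X, [G, f]] = [[X, G], f] - [[X, f], G] = [f, G]`, where `[f, G]` and
`-[G, f]` differ by a multiple of `U`. It does not propagate, since `[U, f] = 0`, and has no
analogue for `Y` because `[Y, f] = 0`. -/
theorem X_ladder (t : WeightData h X Y f G) (i : ℕ) :
    br X (P i) = -((i : ℂ) • P i) + (if i = 1 then β + 2 * γ * h.cg 0 f else 0) • U := by
  induction i with
  | zero => simp [t.XG]
  | succ i ih =>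
    rw [ladder_succ, h.leibniz, ih, t.Xf, LinearMap.map_add₂, LinearMap.map_smul₂,
      h.U_bracket t.f_mem, LinearMap.map_neg₂, LinearMap.map_neg₂, LinearMap.map_smul₂,
      t.bracket_f_ladder, ladder_succ]
    simp only [Nat.add_eq_right]
    push_cast
    module

/-- `U` is a weight vector, and its weight determines which squares are nonzero. -/
theorem exists_type (t : WeightData h X Y f G) : ∃ κ a b c : ℂ, κ ≠ 0 ∧
    (a = 1 ∧ b = 0 ∧ c = 0 ∨ a = 0 ∧ b = 1 ∧ c = 0 ∨ a = 0 ∧ b = 0 ∧ c = 1) ∧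
    δ + β * h.cg 0 f + γ * h.cg 0 f ^ 2 = a * κ ∧ β + 2 * γ * h.cg 0 f = b * κ ∧ γ = c * κ ∧
    br U X = (2 * a + b) • U ∧ br U Y = (b + 2 * c) • U := by
  obtain ⟨i, j, hij, hU⟩ := h.exists_weight_U
  have hX : br U X = (i : ℂ) • U := by rw [hU, t.chA_X, t.chB_X]; simp
  have hY : br U Y = (j : ℂ) • U := by rw [hU, t.chA_Y, t.chB_Y]; simp
  have hij' : (i : ℂ) + j = 2 := by exact_mod_cast hij
  have hff := t.bracket_f_f
  have hfG := t.bracket_f_G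
  have hGG := t.bracket_G_G
  set δ' := δ + β * h.cg 0 f + γ * h.cg 0 f ^ 2 with hδ'
  set β' := β + 2 * γ * h.cg 0 f with hβ'
  have aux : ∀ s : ℂ, s • U = 0 → s = 0 := fun s hs => (smul_eq_zero.1 hs).resolve_right h.u_ne_zero
  -- Compare `X`-weights: `[f, f]`, the symmetrised product of `f` and `G`, and `[G, G]` have
  -- weights `2`, `1`, `0`, while `U` has weight `i`. So at most one of the three coefficients is
  -- nonzero.
  have h1 : δ' * (i - 2) = 0 := aux _ <| by
    have := h.leibniz.bracket_bracket f f X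
    rw [t.fX, hff, LinearMap.map_smul₂, hX] at this
    linear_combination (norm := module) this
  have h2 : β' * (i - 1) = 0 := aux _ <| by
    have h3 := h.leibniz.bracket_bracket f G X
    have h4 := h.leibniz.bracket_bracket G f X
    rw [t.fX, t.GX, hfG, LinearMap.map_add₂, LinearMap.map_neg₂, h4, t.fX, t.GX,
      LinearMap.map_smul₂, hX, map_zero, map_zero, LinearMap.zero_apply] at h3
    linear_combination (norm := module) h3
  have h3 : γ * i = 0 := aux _ <| by
    have := h.leibniz.bracket_bracket G G X
    rw [t.GX, hGG, LinearMap.map_smul₂, hX, map_zero, LinearMap.map_zero₂] at this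
    linear_combination (norm := module) this
  have h4 : δ' ≠ 0 ∨ β' ≠ 0 ∨ γ ≠ 0 := by
    by_contra! hc
    obtain ⟨h5, h6, h7⟩ := hc
    have h8 : β = 0 := by simpa [hβ', h7] using h6
    have h9 : δ = 0 := by simpa [hδ', h7, h8] using h5
    simpa [h7, h8, h9] using h.coeff
  by_cases hγ : γ = 0
  · by_cases hβ : β' = 0
    · have hδ : δ' ≠ 0 := by simpa [hγ, hβ] using h4
      have hi : (i : ℂ) = 2 := by simpa [hδ, sub_eq_zero] using h1
      refine ⟨δ', 1, 0, 0, hδ, by simp, by simp, by simp [hβ], by simp [hγ], ?_, ?_⟩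
      · rw [hX, hi]; simp
      · rw [hY, show (j : ℂ) = 0 by linear_combination hij' - hi]; simp
    · have hi : (i : ℂ) = 1 := by simpa [hβ, sub_eq_zero] using h2
      refine ⟨β', 0, 1, 0, hβ, by simp, ?_, by simp, by simp [hγ], ?_, ?_⟩
      · rw [hi] at h1
        linear_combination -h1
      · rw [hX, hi]; simp
      · rw [hY, show (j : ℂ) = 1 by linear_combination hij' - hi]; simp
  · have hi : (i : ℂ) = 0 := by simpa [hγ] using h3
    refine ⟨γ, 0, 0, 1, hγ, by simp, ?_, ?_, by simp, ?_, ?_⟩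
    · rw [hi] at h1
      linear_combination -(1 / 2) * h1
    · rw [hi] at h2
      linear_combination -h2
    · rw [hX, hi]; simp
    · rw [hY, show (j : ℂ) = 2 by linear_combination hij' - hi]; simp

/-- The last basis vector is the top of the ladder if `α = 0`. If `α = 1` that top is zero and `g
M`, of weight `(M - 1, 2)`, is itself a weight vector, being a product of two ladder elements. -/
theorem exists_top (t : WeightData h X Y f G) : ∃ T ∈ tail U g M, h.cg M T = 1 ∧
    P M = (1 - α) • T ∧ br T X = weightX M α M • T ∧ br T Y = weightY M α M • T ∧
    br X T = -(weightX M α M • T) + (if M = 1 then β + 2 * γ * h.cg 0 f else 0) • U ∧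
    br Y T = -(weightY M α M • T) ∧
    ∀ i j, br (P i) (P j) = (if i = 0 ∧ j = 0 then γ else 0) • U + pairCoeff M α i j • T := by
  have hder := h.leibniz.bracket_bracket
  rcases h.alpha with h0 | ⟨h1, he, h4⟩
  · refine ⟨P M, t.ladder_mem M, t.cg_ladder M (.inr ⟨h0, le_rfl⟩), ?_, ?_, ?_, ?_, ?_, ?_⟩
    · simp [h0]
    · simp [t.ladder_X, weightX_self, h0]
    · simp [t.ladder_Y, weightY_self, h0]
    · simp [t.X_ladder, weightX_self, h0]
    · simp [t.Y_ladder, weightY_self, h0]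
    · intro i j
      by_cases hij : i = 0 ∧ j = 0
      · obtain ⟨rfl, rfl⟩ := hij
        simp [t.bracket_G_G, pairCoeff, h0]
      · rw [h.bracket_tail_tail_eq_zero (.inl ⟨h0, by omega⟩) (t.ladder_mem i) (t.ladder_mem j)]
        simp [hij, pairCoeff, h0]
  · have hg := g_mem_tail U g (le_refl M)
    have hgM := h.cg_g_self (le_refl M)
    have lead : ∀ i j, i + j + 1 = M → br (P i) (P j) = pairCoeff M α i j • g M := by
      intro i j hij
      have h2 := h.sub_mem_tail_succ (t.ladder_mem i)
      have h3 := h.sub_mem_tail_succ (t.ladder_mem j)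
      rw [t.cg_ladder i (.inl (by omega)), one_smul] at h2
      rw [t.cg_ladder j (.inl (by omega)), one_smul] at h3
      have h5 := h.bracket_tail_tail_eq_zero (.inr (by omega)) h2 (t.ladder_mem j)
      have h6 := h.bracket_tail_tail_eq_zero (.inr (by omega)) (g_mem_tail U g (le_refl i)) h3
      rw [LinearMap.map_sub₂, sub_eq_zero] at h5
      rw [map_sub, sub_eq_zero] at h6
      rw [h5, h6, h.gg, if_neg (by omega), zero_smul, zero_add]
    obtain ⟨k, hk⟩ : ∃ k, k + 1 = M := ⟨M - 1, by omega⟩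
    have hkM : (M : ℂ) = k + 1 := by rw [← hk]; push_cast; rfl
    have hk0 : br (P k) (P 0) = g M := by
      rw [lead k 0 (by omega), pairCoeff, if_pos (by omega), hk, he.neg_one_pow, h1]
      simp
    have h0k : br (P 0) (P k) = -g M := by
      rw [lead 0 k (by omega), pairCoeff, if_pos (by omega), h1]
      simp
    have hX : br (g M) X = (k : ℂ) • g M := by
      rw [← hk0, hder, t.ladder_X, t.ladder_X, LinearMap.map_smul₂, map_smul]
      simp
    have hY : br (g M) Y = (2 : ℂ) • g M := by
      rw [← hk0, hder, t.ladder_Y, t.ladder_Y]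
      module
    refine ⟨g M, hg, hgM, ?_, ?_, ?_, ?_, ?_, ?_⟩
    -- The top of the ladder would have `X`-weight `M`, but it lies in the span of `g M`, of weight
    -- `M - 1`, and `U`, of weight at most `2 < M`.
    · rw [h1, sub_self, zero_smul]
      obtain ⟨i, j, hij, hU⟩ := h.exists_weight_U
      have h2 := sub_eq_iff_eq_add.1 (h.sub_mem_span_u (h.sub_mem_tail_succ (t.ladder_mem M)))
      set c := h.cg M (P M)
      set d := h.cu (P M - c • g M)
      have h3 := t.ladder_X M
      rw [h2, LinearMap.map_add₂, LinearMap.map_smul₂, LinearMap.map_smul₂, hX, hU, t.chA_X,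
        t.chB_X, hkM] at h3
      have h5 := congrArg (h.cg M) h3
      have h6 := congrArg h.cu h3
      simp only [map_add, map_smul, h.cg_u, hgM, h.cu_u, h.cu_g, smul_eq_mul] at h5 h6
      have hc : c = 0 := by linear_combination -h5
      have hd : d * (((k + 1 : ℕ) : ℂ) - i) = 0 := by push_cast; linear_combination -h6
      have hi : ((k + 1 : ℕ) : ℂ) - i ≠ 0 := sub_ne_zero.2 (by norm_cast; omega)
      rw [h2, hc, (mul_eq_zero.1 hd).resolve_right hi]
      simp
    · rw [hX, weightX_self, h1, hkM, add_sub_cancel_right]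
    · rw [hY, weightY_self, h1]
      norm_num
    · rw [if_neg (by omega), weightX_self, h1, hkM, add_sub_cancel_right, ← hk0, h.leibniz,
        t.X_ladder, t.X_ladder, if_neg (by omega), if_neg (by omega)]
      simp
    · rw [weightY_self, h1, ← hk0, h.leibniz, t.Y_ladder, t.Y_ladder, LinearMap.map_neg₂,
        LinearMap.map_neg₂, hk0, h0k]
      module
    · intro i j
      by_cases hij : i = 0 ∧ j = 0
      · obtain ⟨rfl, rfl⟩ := hij
        rw [pairCoeff_of_ne (by omega)]
        simp [t.bracket_G_G]
      rw [if_neg hij, zero_smul, zero_add]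
      -- Below the antidiagonal the product is a multiple of `g M` whose `X`-weight `i + j` is not
      -- `M - 1`, hence zero; above it the tails already pair to zero.
      rcases lt_trichotomy (i + j + 1) M with hlt | heq | hgt
      · rw [pairCoeff_of_ne hlt.ne, zero_smul]
        obtain ⟨s, hs⟩ := h.bracket_tail_tail_mem (k := i) (l := j) (by omega) (t.ladder_mem i)
          (t.ladder_mem j)
        have h2 := hder (P i) (P j) X
        rw [t.ladder_X, t.ladder_X, map_smul, LinearMap.map_smul₂, hs, LinearMap.map_smul₂,
          hX] at h2
        have h3 := congrArg (h.cg M) h2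
        simp only [map_add, map_smul, hgM, smul_eq_mul] at h3
        have h5 : s * ((k : ℂ) - (i + j : ℕ)) = 0 := by push_cast; linear_combination h3
        have h6 : (k : ℂ) - (i + j : ℕ) ≠ 0 := sub_ne_zero.2 (by norm_cast; omega)
        rw [hs, (mul_eq_zero.1 h5).resolve_right h6, zero_smul]
      · exact lead i j heq
      · rw [pairCoeff_of_ne hgt.ne', zero_smul]
        exact h.bracket_tail_tail_eq_zero (.inr (by omega)) (t.ladder_mem i) (t.ladder_mem j)

/-- The new family is unitriangular with respect to the old one, apart from the scaling of `U`; `X`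
and `Y` complete it because the characters vanish only on the nilradical. -/
theorem frame (t : WeightData h X Y f G) (hN : IsNilradical br (core E U g)) (hs : IsSolvable br)
    {κ : ℂ} (hκ : κ ≠ 0) {g' : ℕ → L} (h0 : ∀ i, M < i → g' i = 0)
    (h1 : ∀ i, i ≤ M → g' i ∈ tail U g i) (h2 : ∀ i, i ≤ M → h.cg i (g' i) = 1) :
    Frame M f (κ • U) X Y g' := by
  set S := span ℂ ({f, κ • U, X, Y} ∪ Set.range g') with hS
  have hf : f ∈ S := subset_span (by simp)
  have hX : X ∈ S := subset_span (by simp)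
  have hY : Y ∈ S := subset_span (by simp)
  have hg : ∀ i, g' i ∈ S := fun i => subset_span (by simp)
  have hU : U ∈ S := by
    have : κ • U ∈ S := subset_span (by simp)
    exact (smul_mem_iff _ hκ).1 this
  have htail : ∀ d k, k + d = M + 1 → tail U g k ≤ S := by
    intro d
    induction d with
    | zero =>
      intro k hk v hv
      obtain rfl : k = M + 1 := by omega
      rw [h.sub_mem_span_u hv]
      exact smul_mem _ _ hU
    | succ d ih =>
      intro k hk v hv
      have h3 := ih (k + 1) (by omega) (h.sub_mem_tail_succ hv)
      have h4 := ih (k + 1) (by omega) (h.sub_mem_tail_succ (h1 k (by omega)))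
      rw [h2 k (by omega), one_smul] at h4
      have h5 := (sub_mem_iff_right S (hg k)).1 h4
      exact (sub_mem_iff_left S (smul_mem _ _ h5)).1 h3
  have hcore : core E U g ≤ S := by
    intro v hv
    have h3 := htail (M + 1) 0 (by omega) (h.sub_mem_tail_zero hv)
    have h4 := htail (M + 1) 0 (by omega) (h.sub_mem_tail_zero t.f_mem)
    rw [t.cf_f, one_smul] at h4
    have h5 := (sub_mem_iff_right S hf).1 h4
    exact (sub_mem_iff_left S (smul_mem _ _ h5)).1 h3
  refine ⟨h0, eq_top_iff.2 fun v _ => ?_, h.finrank_eq⟩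
  have h3 : v - h.chA v • X - h.chB v • Y ∈ S := by
    refine hcore (h.mem_core_of_ch_eq_zero hN hs ?_ ?_)
    · simp [t.chA_X, t.chA_Y]
    · simp [t.chB_X, t.chB_Y]
  rw [sub_sub] at h3
  exact (sub_mem_iff_left S (add_mem (smul_mem _ _ hX) (smul_mem _ _ hY))).1 h3

theorem exists_model (t : WeightData h X Y f G) (hN : IsNilradical br (core E U g))
    (hs : IsSolvable br) : ∃ a b c u g', Model br M a b c α f u X Y g' := by
  obtain ⟨κ, a, b, c, hκ, htype, ha, hb, hc, hUX, hUY⟩ := t.exists_type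
  obtain ⟨T, hT, hcT, hPT, hTX, hTY, hXT, hYT, hPP⟩ := t.exists_top
  have hff := t.bracket_f_f
  have hfP := t.bracket_f_ladder
  have hXP := t.X_ladder
  have hM := h.one_le
  have hTcore := tail_le_core E U g M hT
  rw [ha] at hff
  simp only [hb] at hfP hXP hXT
  simp only [hc] at hPP
  have hUcore : ∀ {v}, v ∈ core E U g → br (κ • U) v = 0 := fun hv => by
    rw [LinearMap.map_smul₂, h.U_bracket hv, smul_zero]
  have hvU : ∀ v, br v (κ • U) = 0 := fun v => by rw [map_smul, h.bracket_U, smul_zero]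
  have hTv : ∀ {v}, v ∈ core E U g → br T v = 0 := h.bracket_tail_last hT
  set g' : ℕ → L := fun i => if i = M then T else P i with hg'
  have gM : g' M = T := by simp [hg']
  have gne : ∀ {i}, i ≠ M → g' i = P i := fun hi => by simp [hg', hi]
  have gcore : ∀ i, g' i ∈ core E U g := fun i => by
    by_cases hi : i = M
    · rw [hi, gM]; exact hTcore
    · rw [gne hi]; exact t.ladder_mem_core i
  have hPstep : ∀ i ≠ M, P (i + 1) = stepCoeff M α i • g' (i + 1) := fun i hi => by
    rcases lt_trichotomy (i + 1) M with hlt | heq | hgt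
    · rw [stepCoeff_of_lt hlt, gne hlt.ne, one_smul]
    · rw [stepCoeff_last heq, heq, gM, hPT]
    · rw [stepCoeff_of_le (by omega), t.ladder_eq_zero hgt, zero_smul]
  refine ⟨a, b, c, κ • U, g', t.frame hN hs hκ (fun i hi => ?_) (fun i hi => ?_) (fun i hi => ?_),
    hM, htype, h.alpha_even, ?_, hvU f, t.fX, t.fY, fun i => ?_, hUcore t.f_mem, hvU _, ?_, ?_,
    fun i => hUcore (gcore i), t.Xf, hvU X, t.XX, t.XY, fun i => ?_, t.Yf, hvU Y, t.YX, t.YY,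
    fun i => ?_, fun i => ?_, fun i => hvU _, fun i => ?_, fun i => ?_, fun i j => ?_⟩
  · rw [gne hi.ne', t.ladder_eq_zero hi]
  · by_cases hi : i = M
    · rw [hi, gM]; exact hT
    · rw [gne hi]; exact t.ladder_mem i
  · by_cases hi : i = M
    · rw [hi, gM]; exact hcT
    · rw [gne hi]; exact t.cg_ladder i (.inl (by omega))
  · rw [hff, mul_smul]
  · by_cases hi : i = M
    · rw [hi, gM, stepCoeff_of_le le_rfl, if_neg (by omega),
        t.bracket_f_of_mem (tail_anti U g hM hT), hTv t.f_mem]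
      simp
    · rw [gne hi, hfP, hPstep i hi]
      congr 1
      split_ifs <;> module
  · rw [LinearMap.map_smul₂, hUX, smul_comm]
  · rw [LinearMap.map_smul₂, hUY, smul_comm]
  · by_cases hi : i = M
    · rw [hi, gM, hXT]
      congr 1
      split_ifs <;> module
    · rw [gne hi, hXP, weightX_of_ne hi]
      congr 1
      split_ifs <;> module
  · by_cases hi : i = M
    · rw [hi, gM, hYT]
    · rw [gne hi, t.Y_ladder, weightY_of_ne hi, one_smul]
  · by_cases hi : i = M
    · rw [hi, gM, hTv t.f_mem, stepCoeff_of_le le_rfl, zero_smul]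
    · rw [gne hi, ← hPstep i hi, ladder_succ]
  · by_cases hi : i = M
    · rw [hi, gM, hTX]
    · rw [gne hi, t.ladder_X, weightX_of_ne hi]
  · by_cases hi : i = M
    · rw [hi, gM, hTY]
    · rw [gne hi, t.ladder_Y, weightY_of_ne hi, one_smul]
  · by_cases hi : i = M
    · rw [hi, gM, hTv (gcore j), pairCoeff_of_ne (by omega), if_neg (by omega)]
      simp
    · by_cases hj : j = M
      · have h1 := h.bracket_tail_tail_eq_zero (.inr (by omega)) (t.ladder_mem i) hT
        rw [hj, gM, gne hi, h1, pairCoeff_of_ne (by omega), if_neg (by omega)]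
        simp
      · rw [gne hi, gne hj, hPP, gM]
        congr 1
        split_ifs <;> module

end WeightData
end Extension
end WeightBasis

/-! ### Normalising the nilradical, and matching models with the six algebras. -/

section Classification

variable {L : Type*} [AddCommGroup L] [Module ℂ L]

namespace NilTable

variable {br : Mul₂ L} {M : ℕ} {α β γ : ℂ} {E U x y : L} {g : ℕ → L}

/-- Given `M = 1`, a multiple of `E` is added to `g 0` to make its square vanish. -/
theorem exists_extension_one (t : NilTable br 1 0 1 β γ E U g) (h : Frame 1 E U x y g)
    (hL : IsLeibniz br) (hI : IsIdeal br (core E U g)) :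
    ∃ β' g', Extension br 1 0 1 β' 0 E U x y g' ∧ core E U g' = core E U g := by
  -- Modulo `U` the nilradical is a Heisenberg algebra, in which no line is distinguished. The form
  -- at `g 0 + r E` is `r² + β r + γ`, so a root `r` makes the new `g 0` isotropic.
  obtain ⟨s, hs⟩ := IsAlgClosed.exists_eq_mul_self (β ^ 2 - 4 * γ)
  obtain ⟨r, hr⟩ : ∃ r, r * r + β * r + γ = 0 :=
    ⟨(s - β) / 2, by linear_combination -hs / 4⟩
  set g' : ℕ → L := fun i => g i + (if i = 0 then r else 0) • E + (if i = 1 then r else 0) • U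
    with hg'
  have hg2 : ∀ i, g (i + 1 + 1) = 0 := fun i => h.g_zero _ (by omega)
  have hc : core E U g' = core E U g := by
    apply le_antisymm
    · exact core_le (f_mem_core _ _ _) (u_mem_core _ _ _) fun i => add_mem (add_mem
        (g_mem_core _ _ _ _) (smul_mem _ _ (f_mem_core _ _ _))) (smul_mem _ _ (u_mem_core _ _ _))
    · refine core_le (f_mem_core _ _ _) (u_mem_core _ _ _) fun i => ?_
      have h1 := sub_mem (sub_mem (g_mem_core E U g' i)
        (smul_mem _ (if i = 0 then r else 0) (f_mem_core E U g')))
        (smul_mem _ (if i = 1 then r else 0) (u_mem_core E U g'))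
      convert h1 using 1
      simp only [hg']
      module
  have hF : Frame 1 E U x y g' := h.of_core_eq hc fun i hi => by
    simp [hg', h.g_zero i hi, show i ≠ 0 by omega, show i ≠ 1 by omega]
  refine ⟨β + 2 * r, g', ⟨hF, ⟨?_, ?_, ?_, ?_, ?_, ?_, ?_, ?_, ?_⟩, le_rfl, hL, by rwa [hc],
    .inl one_ne_zero, .inl rfl, fun _ => rfl⟩, hc⟩
  · exact t.EE
  · exact t.EU
  · rintro (_ | _ | i) <;> simp [hg', t.EE, t.EU, t.Eg, hg2]
    module
  · exact t.UE
  · exact t.UU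
  · intro i
    simp [hg', t.UE, t.UU, t.Ug, -ite_smul]
  · rintro (_ | _ | i) <;> simp [hg', t.EE, t.UE, t.gE, hg2]
  · intro i
    simp [hg', t.gU, t.EU, t.UU, -ite_smul]
  · rintro (_ | _ | i) (_ | _ | j) <;>
      simp [hg', pairCoeff, t.EE, t.EU, t.Eg, t.UE, t.UU, t.Ug, t.gE, t.gU, t.gg, hg2]
    linear_combination (norm := module) hr • U

/-- Given `M = 2` and `α = 1`, the vectors `E` and `g 0` are exchanged to make `α` vanish. -/
theorem exists_extension_two (t : NilTable br 2 1 1 β γ E U g) (h : Frame 2 E U x y g)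
    (hL : IsLeibniz br) (hI : IsIdeal br (core E U g)) :
    ∃ δ' β' γ' E' g', Extension br 2 0 δ' β' γ' E' U x y g' ∧ core E' U g' = core E U g := by
  -- The invariant line here is that of `E - g 0`, since `[g 1, E - g 0] = 0`. It becomes the new `g
  -- 0`, with the old `g 0` as the new `E`; the `U`-term at `i = 1` ensures that the new `g 1` is
  -- exactly the product of these two.
  set g' : ℕ → L := fun i => (if i = 0 then (1 : ℂ) else 0) • E - g i
    + (if i = 1 then β - γ else 0) • U with hg'
  have hg3 : ∀ i, g (i + 1 + 1 + 1) = 0 := fun i => h.g_zero _ (by omega)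
  have hc : core (g 0) U g' = core E U g := by
    have hU := u_mem_core (g 0) U g'
    have hg0 := f_mem_core (g 0) U g'
    have hE : E ∈ core (g 0) U g' := by
      have h1 := add_mem (g_mem_core (g 0) U g' 0) hg0
      simpa [hg'] using h1
    apply le_antisymm
    · exact core_le (g_mem_core _ _ _ _) (u_mem_core _ _ _) fun i => add_mem (sub_mem
        (smul_mem _ _ (f_mem_core _ _ _)) (g_mem_core _ _ _ _)) (smul_mem _ _ (u_mem_core _ _ _))
    · refine core_le hE hU fun i => ?_
      have h1 := sub_mem (add_mem (smul_mem _ (if i = 0 then (1 : ℂ) else 0) hE)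
        (smul_mem _ (if i = 1 then β - γ else 0) hU)) (g_mem_core (g 0) U g' i)
      convert h1 using 1
      simp only [hg']
      module
  have hF : Frame 2 (g 0) U x y g' := h.of_core_eq hc fun i hi => by
    simp [hg', h.g_zero i hi, show i ≠ 0 by omega, show i ≠ 1 by omega]
  refine ⟨γ, β - 2 * γ, 1 - β + γ, g 0, g', ⟨hF, ⟨?_, ?_, ?_, ?_, ?_, ?_, ?_, ?_, ?_⟩,
    one_le_two, hL, by rwa [hc], ?_, .inl rfl, by simp⟩, hc⟩
  · simp [t.gg, pairCoeff]
  · exact t.gU 0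
  · rintro (_ | _ | _ | i) <;> simp [hg', pairCoeff, t.gE, t.gU, t.gg, hg3]
    module
  · exact t.Ug 0
  · exact t.UU
  · intro i
    simp [hg', t.UE, t.UU, t.Ug, -ite_smul]
  · rintro (_ | _ | _ | i) <;> simp [hg', pairCoeff, t.Eg, t.Ug, t.gg, hg3]
    module
  · intro i
    simp [hg', t.gU, t.EU, t.UU, -ite_smul]
  · rintro (_ | _ | _ | i) (_ | _ | _ | j) <;>
      simp [hg', pairCoeff, t.EE, t.EU, t.Eg, t.UE, t.UU, t.Ug, t.gE, t.gU, t.gg, hg3]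
    module
  -- The three new coefficients add up to `1`, the value of the form at the old `E`.
  · by_contra! hz
    obtain ⟨h1, h2, h3⟩ := hz
    exact one_ne_zero (α := ℂ) (by linear_combination h3 + h2 + h1)

/-- Only `M = 1`, and `M = 2` with `α = 1`, need a change of basis. For all other `M` the given
basis already satisfies `Extension`, as an even `M` different from `2` is at least `4`. -/
theorem exists_extension (t : NilTable br M α 1 β γ E U g) (h : Frame M E U x y g) (hM : 1 ≤ M)
    (hα : α = 0 ∨ α = 1 ∧ Even M) (hL : IsLeibniz br) (hI : IsIdeal br (core E U g)) :
    ∃ α' δ' β' γ' E' g', Extension br M α' δ' β' γ' E' U x y g' ∧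
      core E' U g' = core E U g := by
  by_cases h1 : M = 1
  · subst h1
    have h0 : α = 0 := hα.resolve_right fun h => absurd h.2 (by decide)
    subst h0
    obtain ⟨β', g', hg⟩ := t.exists_extension_one h hL hI
    exact ⟨_, _, _, _, _, _, hg⟩
  · rcases hα with h0 | ⟨h0, he⟩
    · exact ⟨α, 1, β, γ, E, g, ⟨h, t, hM, hL, hI, .inl one_ne_zero, .inl h0,
        fun h => absurd h h1⟩, rfl⟩
    · by_cases h2 : M = 2
      · subst h2 h0
        obtain ⟨δ', β', γ', E', g', hg⟩ := t.exists_extension_two h hL hI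
        exact ⟨_, _, _, _, _, _, hg⟩
      · have h4 : 4 ≤ M := by obtain ⟨k, rfl⟩ := he; omega
        exact ⟨α, 1, β, γ, E, g, ⟨h, t, hM, hL, hI, .inl one_ne_zero, .inr ⟨h0, he, h4⟩,
          fun h => absurd h h1⟩, rfl⟩

end NilTable

theorem exists_frame [FiniteDimensional ℂ L] {M : ℕ} {E U : L} {g : ℕ → L}
    {Q : Submodule ℂ L} (hg : ∀ i, M < i → g i = 0) (hN : finrank ℂ (core E U g) = M + 3)
    (hc : IsCompl (core E U g) Q) (hQ : finrank ℂ Q = 2) : ∃ x y, Frame M E U x y g := by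
  let b := finBasisOfFinrankEq ℂ Q hQ
  refine ⟨b 0, b 1, hg, ?_, ?_⟩
  · set S := span ℂ ({E, U, (b 0 : L), (b 1 : L)} ∪ Set.range g)
    have h1 : core E U g ≤ S := by
      refine core_le (subset_span (by simp)) (subset_span (by simp)) fun i => subset_span (by simp)
    have h2 : Q ≤ S := by
      intro v hv
      have h3 := congrArg Subtype.val (b.sum_repr ⟨v, hv⟩)
      rw [Fin.sum_univ_two] at h3
      rw [← show _ = v from h3]
      exact add_mem (smul_mem _ _ (subset_span (by simp))) (smul_mem _ _ (subset_span (by simp)))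
    exact eq_top_iff.2 (hc.sup_eq_top.ge.trans (sup_le h1 h2))
  · rw [← finrank_add_eq_of_isCompl hc, hN, hQ]

theorem exists_model_of_hasNilradicalCodimTwo [FiniteDimensional ℂ L] {br : Mul₂ L} {M : ℕ}
    (hM : 1 ≤ M) {α β γ : ℂ} (hα : α = 0 ∨ α = 1 ∧ Even M)
    (h : HasNilradicalCodimTwo br (G (M + 3) α β γ)) :
    ∃ a b c ε f u x y g, Model br M a b c ε f u x y g := by
  obtain ⟨hL, hs, N, Q, hN, ⟨φ, hφ⟩, hc, hQ⟩ := h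
  have tG : NilTable (G (M + 3) α β γ) M α 1 β γ (e 1) (e 2) (eShift M) :=
    nilTable_ofTable hM le_rfl α β γ fun _ _ _ _ => rfl
  set ψ := N.subtype ∘ₗ φ.toLinearMap
  have t : NilTable br M α 1 β γ (ψ (e 1)) (ψ (e 2)) fun i => ψ (eShift M i) := tG.map ψ hφ
  have hcore : core (ψ (e 1)) (ψ (e 2)) (fun i => ψ (eShift M i)) = N := by
    rw [← map_core, core_e, Submodule.map_top, LinearMap.range_comp, LinearEquiv.range,
      Submodule.map_top, range_subtype]
  obtain ⟨x, y, hF⟩ := exists_frame (M := M) (E := ψ (e 1)) (U := ψ (e 2))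
    (g := fun i => ψ (eShift M i)) (Q := Q)
    (fun i hi => by rw [eShift_of_lt hi, map_zero])
    (by rw [hcore, ← φ.finrank_eq, finrank_fin_fun]) (by rwa [hcore]) hQ
  obtain ⟨α', δ', β', γ', E', g', hX, hXc⟩ := t.exists_extension hF hM hα hL
    (by rw [hcore]; exact hN.1.1)
  have hN' : IsNilradical br (core E' (ψ (e 2)) g') := by rwa [hXc, hcore]
  obtain ⟨X, Y, f, G, hW⟩ := hX.exists_weightData hN' hs
  obtain ⟨a, b, c, u, g, hmodel⟩ := hW.exists_model hN' hs
  exact ⟨_, _, _, _, _, _, _, _, _, hmodel⟩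

/-- The parameters `a, b, c, ε` of the six algebras. -/
def params : Fin 6 → ℂ × ℂ × ℂ × ℂ :=
  ![(1, 0, 0, 0), (0, 1, 0, 0), (0, 0, 1, 0), (1, 0, 0, 1), (0, 1, 0, 1), (0, 0, 1, 1)]

theorem params_injective : Function.Injective params := by
  intro k l h
  fin_cases k <;> fin_cases l <;> simp [params] at h ⊢

theorem exists_params_eq {a b c ε : ℂ} {n : ℕ}
    (h : (a = 1 ∧ b = 0 ∧ c = 0) ∨ (a = 0 ∧ b = 1 ∧ c = 0) ∨ (a = 0 ∧ b = 0 ∧ c = 1))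
    (hε : ε = 0 ∨ ε = 1 ∧ Odd n) : ∃ k, Occurs n k ∧ params k = (a, b, c, ε) := by
  rcases hε with rfl | ⟨rfl, ho⟩
  · rcases h with ⟨rfl, rfl, rfl⟩ | ⟨rfl, rfl, rfl⟩ | ⟨rfl, rfl, rfl⟩
    exacts [⟨0, by simp [Occurs], rfl⟩, ⟨1, by simp [Occurs], rfl⟩, ⟨2, by simp [Occurs], rfl⟩]
  · rcases h with ⟨rfl, rfl, rfl⟩ | ⟨rfl, rfl, rfl⟩ | ⟨rfl, rfl, rfl⟩
    exacts [⟨3, fun _ => ho, rfl⟩, ⟨4, fun _ => ho, rfl⟩, ⟨5, fun _ => ho, rfl⟩]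

theorem exists_isStandard {M : ℕ} (hM : 1 ≤ M) (k : Fin 6) (hk : Occurs (M + 3) k) :
    ∃ α β γ, GH (M + 3) k = G (M + 3) α β γ ∧ α = (params k).2.2.2 ∧
      IsStandard M (H (M + 3) k) α β γ (params k).1 (params k).2.1 (params k).2.2.1 := by
  have he : 3 ≤ (k : ℕ) → Even M := fun h => by
    have := hk h
    grind
  fin_cases k
  · exact ⟨_, _, _, rfl, rfl, isStandard_H1 hM⟩
  · exact ⟨_, _, _, rfl, rfl, isStandard_H2 hM⟩
  · exact ⟨_, _, _, rfl, rfl, isStandard_H3 hM⟩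
  · exact ⟨_, _, _, rfl, rfl, isStandard_H4 hM (he le_rfl)⟩
  · exact ⟨_, _, _, rfl, rfl, isStandard_H5 hM (he (by decide))⟩
  · exact ⟨_, _, _, rfl, rfl, isStandard_H6 hM (he (by decide))⟩

theorem exists_model_H {M : ℕ} (hM : 1 ≤ M) (k : Fin 6) (hk : Occurs (M + 3) k) :
    ∃ f u x y g, Model (H (M + 3) k) M (params k).1 (params k).2.1 (params k).2.2.1
      (params k).2.2.2 f u x y g := by
  obtain ⟨α, β, γ, _, hα, _, σ, h⟩ := exists_isStandard hM k hk
  rw [hα] at h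
  exact ⟨_, _, _, _, _, h⟩

end Classification

end LeibnizAlg

theorem theorem3p12 (n : ℕ) (hn : 4 ≤ n) :
    (∀ (R : Type*) [AddCommGroup R] [Module ℂ R] [FiniteDimensional ℂ R]
        (br : LeibnizAlg.Mul₂ R) (α β γ : ℂ),
        (α = 0 ∨ (α = 1 ∧ Odd n)) →
        LeibnizAlg.HasNilradicalCodimTwo br (LeibnizAlg.G n α β γ) →
        ∃ k : Fin 6, LeibnizAlg.Occurs n k ∧ LeibnizAlg.Iso br (LeibnizAlg.H n k)) ∧
    (∀ k : Fin 6, LeibnizAlg.Occurs n k →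
        LeibnizAlg.HasNilradicalCodimTwo (LeibnizAlg.H n k) (LeibnizAlg.GH n k)) ∧
    (6 ≤ n → ∀ k l : Fin 6, LeibnizAlg.Occurs n k → LeibnizAlg.Occurs n l → k ≠ l →
        ¬ LeibnizAlg.Iso (LeibnizAlg.H n k) (LeibnizAlg.H n l)) := by
  obtain ⟨M, rfl⟩ : ∃ M, n = M + 3 := ⟨n - 3, by omega⟩
  have hM : 1 ≤ M := by omega
  have hodd : Odd (M + 3) ↔ Even M := by grind
  refine ⟨fun R _ _ _ br α β γ hα h => ?_, fun k hk => ?_, fun h6 k l hk hl hkl hiso => ?_⟩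
  · rw [hodd] at hα
    obtain ⟨a, b, c, ε, f, u, x, y, g, hmodel⟩ :=
      LeibnizAlg.exists_model_of_hasNilradicalCodimTwo hM hα h
    have heps := hmodel.eps
    rw [← hodd] at heps
    obtain ⟨k, hk, hp⟩ := LeibnizAlg.exists_params_eq hmodel.type heps
    obtain ⟨f', u', x', y', g', hH⟩ := LeibnizAlg.exists_model_H hM k hk
    rw [hp] at hH
    exact ⟨k, hk, hmodel.iso hH⟩
  · obtain ⟨α, β, γ, hG, _, t, σ, hH⟩ := LeibnizAlg.exists_isStandard hM k hk
    rw [hG]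
    refine hH.hasNilradicalCodimTwo ?_
    rw [LeibnizAlg.core_shiftOne]
    exact LeibnizAlg.subIso_core hM t
  · obtain ⟨f, u, x, y, g, hk⟩ := LeibnizAlg.exists_model_H hM k hk
    obtain ⟨f', u', x', y', g', hl⟩ := LeibnizAlg.exists_model_H hM l hl
    obtain ⟨h1, h2, h3, h4⟩ := hk.params_of_iso hl (by omega) hiso
    exact hkl (LeibnizAlg.params_injective (Prod.ext h1 (Prod.ext h2 (Prod.ext h3 h4))))
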